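/- For a polynomial $f=\sum c_{\alpha,\beta}x^\alpha y^\beta\in\mathbb C[x^{-1},x,y]$ let $\mathrm{Supp} f\subset\mathbb Z^2$ be its support, and let $\chi_c$ denote the Euler characteristic with compact supports, $\chi_c(X)=\sum_n(-1)^n\dim H^n_c(X;\mathbb Q)$, for the classical topology. The one-dimensional faces of the Newton polygon at the origin $\mathcal N(f)$ are the segments joining consecutive vertices of the convex hull of $\mathrm{Supp} f+\mathbb R_{\ge 0}^2$. Those of the global Newton polygon $\overline{\mathcal N}(f)$ are the edges of the convex hull of $\mathrm{Supp} f$ (the segment itself, if this hull is a segment). For $f\in\mathbb C[x,y]$ put $E=\mathrm{Supp} f\cup\{(0,0)\}$ and let $V_{0,\infty}$, $V_{\infty,\infty}$, $V_{\infty,0}$ be the sets of vertices of the convex hulls of $E+(\mathbb R_{\ge0}\times\mathbb R_{\le0})$, $E+(\mathbb R_{\le0}\times\mathbb R_{\le0})$, $E+(\mathbb R_{\le0}\times\mathbb R_{\ge0})$; the one-dimensional faces of the Newton polygon at infinity $\mathcal N_\infty(f)$ are the segments joining two consecutive points of $V_{0,\infty}\cup V_{\infty,\infty}$, ordered by the first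 coordinate, or two consecutive points of $V_{\infty,\infty}\cup V_{\infty,0}$, ordered by the second coordinate. For a segment $\gamma=[v,w]$ with distinct end points in $\mathbb Z^2$ let $\mathcal S_\gamma=|\det(v,w)|/2$, let $s_\gamma$ be the number of integer points of $\gamma$ other than $v,w$, let $f_\gamma$ be the sum of the terms of $f$ with exponent on $\gamma$, and let $r_\gamma$ be the number of its distinct roots, that is, of the $\mu\in\mathbb C^*$ such that $f_\gamma$ vanishes on the curve $x^{e_1}y^{e_2}=\mu$ of $(\mathbb C^*)^2$, where $(e_1,e_2)$ is the primitive integer vector in the direction $w-v$. For a polygon $\mathcal N$ as above the area of $\mathcal N$ with respect to $f$ is $$\mathcal S_{\mathcal N,f}=\sum_{\gamma}\frac{r_\gamma\,\mathcal S_\gamma}{s_\gamma+1},$$ the sum over the one-dimensional faces $\gamma$ of $\mathcal N$. **Proposition (quasi-homogeneous case).** 1. Let $f=x^ay^b$ with $a\in\mathbb Z\setminus\{0\}$ and $b\in\mathbb Z_{>0}$. Then $$\chi_c\bigl(f^{-1}(1)\cap(\mathbb C^*)^2\bigr)=\chi_c\bigl(f^{-1}(1)\bigr)=0,$$ where $f^{-1}(1)$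 is taken in $\mathbb C^*\times\mathbb C$, or in $\mathbb C^2$ if $a>0$. 2. Let $a\in\mathbb Z$, $b\in\mathbb Z_{\ge0}$, let $p,q$ be coprime positive integers, $r\ge1$, $\mu_1,\dots,\mu_r\in\mathbb C^*$ pairwise distinct, $\nu_1,\dots,\nu_r$ positive integers and $n=\sum_{i=1}^r\nu_i$. (a) If $f=x^ay^b\prod_{i=1}^r(x^q-\mu_iy^p)^{\nu_i}$, then $$\chi_c\bigl(f^{-1}(1)\cap(\mathbb C^*)^2\bigr)=-\frac{2r\mathcal S}{n}=-2\,\mathcal S_{\mathcal N(f),f},$$ where $\mathcal S$ is the area of the (possibly degenerate) triangle with vertices $(0,0)$, $(a+qn,b)$, $(a,b+pn)$. (b) If $f=x^ay^b\prod_{i=1}^r(x^qy^p-\mu_i)^{\nu_i}$, then $$\chi_c\bigl(f^{-1}(1)\cap(\mathbb C^*)^2\bigr)=-\frac{2r\mathcal S}{n}=-2\,\mathcal S_{\overline{\mathcal N}(f),f},$$ where $\mathcal S$ is the area of the (possibly degenerate) triangle with vertices $(0,0)$, $(a,b)$, $(a+qn,b+pn)$. In both cases, if moreover $f\in\mathbb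 C[x,y]$, then $\chi_c\bigl(f^{-1}(1)\cap(\mathbb C^*)^2\bigr)=-2\,\mathcal S_{\mathcal N_\infty(f),f}$. -/

import Mathlib

open scoped Topology Pointwise

noncomputable section

/-! ### Alexander–Spanier cohomology with compact supports and the Euler characteristic `χ_c` -/

namespace CompactSupp

variable (X : Type*)

/-- Alexander–Spanier `n`-cochains: arbitrary rational functions on `X ^ (n + 1)`. -/
abbrev Cochain (n : ℕ) : Type _ := (Fin (n + 1) → X) → ℚ

variable {X}

/-- The coboundary `(δ φ)(x₀, …, xₙ₊₁) = ∑ i, (-1) ^ i φ(x₀, …, x̂ᵢ, …, xₙ₊₁)`. -/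
def coboundary (n : ℕ) : Cochain X n →ₗ[ℚ] Cochain X (n + 1) where
  toFun φ p := ∑ i : Fin (n + 2), (-1 : ℚ) ^ (i : ℕ) * φ (fun j => p (i.succAbove j))
  map_add' φ ψ := by
    funext p
    simp [mul_add, Finset.sum_add_distrib]
  map_smul' c φ := by
    funext p
    simp [Finset.mul_sum, mul_left_comm]

variable [TopologicalSpace X]

/-- `φ` vanishes on all tuples of points of some neighbourhood of `x`. -/
def LocallyZeroAt {n : ℕ} (φ : Cochain X n) (x : X) : Prop :=
  ∃ U ∈ 𝓝 x, ∀ p : Fin (n + 1) → X, (∀ i, p i ∈ U) → φ p = 0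

theorem LocallyZeroAt.zero {n : ℕ} (x : X) : LocallyZeroAt (0 : Cochain X n) x :=
  ⟨Set.univ, Filter.univ_mem, fun _ _ => rfl⟩

theorem LocallyZeroAt.add {n : ℕ} {φ ψ : Cochain X n} {x : X}
    (hφ : LocallyZeroAt φ x) (hψ : LocallyZeroAt ψ x) : LocallyZeroAt (φ + ψ) x := by
  obtain ⟨U, hU, h⟩ := hφ
  obtain ⟨V, hV, h'⟩ := hψ
  refine ⟨U ∩ V, Filter.inter_mem hU hV, fun p hp => ?_⟩
  simp [h p fun i => (hp i).1, h' p fun i => (hp i).2]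

theorem LocallyZeroAt.smul {n : ℕ} {φ : Cochain X n} {x : X} (c : ℚ)
    (hφ : LocallyZeroAt φ x) : LocallyZeroAt (c • φ) x := by
  obtain ⟨U, hU, h⟩ := hφ
  exact ⟨U, hU, fun p hp => by simp [h p hp]⟩

variable (X)

/-- The locally zero cochains. -/
def locallyZero (n : ℕ) : Submodule ℚ (Cochain X n) where
  carrier := {φ | ∀ x, LocallyZeroAt φ x}
  add_mem' hφ hψ x := (hφ x).add (hψ x)
  zero_mem' x := LocallyZeroAt.zero x
  smul_mem' c _ hφ x := (hφ x).smul c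

/-- The cochains with compact support: those that are locally zero outside a compact set. -/
def compactlySupported (n : ℕ) : Submodule ℚ (Cochain X n) where
  carrier := {φ | ∃ K : Set X, IsCompact K ∧ ∀ x, x ∉ K → LocallyZeroAt φ x}
  add_mem' := by
    rintro φ ψ ⟨K, hK, h⟩ ⟨L, hL, h'⟩
    refine ⟨K ∪ L, hK.union hL, fun x hx => ?_⟩
    exact (h x fun hxK => hx (Or.inl hxK)).add (h' x fun hxL => hx (Or.inr hxL))
  zero_mem' := ⟨∅, isCompact_empty, fun x _ => LocallyZeroAt.zero x⟩
  smul_mem' := by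
    rintro c φ ⟨K, hK, h⟩
    exact ⟨K, hK, fun x hx => (h x hx).smul c⟩

/-- Representatives of the `n`-cocycles of the complex
`compactlySupported X / locallyZero X`. -/
def cocycles (n : ℕ) : Submodule ℚ (Cochain X n) :=
  compactlySupported X n ⊓ (locallyZero X (n + 1)).comap (coboundary n)

/-- Representatives of the `n`-coboundaries of the complex
`compactlySupported X / locallyZero X`. -/
def coboundaries : (n : ℕ) → Submodule ℚ (Cochain X n)
  | 0 => locallyZero X 0
  | n + 1 => (compactlySupported X n).map (coboundary n) ⊔ locallyZero X (n + 1)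

/-- `H_c^n(X; ℚ)`: the Alexander–Spanier cohomology with compact supports, that is, the cohomology
of the cochain complex `compactlySupported X / locallyZero X`. -/
abbrev Cohomology (n : ℕ) : Type _ :=
  cocycles X n ⧸ (coboundaries X n).submoduleOf (cocycles X n)

/-- The total cohomology `⨁ n, H_c^n(X; ℚ)` has finite dimension, so that `χ_c(X)` is defined. -/
def FiniteCohomology : Prop :=
  (∀ n, Module.Finite ℚ (Cohomology X n)) ∧ ∃ N, ∀ n, N ≤ n → Subsingleton (Cohomology X n)

/-- `χ_c(X) = ∑ n, (-1) ^ n dim H_c^n(X; ℚ)`, meaningful if `FiniteCohomology X`. -/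
def eulerChar : ℤ :=
  ∑ᶠ n : ℕ, (-1 : ℤ) ^ n * (Module.finrank ℚ (Cohomology X n) : ℤ)

/-- `χ_c(X)` is defined and equal to the real number `c`. -/
def HasEulerChar (c : ℝ) : Prop :=
  FiniteCohomology X ∧ (eulerChar X : ℝ) = c

end CompactSupp

/-! ### The ring `ℂ[x⁻¹, x, y]` -/

namespace NewtonPolygon

/-- The ring `ℂ[x⁻¹, x, y]`; the exponent `(α, β)` stands for `x ^ α y ^ β`. -/
abbrev LaurentPoly : Type := AddMonoidAlgebra ℂ (ℤ × ℕ)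

/-- The term `c x ^ a y ^ b`. -/
def term (c : ℂ) (a : ℤ) (b : ℕ) : LaurentPoly := AddMonoidAlgebra.single (a, b) c

/-- The value `f(x, y)`, where `x ≠ 0` or `f` has no negative power of `x`. -/
def eval (f : LaurentPoly) (x y : ℂ) : ℂ :=
  ∑ m ∈ f.coeff.support, f.coeff m * x ^ m.1 * y ^ m.2

/-- `f` belongs to `ℂ[x, y]`. -/
def IsPoly (f : LaurentPoly) : Prop := ∀ m ∈ f.coeff.support, 0 ≤ m.1

/-- `f⁻¹(1) ∩ 𝔾ₘ²`, with the topology induced by `ℂ²`. -/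
def torusFiber (f : LaurentPoly) : Set (ℂ × ℂ) :=
  {z | z.1 ≠ 0 ∧ z.2 ≠ 0 ∧ eval f z.1 z.2 = 1}

/-- `f⁻¹(1)` in `𝔾ₘ × 𝔸¹`, the variety on which `f` in `ℂ[x⁻¹, x, y]` is a function. -/
def fiber (f : LaurentPoly) : Set (ℂ × ℂ) :=
  {z | z.1 ≠ 0 ∧ eval f z.1 z.2 = 1}

/-- `f⁻¹(1)` in `𝔸²`, for `f` in `ℂ[x, y]`. -/
def affineFiber (f : LaurentPoly) : Set (ℂ × ℂ) :=
  {z | eval f z.1 z.2 = 1}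

/-! ### Newton polygons -/

/-- The inclusion of `ℤ²` in `ℝ²`. -/
def toPlane (v : ℤ × ℤ) : ℝ × ℝ := ((v.1 : ℝ), (v.2 : ℝ))

/-- The support of `f` as a subset of `ℤ²`. -/
def supp (f : LaurentPoly) : Set (ℤ × ℤ) :=
  (fun m : ℤ × ℕ => (m.1, (m.2 : ℤ))) '' (f.coeff.support : Set (ℤ × ℕ))

/-- The smallest convex set containing `E + Q`. -/
def diagram (E : Set (ℤ × ℤ)) (Q : Set (ℝ × ℝ)) : Set (ℝ × ℝ) :=
  convexHull ℝ (toPlane '' E + Q)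

/-- The set of vertices of `diagram E Q`. -/
def vertices (E : Set (ℤ × ℤ)) (Q : Set (ℝ × ℝ)) : Set (ℤ × ℤ) :=
  {v | toPlane v ∈ (diagram E Q).extremePoints ℝ}

/-- `v` and `w` are consecutive elements of `V`, ordered by the function `g`. -/
def Consecutive (g : ℤ × ℤ → ℤ) (V : Set (ℤ × ℤ)) (v w : ℤ × ℤ) : Prop :=
  v ∈ V ∧ w ∈ V ∧ g v < g w ∧ ∀ u ∈ V, ¬ (g v < g u ∧ g u < g w)

/-- The lexicographic order, used to list each segment `[v, w]` once. -/
def LexLt (v w : ℤ × ℤ) : Prop := v.1 < w.1 ∨ (v.1 = w.1 ∧ v.2 < w.2)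

/-- The vertices of the Newton diagram of `f` at the origin, that is, of the smallest convex set
containing `Supp f + ℝ₊²`. -/
def originVertices (f : LaurentPoly) : Set (ℤ × ℤ) :=
  vertices (supp f) (Set.Ici 0 ×ˢ Set.Ici 0)

/-- The one-dimensional faces `[v, w]` of the Newton polygon at the origin `𝒩(f)`. -/
def originFaces (f : LaurentPoly) : Set ((ℤ × ℤ) × (ℤ × ℤ)) :=
  {γ | Consecutive Prod.fst (originVertices f) γ.1 γ.2}

/-- The one-dimensional faces `[v, w]` of the global Newton polygon of `f`, that is, of the convex
hull of `Supp f` (which is its own face if it is a segment). -/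
def globalFaces (f : LaurentPoly) : Set ((ℤ × ℤ) × (ℤ × ℤ)) :=
  {γ | LexLt γ.1 γ.2 ∧ IsExtreme ℝ (convexHull ℝ (toPlane '' supp f))
    (segment ℝ (toPlane γ.1) (toPlane γ.2))}

/-- `V_{0,∞}` for the set `Supp f ∪ {(0, 0)}`. -/
def verticesZeroInf (f : LaurentPoly) : Set (ℤ × ℤ) :=
  vertices (insert 0 (supp f)) (Set.Ici 0 ×ˢ Set.Iic 0)

/-- `V_{∞,∞}` for the set `Supp f ∪ {(0, 0)}`. -/
def verticesInfInf (f : LaurentPoly) : Set (ℤ × ℤ) :=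
  vertices (insert 0 (supp f)) (Set.Iic 0 ×ˢ Set.Iic 0)

/-- `V_{∞,0}` for the set `Supp f ∪ {(0, 0)}`. -/
def verticesInfZero (f : LaurentPoly) : Set (ℤ × ℤ) :=
  vertices (insert 0 (supp f)) (Set.Iic 0 ×ˢ Set.Ici 0)

/-- The one-dimensional faces of the Newton polygon at infinity `𝒩_∞(f)` of `f` in `ℂ[x, y]`: the
segments between consecutive vertices at infinity, where `V_{0,∞} ∪ V_{∞,∞}` is ordered by the
first coordinate and `V_{∞,∞} ∪ V_{∞,0}` by the second one. -/
def infinityFaces (f : LaurentPoly) : Set ((ℤ × ℤ) × (ℤ × ℤ)) :=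
  {γ | LexLt γ.1 γ.2 ∧
    (Consecutive Prod.fst (verticesZeroInf f ∪ verticesInfInf f) γ.1 γ.2 ∨
      Consecutive Prod.snd (verticesInfInf f ∪ verticesInfZero f) γ.1 γ.2 ∨
      Consecutive Prod.snd (verticesInfInf f ∪ verticesInfZero f) γ.2 γ.1)}

/-! ### The area of a Newton polygon with respect to `f` -/

/-- The primitive vector with the direction of the segment `[v, w]`. -/
def direction (γ : (ℤ × ℤ) × (ℤ × ℤ)) : ℤ × ℤ :=
  ((γ.2.1 - γ.1.1) / Int.gcd (γ.2.1 - γ.1.1) (γ.2.2 - γ.1.2),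
    (γ.2.2 - γ.1.2) / Int.gcd (γ.2.1 - γ.1.1) (γ.2.2 - γ.1.2))

open Classical in
/-- The face polynomial `f_γ`: the part of `f` supported on the segment `γ = [v, w]`. -/
def facePoly (f : LaurentPoly) (γ : (ℤ × ℤ) × (ℤ × ℤ)) : LaurentPoly :=
  AddMonoidAlgebra.ofCoeff (f.coeff.filter fun m =>
    toPlane (m.1, (m.2 : ℤ)) ∈ segment ℝ (toPlane γ.1) (toPlane γ.2))

/-- The roots of the face polynomial `f_γ`. If `γ` has the primitive direction `(u, v)`, then
`f_γ` is a term times the product of the powers `(x ^ u y ^ v - μ) ^ ν`, for distinct `μ ≠ 0`;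
these `μ` are the ones such that `f_γ` vanishes on the curve `x ^ u y ^ v = μ` of the torus. -/
def faceRoots (f : LaurentPoly) (γ : (ℤ × ℤ) × (ℤ × ℤ)) : Set ℂ :=
  {μ | μ ≠ 0 ∧ ∀ x y : ℂ, x ≠ 0 → y ≠ 0 →
    x ^ (direction γ).1 * y ^ (direction γ).2 = μ → eval (facePoly f γ) x y = 0}

/-- The number of points with integer coordinates on `γ = [v, w]` other than `v` and `w`. -/
def interiorPoints (γ : (ℤ × ℤ) × (ℤ × ℤ)) : ℕ :=
  {u : ℤ × ℤ | toPlane u ∈ openSegment ℝ (toPlane γ.1) (toPlane γ.2)}.ncard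

/-- The area `|det(v, w)| / 2` of the face `γ = [v, w]`. -/
def faceArea (γ : (ℤ × ℤ) × (ℤ × ℤ)) : ℝ :=
  |((γ.1.1 * γ.2.2 - γ.1.2 * γ.2.1 : ℤ) : ℝ)| / 2

/-- The area with respect to `f` of the polygon with the one-dimensional faces `F`:
the sum of the numbers `r_γ S_γ / (s_γ + 1)`, with `r_γ` the number of distinct roots of `f_γ`,
`S_γ` the area of `γ` and `s_γ` the number of its interior integer points. -/
def areaWrt (F : Set ((ℤ × ℤ) × (ℤ × ℤ))) (f : LaurentPoly) : ℝ :=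
  ∑ᶠ γ ∈ F, ((faceRoots f γ).ncard : ℝ) * faceArea γ / ((interiorPoints γ : ℝ) + 1)

/-- The area (Lebesgue measure) of the triangle with the vertices `(0, 0)`, `v` and `w`. -/
def triangleArea (v w : ℤ × ℤ) : ℝ :=
  MeasureTheory.volume.real (convexHull ℝ {0, toPlane v, toPlane w})

/-- `x ^ a y ^ b ∏ (x ^ q - μ_i y ^ p) ^ ν_i` -/
def formDiff (a : ℤ) (b p q : ℕ) {r : ℕ} (μ : Fin r → ℂ) (ν : Fin r → ℕ) : LaurentPoly :=
  term 1 a b * ∏ i, (term 1 (q : ℤ) 0 - term (μ i) 0 p) ^ ν i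

/-- `x ^ a y ^ b ∏ (x ^ q y ^ p - μ_i) ^ ν_i` -/
def formProd (a : ℤ) (b p q : ℕ) {r : ℕ} (μ : Fin r → ℂ) (ν : Fin r → ℕ) : LaurentPoly :=
  term 1 a b * ∏ i, (term 1 (q : ℤ) p - term (μ i) 0 0) ^ ν i

end NewtonPolygon

end

/-!
A unimodular monomial change of coordinates of the torus turns the curve
`x ^ a y ^ b ∏ (x ^ e₁ y ^ e₂ - μ_i) ^ ν_i = 1` into `s ^ M * G t = 1`, where
`G = t ^ N ∏ (t - μ_i) ^ ν_i` and `M = ± det ((a, b), e)`. For `M ≠ 0` the projection to `t` is an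
`|M|`-sheeted covering of `ℂ^*` minus the `r` points `μ_i`, whence `χ_c = -|M| r`; for `M = 0` the
curve is a finite union of copies of `ℂ^*`. In terms of the Newton polygon, `|M| / 2` is the area
of the triangle spanned by the origin and one lattice unit of the edge which carries `f`. Every
further face of the polygon at infinity lies on a line through the origin and has area zero.

The Euler characteristic of the covering comes from the Mayer–Vietoris sequence of two open sets.
Compact convex sets have the cohomology of a point, and removing a closed convex piece from one of
them leaves no cohomology at all, so that inclusion and exclusion along the sides of a triangle
gives `χ_c = 1` for an open planar cell. The vertical and the horizontal line through a puncture cut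
the plane into smaller cells, and the covering is trivial over a cell without punctures.
-/

namespace CompactSupp

/-! ### Cochains and the prism operator -/

section Tuples

variable {X Y : Type*}

/-- The coboundary on functions of `m`-tuples, where `m = 0` is allowed: this is the augmentation
for `m = 0`, and `coboundary n` for `m = n + 1`. -/
def tupleCoboundary (m : ℕ) : ((Fin m → X) → ℚ) →ₗ[ℚ] ((Fin (m + 1) → X) → ℚ) where
  toFun φ p := ∑ i : Fin (m + 1), (-1 : ℚ) ^ (i : ℕ) * φ (fun j => p (i.succAbove j))
  map_add' φ ψ := by
    funext p
    simp [mul_add, Finset.sum_add_distrib]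
  map_smul' c φ := by
    funext p
    simp [Finset.mul_sum, mul_left_comm]

theorem tupleCoboundary_succ (n : ℕ) (φ : Cochain X n) :
    tupleCoboundary (n + 1) φ = coboundary n φ := rfl

/-- The contraction of a cochain by a point. -/
def contract {m : ℕ} (x : X) (φ : (Fin (m + 1) → X) → ℚ) : (Fin m → X) → ℚ :=
  fun p => φ (Fin.cons x p)

theorem contract_sub {m : ℕ} (x : X) (φ ψ : (Fin (m + 1) → X) → ℚ) :
    contract x (φ - ψ) = contract x φ - contract x ψ := rfl

theorem tupleCoboundary_zero_apply (φ : (Fin 0 → X) → ℚ) (p : Fin 1 → X) (q : Fin 0 → X) :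
    tupleCoboundary 0 φ p = φ q := by
  change ∑ i : Fin 1, (-1 : ℚ) ^ (i : ℕ) * φ (fun j => p (i.succAbove j)) = φ q
  rw [Fin.sum_univ_one, Fin.val_zero, pow_zero, one_mul, Subsingleton.elim q]

theorem tupleCoboundary_cons (m : ℕ) (φ : (Fin (m + 1) → X) → ℚ) (x : X) (p : Fin (m + 1) → X) :
    tupleCoboundary (m + 1) φ (Fin.cons x p) = φ p - tupleCoboundary m (contract x φ) p := by
  simp only [tupleCoboundary, LinearMap.coe_mk, AddHom.coe_mk]
  rw [Fin.sum_univ_succ, sub_eq_add_neg, ← Finset.sum_neg_distrib]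
  congr 1
  · simp
  · refine Finset.sum_congr rfl fun i _ => ?_
    rw [Fin.val_succ, pow_succ, mul_neg_one, neg_mul, contract]
    congr 3
    funext j
    cases j using Fin.cases <;> simp

theorem contract_tupleCoboundary {m : ℕ} (x : X) (φ : (Fin (m + 1) → X) → ℚ) :
    contract x (tupleCoboundary (m + 1) φ) = φ - tupleCoboundary m (contract x φ) :=
  funext fun p => tupleCoboundary_cons m φ x p

theorem tupleCoboundary_comp (m : ℕ) (φ : (Fin m → X) → ℚ) :
    tupleCoboundary (m + 1) (tupleCoboundary m φ) = 0 := by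
  induction m with
  | zero =>
    funext p
    rw [← Fin.cons_self_tail p, tupleCoboundary_cons]
    simp [tupleCoboundary_zero_apply _ _ Fin.elim0, contract]
  | succ m ih =>
    funext p
    rw [← Fin.cons_self_tail p, tupleCoboundary_cons, contract_tupleCoboundary, map_sub, ih]
    simp

theorem coboundary_comp (n : ℕ) (φ : Cochain X n) : coboundary (n + 1) (coboundary n φ) = 0 :=
  tupleCoboundary_comp (n + 1) φ

/-- The pullback of functions of `m`-tuples by a map. -/
def pullback (f : X → Y) (m : ℕ) : ((Fin m → Y) → ℚ) →ₗ[ℚ] ((Fin m → X) → ℚ) :=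
  LinearMap.funLeft ℚ ℚ fun p i => f (p i)

theorem pullback_apply (f : X → Y) {m : ℕ} (φ : (Fin m → Y) → ℚ) (p : Fin m → X) :
    pullback f m φ p = φ fun i => f (p i) := rfl

theorem pullback_cons (f : X → Y) {m : ℕ} (φ : (Fin (m + 1) → Y) → ℚ) (x : X) (p : Fin m → X) :
    pullback f (m + 1) φ (Fin.cons x p) = pullback f m (contract (f x) φ) p := by
  simp only [pullback_apply, contract]
  congr 1
  funext i
  cases i using Fin.cases <;> simp

/-- The prism operator of two maps `f` and `g`, a homotopy between the pullbacks by `f` and `g`: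
on a tuple `(x₀, …, xₘ₋₁)` it is the alternating sum of the values
`φ (f x₀, …, f xᵢ, g xᵢ, …, g xₘ₋₁)`. -/
def prism (f g : X → Y) : (m : ℕ) → ((Fin (m + 1) → Y) → ℚ) → ((Fin m → X) → ℚ)
  | 0, _, _ => 0
  | m + 1, φ, p =>
    φ (Fin.cons (f (p 0)) fun i => g (p i)) - prism f g m (contract (f (p 0)) φ) (Fin.tail p)

theorem prism_zero (f g : X → Y) (φ : (Fin 1 → Y) → ℚ) : prism f g 0 φ = 0 := rfl

theorem prism_cons (f g : X → Y) (m : ℕ) (φ : (Fin (m + 2) → Y) → ℚ) (x : X) (p : Fin m → X) :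
    prism f g (m + 1) φ (Fin.cons x p) =
      pullback g (m + 1) (contract (f x) φ) (Fin.cons x p) -
        prism f g m (contract (f x) φ) p := rfl

theorem contract_prism (f g : X → Y) (m : ℕ) (φ : (Fin (m + 2) → Y) → ℚ) (x : X) :
    contract x (prism f g (m + 1) φ) =
      pullback g m (contract (g x) (contract (f x) φ)) - prism f g m (contract (f x) φ) := by
  funext p
  rw [contract, prism_cons, pullback_cons]
  rfl

theorem prism_sub (f g : X → Y) (m : ℕ) (φ ψ : (Fin (m + 1) → Y) → ℚ) :
    prism f g m (φ - ψ) = prism f g m φ - prism f g m ψ := by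
  induction m with
  | zero => simp [prism_zero]
  | succ m ih =>
    funext p
    simp only [prism, contract_sub, ih, Pi.sub_apply]
    ring

theorem prism_homotopy (f g : X → Y) (m : ℕ) (φ : (Fin (m + 1) → Y) → ℚ) :
    tupleCoboundary m (prism f g m φ) + prism f g (m + 1) (tupleCoboundary (m + 1) φ) =
      pullback g (m + 1) φ - pullback f (m + 1) φ := by
  induction m with
  | zero =>
    funext p
    rw [← Fin.cons_self_tail p]
    generalize p 0 = x
    generalize Fin.tail p = r
    rw [prism_zero, map_zero, zero_add, prism_cons, prism_zero, contract_tupleCoboundary]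
    simp only [Pi.sub_apply, Pi.zero_apply, sub_zero, pullback_cons]
    simp only [pullback_apply, contract_sub, Pi.sub_apply, sub_right_inj]
    exact tupleCoboundary_zero_apply _ _ _
  | succ m ih =>
    funext p
    rw [← Fin.cons_self_tail p]
    generalize p 0 = x
    generalize Fin.tail p = r
    have hcontract := congrFun (ih (contract (f x) φ)) r
    have hgx : tupleCoboundary m (pullback g m (contract (g x) (contract (f x) φ))) r =
        pullback g (m + 1) (tupleCoboundary m (contract (g x) (contract (f x) φ))) r := rfl
    simp only [Pi.add_apply, Pi.sub_apply] at hcontract ⊢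
    simp only [tupleCoboundary_cons, prism_cons, contract_prism, map_sub, contract_sub,
      contract_tupleCoboundary, prism_sub, pullback_cons, Pi.sub_apply] at hcontract ⊢
    linarith

theorem prism_eq_zero {f g : X → Y} {m : ℕ} {φ : (Fin (m + 1) → Y) → ℚ} {S : Set Y}
    (hφ : ∀ q, (∀ i, q i ∈ S) → φ q = 0) {p : Fin m → X} (hf : ∀ i, f (p i) ∈ S)
    (hg : ∀ i, g (p i) ∈ S) : prism f g m φ p = 0 := by
  induction m with
  | zero => rfl
  | succ m ih =>
    have hcontract : ∀ r : Fin (m + 1) → Y, (∀ i, r i ∈ S) → contract (f (p 0)) φ r = 0 :=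
      fun r hr => hφ _ fun i => by cases i using Fin.cases <;> simp [hf, hr]
    rw [prism, ih hcontract (p := Fin.tail p) (fun i => hf i.succ) (fun i => hg i.succ), sub_zero]
    exact hφ _ fun i => by cases i using Fin.cases <;> simp [hf, hg]

end Tuples

/-! ### Lengths of subquotients and Mayer–Vietoris sequences -/

section AlternatingSums

/-- The sequence `l` of dimensions consists of finite numbers, almost all of them zero, so that
its alternating sum is meaningful. -/
def FiniteDims (l : ℕ → ℕ∞) : Prop := (∀ n, l n ≠ ⊤) ∧ l.support.Finite

/-- The alternating sum of a sequence of dimensions, meaningful if `FiniteDims l`. -/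
noncomputable def altSum (l : ℕ → ℕ∞) : ℝ := ∑ᶠ n, (-1) ^ n * ((l n).toNat : ℝ)

variable {k l : ℕ → ℕ∞}

theorem FiniteDims.mono (hl : FiniteDims l) (h : k ≤ l) : FiniteDims k :=
  ⟨fun n => ne_top_of_le_ne_top (hl.1 n) (h n),
    hl.2.subset fun n hn hln => hn (le_zero_iff.mp (hln ▸ h n))⟩

theorem FiniteDims.add (hk : FiniteDims k) (hl : FiniteDims l) : FiniteDims (k + l) :=
  ⟨fun n => WithTop.add_ne_top.mpr ⟨hk.1 n, hl.1 n⟩,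
    (hk.2.union hl.2).subset (Function.support_add k l)⟩

theorem FiniteDims.altSum_add (hk : FiniteDims k) (hl : FiniteDims l) :
    altSum (k + l) = altSum k + altSum l := by
  have hterm : ∀ {j : ℕ → ℕ∞}, FiniteDims j →
      (Function.support fun n => (-1 : ℝ) ^ n * ((j n).toNat : ℝ)).Finite := fun hj =>
    hj.2.subset fun n hn hjn => hn (by simp [hjn])
  rw [altSum, altSum, altSum, ← finsum_add_distrib (hterm hk) (hterm hl)]
  refine finsum_congr fun n => ?_
  rw [Pi.add_apply, ENat.toNat_add (hk.1 n) (hl.1 n), Nat.cast_add, mul_add]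

theorem finiteDims_comp_succ_iff (h0 : l 0 = 0) : FiniteDims (l ∘ Nat.succ) ↔ FiniteDims l := by
  constructor
  · intro h
    refine ⟨fun n => ?_, (h.2.image Nat.succ).subset fun n hn => ?_⟩ <;> cases n with
    | zero => first | exact absurd h0 hn | simp [h0]
    | succ n => first | exact ⟨n, hn, rfl⟩ | exact h.1 n
  · exact fun h => ⟨fun n => h.1 (n + 1), h.2.preimage Nat.succ_injective.injOn⟩

theorem altSum_comp_succ (h0 : l 0 = 0) : altSum (l ∘ Nat.succ) = -altSum l := by
  let f : ℕ → ℝ := fun n => -((-1) ^ n * ((l n).toNat : ℝ))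
  calc altSum (l ∘ Nat.succ) = ∑ᶠ n, f (Nat.succ n) :=
        finsum_congr fun n => by simp [f, pow_succ]
    _ = ∑ᶠ n ∈ Set.range Nat.succ, f n := (finsum_mem_range Nat.succ_injective).symm
    _ = ∑ᶠ n, f n := finsum_congr fun n => by cases n <;> simp [f, h0]
    _ = -altSum l := finsum_neg_distrib _

/-- The dimensions `a`, `b`, `b'` and `c` of the terms of a Mayer–Vietoris sequence
`⋯ → A n → B n × B' n → C n → A (n + 1) → ⋯`, expressed by the ranks of its maps: `w` and `u` for
the maps into and out of `B × B'`, and `k (n + 1)` for the connecting map `C n → A (n + 1)`. -/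
def MayerVietorisRanks (a b b' c : ℕ → ℕ∞) : Prop :=
  ∃ k u w : ℕ → ℕ∞, k 0 = 0 ∧ a = w + k ∧ c = k ∘ Nat.succ + u ∧ b + b' = u + w

variable {a b b' c : ℕ → ℕ∞}

theorem MayerVietorisRanks.finiteDims_union (h : MayerVietorisRanks a b b' c)
    (ha : FiniteDims a) (hb : FiniteDims b) (hb' : FiniteDims b') : FiniteDims c := by
  obtain ⟨k, u, w, hk0, rfl, rfl, hbb'⟩ := h
  have hk : FiniteDims k := ha.mono le_add_self
  have hu : FiniteDims u := (hb.add hb').mono (hbb' ▸ le_self_add)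
  exact ((finiteDims_comp_succ_iff hk0).mpr hk).add hu

theorem MayerVietorisRanks.finiteDims_inter (h : MayerVietorisRanks a b b' c)
    (hc : FiniteDims c) (hb : FiniteDims b) (hb' : FiniteDims b') : FiniteDims a := by
  obtain ⟨k, u, w, hk0, rfl, rfl, hbb'⟩ := h
  have hk : FiniteDims k := (finiteDims_comp_succ_iff hk0).mp (hc.mono le_self_add)
  exact ((hb.add hb').mono (hbb' ▸ le_add_self)).add hk

theorem MayerVietorisRanks.altSum_add_altSum (h : MayerVietorisRanks a b b' c)
    (ha : FiniteDims a) (hb : FiniteDims b) (hb' : FiniteDims b') :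
    altSum a + altSum c = altSum b + altSum b' := by
  obtain ⟨k, u, w, hk0, rfl, rfl, hbb'⟩ := h
  have hk : FiniteDims k := ha.mono le_add_self
  have hw : FiniteDims w := ha.mono le_self_add
  have hu : FiniteDims u := (hb.add hb').mono (hbb' ▸ le_self_add)
  rw [← hb.altSum_add hb', hbb', hu.altSum_add hw, hw.altSum_add hk,
    ((finiteDims_comp_succ_iff hk0).mpr hk).altSum_add hu, altSum_comp_succ hk0]
  ring

end AlternatingSums

section RelLength

open Submodule

variable {R V W : Type*} [Ring R] [AddCommGroup V] [Module R V] [AddCommGroup W] [Module R W]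

/-- The length of the subquotient `Z ⧸ (B ⊓ Z)` of a module, the analogue for modules of
`Subgroup.relIndex`. -/
noncomputable def relLength (B Z : Submodule R V) : ℕ∞ :=
  Module.length R (Z ⧸ B.submoduleOf Z)

theorem relLength_ker (g : V →ₗ[R] W) (Z : Submodule R V) :
    relLength g.ker Z = Module.length R (Z.map g) := by
  rw [← LinearMap.range_domRestrict]
  exact ((quotEquivOfEq _ _ (LinearMap.ker_domRestrict Z g).symm).trans
    (g.domRestrict Z).quotKerEquivRange).length_eq

theorem relLength_eq_length_map_mkQ (B Z : Submodule R V) :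
    relLength B Z = Module.length R (Z.map B.mkQ) := by
  rw [← relLength_ker, ker_mkQ]

theorem relLength_eq_zero_iff {B Z : Submodule R V} : relLength B Z = 0 ↔ Z ≤ B := by
  rw [relLength, Module.length_eq_zero_iff, Submodule.Quotient.subsingleton_iff,
    submoduleOf_eq_top]

theorem relLength_congr_left {B B' Z : Submodule R V} (h : Z ⊓ B = Z ⊓ B') :
    relLength B Z = relLength B' Z := by
  have hcomap : B.submoduleOf Z = B'.submoduleOf Z := by
    ext ⟨x, hx⟩
    simpa [submoduleOf, hx] using SetLike.ext_iff.mp h x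
  rw [relLength, relLength, hcomap]

theorem relLength_sup_right (B Z : Submodule R V) : relLength B (Z ⊔ B) = relLength B Z := by
  rw [relLength_eq_length_map_mkQ, relLength_eq_length_map_mkQ, Submodule.map_sup, mkQ_map_self,
    sup_bot_eq]

theorem relLength_map (g : V →ₗ[R] W) (B : Submodule R W) (Z : Submodule R V) :
    relLength B (Z.map g) = relLength (B.comap g) Z := by
  rw [relLength_eq_length_map_mkQ, ← map_comp, ← relLength_ker, LinearMap.ker_comp, ker_mkQ]

theorem relLength_add_relLength {B Y Z : Submodule R V} (hBY : B ≤ Y) (hYZ : Y ≤ Z) :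
    relLength B Y + relLength Y Z = relLength B Z := by
  have hle : B.submoduleOf Z ≤ Y.submoduleOf Z := comap_mono hBY
  have hY : relLength B Y = Module.length R (factor hle).ker := by
    have hmap : (Y.submoduleOf Z).map Z.subtype = Y := by
      rw [submoduleOf, map_comap_subtype, inf_eq_right.mpr hYZ]
    conv_lhs => rw [← hmap, relLength_map]
    rw [factor, ker_mapQ, ← relLength_eq_length_map_mkQ, comap_id]
    rfl
  rw [hY, relLength, relLength]
  exact (Module.length_eq_add_of_exact (factor hle).ker.subtype (factor hle)
    (subtype_injective _) (factor_surjective hle) (LinearMap.exact_subtype_ker_map _)).symm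

variable {B B' Y Z Z' : Submodule R V}

theorem relLength_sup_right_of_le (h : B' ≤ B) (Z : Submodule R V) :
    relLength B (Z ⊔ B') = relLength B Z := by
  rw [← relLength_sup_right, sup_assoc, sup_eq_right.mpr h, relLength_sup_right]

theorem relLength_eq_inf_add_sup (h : B ≤ Z) (Y : Submodule R V) :
    relLength B Z = relLength (B ⊓ Y) (Z ⊓ Y) + relLength (B ⊔ Y) (Z ⊔ Y) := by
  have hmodular : B ⊔ Z ⊓ Y = Z ⊓ (B ⊔ Y) := by
    rw [inf_comm Z, inf_comm Z, sup_inf_assoc_of_le Y h]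
  calc relLength B Z = relLength B (B ⊔ Z ⊓ Y) + relLength (B ⊔ Z ⊓ Y) Z :=
        (relLength_add_relLength le_sup_left (sup_le h inf_le_left)).symm
    _ = relLength (B ⊓ Y) (Z ⊓ Y) + relLength (B ⊔ Y) (Z ⊔ Y) := by
        congr 1
        · rw [sup_comm, relLength_sup_right]
          exact relLength_congr_left (by rw [inf_comm B Y, ← inf_assoc (Z ⊓ Y), inf_right_idem])
        · rw [relLength_sup_right_of_le le_sup_right, hmodular]
          exact relLength_congr_left (by rw [← inf_assoc, inf_idem])

theorem relLength_add_relLength_eq_inf_add_sup (hB : B ≤ Z) (hB' : B' ≤ Z') :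
    relLength B Z + relLength B' Z' =
      relLength (B ⊓ B') (Z ⊓ Z') + relLength (B ⊔ B') (Z ⊔ Z') := by
  rw [relLength_eq_inf_add_sup hB B', relLength_eq_inf_add_sup hB' Z, inf_comm B', inf_comm Z',
    sup_comm B', sup_comm Z',
    ← relLength_add_relLength (inf_le_inf_right B' hB) (inf_le_inf_left Z hB'),
    ← relLength_add_relLength (sup_le_sup_right hB B') (sup_le_sup_left hB' Z)]
  abel

theorem relLength_comap_of_surjective {g : V →ₗ[R] W} (hg : Function.Surjective g)
    (B Z : Submodule R W) : relLength (B.comap g) (Z.comap g) = relLength B Z := by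
  rw [← relLength_map, map_comap_eq_of_surjective hg]

theorem relLength_inf_sup_inf (A B K : Submodule R V) :
    relLength (A ⊓ K ⊔ B ⊓ K) ((A ⊔ B) ⊓ K) = relLength (A ⊓ K ⊔ B) ((A ⊔ B) ⊓ (K ⊔ B)) := by
  have hsup : (A ⊔ B) ⊓ (K ⊔ B) = (A ⊔ B) ⊓ K ⊔ (A ⊓ K ⊔ B) := by
    rw [← sup_assoc, sup_eq_left.mpr (inf_le_inf_right K le_sup_left),
      inf_sup_assoc_of_le K (le_sup_right : B ≤ A ⊔ B)]
  have hinf : (A ⊓ K ⊔ B) ⊓ K = A ⊓ K ⊔ B ⊓ K := sup_inf_assoc_of_le B inf_le_right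
  rw [hsup, relLength_sup_right]
  refine relLength_congr_left ?_
  rw [← hinf, inf_comm (A ⊓ K ⊔ B), ← inf_assoc, inf_right_idem]

/-- Both sides are the length of the central diamond of the modular lattice generated by `A`, `B`
and `ker g`. -/
theorem relLength_map_inf_map (g : V →ₗ[R] W) (A B : Submodule R V) :
    relLength ((A ⊓ B).map g) (A.map g ⊓ B.map g) =
      relLength (A ⊓ g.ker ⊔ B ⊓ g.ker) ((A ⊔ B) ⊓ g.ker) := by
  have hmodular : A ⊓ B ⊔ g.ker ⊓ A = (A ⊓ B ⊔ g.ker) ⊓ A :=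
    (sup_inf_assoc_of_le g.ker inf_le_left).symm
  calc relLength ((A ⊓ B).map g) (A.map g ⊓ B.map g)
      = relLength (A ⊓ B ⊔ g.ker) ((g.ker ⊔ B) ⊓ A) := by
        rw [map_inf_eq_map_inf_comap, relLength_map, comap_map_eq, comap_map_eq, sup_comm B,
          inf_comm A (g.ker ⊔ B)]
    _ = relLength (g.ker ⊓ A ⊔ B ⊓ A) ((g.ker ⊔ B) ⊓ A) :=
        relLength_congr_left (by
          rw [sup_comm (g.ker ⊓ A), inf_comm B, hmodular, inf_comm (A ⊓ B ⊔ g.ker) A, ← inf_assoc,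
            inf_right_idem])
    _ = relLength (A ⊓ g.ker ⊔ B ⊓ g.ker) ((A ⊔ B) ⊓ g.ker) := by
        rw [relLength_inf_sup_inf, relLength_inf_sup_inf, inf_comm g.ker,
          inf_comm (A ⊔ B)]

end RelLength

section RelativeComplexes

open Submodule

variable {R : Type*} [Ring R] {C C' : ℕ → Type*}
  [∀ n, AddCommGroup (C n)] [∀ n, Module R (C n)]
  [∀ n, AddCommGroup (C' n)] [∀ n, Module R (C' n)]
  (d : ∀ n, C n →ₗ[R] C (n + 1)) (d' : ∀ n, C' n →ₗ[R] C' (n + 1))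

/-- Representatives of the `n`-cocycles of the complex `A / L`. -/
def relCocycles (A L : ∀ n, Submodule R (C n)) (n : ℕ) : Submodule R (C n) :=
  A n ⊓ (L (n + 1)).comap (d n)

/-- Representatives of the `n`-coboundaries of the complex `A / L`. -/
def relCoboundaries (A L : ∀ n, Submodule R (C n)) : (n : ℕ) → Submodule R (C n)
  | 0 => L 0
  | n + 1 => (A n).map (d n) ⊔ L (n + 1)

/-- The lengths of the cohomology modules of the complex `A / L`. -/
noncomputable def relCohomologyLength (A L : ∀ n, Submodule R (C n)) (n : ℕ) : ℕ∞ :=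
  relLength (relCoboundaries d A L n) (relCocycles d A L n)

/-- `L ≤ A` are subcomplexes of the sequence of modules `C` with the maps `d`. -/
structure IsRelComplex (A L : ∀ n, Submodule R (C n)) : Prop where
  le : ∀ n, L n ≤ A n
  le_comap : ∀ n, A n ≤ (A (n + 1)).comap (d n)
  le_comap_rel : ∀ n, L n ≤ (L (n + 1)).comap (d n)

variable {d d'} {A B L : ∀ n, Submodule R (C n)}

theorem IsRelComplex.le_relCocycles (hA : IsRelComplex d A L) (n : ℕ) :
    L n ≤ relCocycles d A L n :=
  le_inf (hA.le n) (hA.le_comap_rel n)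

theorem relCoboundaries_le (hd : ∀ n x, d (n + 1) (d n x) = 0) (hA : IsRelComplex d A L) (n : ℕ) :
    relCoboundaries d A L n ≤ relCocycles d A L n := by
  cases n with
  | zero => exact hA.le_relCocycles 0
  | succ n =>
    refine sup_le (map_le_iff_le_comap.mpr fun x hx => ⟨hA.le_comap n hx, ?_⟩)
      (hA.le_relCocycles _)
    change d (n + 1) (d n x) ∈ L (n + 2)
    exact hd n x ▸ zero_mem _

theorem relCocycles_inf : relCocycles d (A ⊓ B) L = relCocycles d A L ⊓ relCocycles d B L :=
  funext fun _ => inf_inf_distrib_right _ _ _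

theorem relCoboundaries_sup :
    relCoboundaries d (A ⊔ B) L = relCoboundaries d A L ⊔ relCoboundaries d B L := by
  funext n
  cases n with
  | zero => exact (sup_idem _).symm
  | succ n =>
    simp only [relCoboundaries, Pi.sup_apply, Submodule.map_sup]
    exact sup_sup_distrib_right _ _ _

theorem relCocycles_mono (h : A ≤ B) : relCocycles d A L ≤ relCocycles d B L :=
  fun n => inf_le_inf_right _ (h n)

theorem relCoboundaries_mono (h : A ≤ B) : relCoboundaries d A L ≤ relCoboundaries d B L := by
  rintro (_ | n)
  · exact le_rfl
  · exact sup_le_sup_right (map_mono (h n)) _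

/-- The connecting isomorphism of the Mayer–Vietoris sequence. -/
theorem relLength_connecting (n : ℕ) :
    relLength (relCocycles d A L n ⊔ relCocycles d B L n) (relCocycles d (A ⊔ B) L n) =
      relLength (relCoboundaries d (A ⊓ B) L (n + 1))
        (relCoboundaries d A L (n + 1) ⊓ relCoboundaries d B L (n + 1)) := by
  let g := (L (n + 1)).mkQ ∘ₗ d n
  have hker : g.ker = (L (n + 1)).comap (d n) := by rw [LinearMap.ker_comp, ker_mkQ]
  have hcomap (D : Submodule R (C n)) :
      D.map (d n) ⊔ L (n + 1) = (D.map g).comap (L (n + 1)).mkQ := by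
    rw [map_comp, comap_map_mkQ, sup_comm]
  have h := relLength_map_inf_map g (A n) (B n)
  rw [hker] at h
  simp only [relCoboundaries, hcomap, ← comap_inf]
  rw [relLength_comap_of_surjective (mkQ_surjective _)]
  exact h.symm

theorem mayerVietorisRanks_rel (hd : ∀ n x, d (n + 1) (d n x) = 0) (hA : IsRelComplex d A L)
    (hB : IsRelComplex d B L) :
    MayerVietorisRanks (relCohomologyLength d (A ⊓ B) L) (relCohomologyLength d A L)
      (relCohomologyLength d B L) (relCohomologyLength d (A ⊔ B) L) := by
  have hBZ := relCoboundaries_le hd hA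
  have hBZ' := relCoboundaries_le hd hB
  refine ⟨fun n => relLength (relCoboundaries d (A ⊓ B) L n)
      (relCoboundaries d A L n ⊓ relCoboundaries d B L n),
    fun n => relLength (relCoboundaries d A L n ⊔ relCoboundaries d B L n)
      (relCocycles d A L n ⊔ relCocycles d B L n),
    fun n => relLength (relCoboundaries d A L n ⊓ relCoboundaries d B L n)
      (relCocycles d A L n ⊓ relCocycles d B L n),
    relLength_eq_zero_iff.mpr inf_le_left, ?_, ?_, ?_⟩ <;> funext n
  · rw [relCohomologyLength, relCocycles_inf, Pi.add_apply, add_comm]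
    exact (relLength_add_relLength (le_inf (relCoboundaries_mono inf_le_left n)
      (relCoboundaries_mono inf_le_right n)) (inf_le_inf (hBZ n) (hBZ' n))).symm
  · rw [relCohomologyLength, relCoboundaries_sup, Pi.add_apply, add_comm, Function.comp_apply,
      ← relLength_connecting]
    exact (relLength_add_relLength (sup_le_sup (hBZ n) (hBZ' n))
      (sup_le (relCocycles_mono le_sup_left n) (relCocycles_mono le_sup_right n))).symm
  · rw [Pi.add_apply, Pi.add_apply, add_comm (relLength _ _)]
    exact relLength_add_relLength_eq_inf_add_sup (hBZ n) (hBZ' n)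

section ChainMap

variable {A' L' : ∀ n, Submodule R (C' n)} {J : ∀ n, C n →ₗ[R] C' n}

theorem relCocycles_eq_map_sup (hJ : ∀ n x, d' n (J n x) = J (n + 1) (d n x))
    (hA : ∀ n, A n ≤ (A (n + 1)).comap (d n)) (hL' : ∀ n, L' n ≤ (L' (n + 1)).comap (d' n))
    (hsurj : ∀ n, (A n).map (J n) ⊔ L' n = A' n) (hinj : ∀ n, A n ⊓ (L' n).comap (J n) = L n)
    (n : ℕ) : relCocycles d' A' L' n = (relCocycles d A L n).map (J n) ⊔ L' n := by
  apply le_antisymm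
  · rintro x ⟨hx, hdx⟩
    rw [← hsurj] at hx
    obtain ⟨_, ⟨a, ha, rfl⟩, l, hl, rfl⟩ := mem_sup.mp hx
    refine add_mem_sup ⟨a, ⟨ha, ?_⟩, rfl⟩ hl
    rw [← hinj]
    refine ⟨hA n ha, ?_⟩
    change J (n + 1) (d n a) ∈ L' (n + 1)
    rw [← hJ]
    simpa using sub_mem hdx (hL' n hl)
  · refine sup_le (map_le_iff_le_comap.mpr fun a ha => mem_inf.mpr ⟨?_, ?_⟩)
      fun l hl => ⟨hsurj n ▸ mem_sup_right hl, hL' n hl⟩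
    · exact hsurj n ▸ mem_sup_left (mem_map_of_mem ha.1)
    · change d' n (J n a) ∈ L' (n + 1)
      rw [hJ]
      exact ((hinj (n + 1)).symm.le ha.2).2

theorem relCoboundaries_eq_map_sup (hJ : ∀ n x, d' n (J n x) = J (n + 1) (d n x))
    (hL' : ∀ n, L' n ≤ (L' (n + 1)).comap (d' n))
    (hsurj : ∀ n, (A n).map (J n) ⊔ L' n = A' n) (hinj : ∀ n, A n ⊓ (L' n).comap (J n) = L n)
    (n : ℕ) : relCoboundaries d' A' L' n = (relCoboundaries d A L n).map (J n) ⊔ L' n := by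
  have hL (n) : (L n).map (J n) ≤ L' n :=
    map_le_iff_le_comap.mpr ((hinj n).symm.le.trans inf_le_right)
  cases n with
  | zero => exact (sup_eq_right.mpr (hL 0)).symm
  | succ n =>
    have hcomp : d' n ∘ₗ J n = J (n + 1) ∘ₗ d n := LinearMap.ext (hJ n)
    rw [relCoboundaries, relCoboundaries, ← hsurj, Submodule.map_sup, Submodule.map_sup,
      ← map_comp, ← map_comp, hcomp,
      sup_assoc, sup_assoc, sup_eq_right.mpr (map_le_iff_le_comap.mpr (hL' n)),
      sup_eq_right.mpr (hL (n + 1))]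

/-- A chain map that induces an isomorphism of complexes `A / L → A' / L'` preserves the
cohomology. -/
theorem relCohomologyLength_eq_of_chainMap (hJ : ∀ n x, d' n (J n x) = J (n + 1) (d n x))
    (hA : IsRelComplex d A L) (hL' : ∀ n, L' n ≤ (L' (n + 1)).comap (d' n))
    (hsurj : ∀ n, (A n).map (J n) ⊔ L' n = A' n) (hinj : ∀ n, A n ⊓ (L' n).comap (J n) = L n) :
    relCohomologyLength d' A' L' = relCohomologyLength d A L := by
  funext n
  have hBA : relCoboundaries d A L n ≤ A n := by
    cases n with
    | zero => exact hA.le 0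
    | succ n => exact sup_le (map_le_iff_le_comap.mpr (hA.le_comap n)) (hA.le _)
  have hLB : L n ≤ relCoboundaries d A L n := by
    cases n with
    | zero => exact le_rfl
    | succ n => exact le_sup_right
  rw [relCohomologyLength, relCocycles_eq_map_sup hJ hA.le_comap hL' hsurj hinj,
    relCoboundaries_eq_map_sup hJ hL' hsurj hinj, relLength_sup_right_of_le le_sup_right,
    relLength_map]
  refine relLength_congr_left (le_antisymm ?_ ?_)
  · rintro z ⟨hz, hzB⟩
    obtain ⟨_, ⟨b, hb, rfl⟩, l, hl, h⟩ := mem_sup.mp hzB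
    refine ⟨hz, ?_⟩
    suffices z - b ∈ L n by simpa using add_mem (hLB this) hb
    rw [← hinj]
    refine ⟨sub_mem hz.1 (hBA hb), ?_⟩
    change J n (z - b) ∈ L' n
    rwa [map_sub, ← h, add_sub_cancel_left]
  · exact inf_le_inf_left _ (map_le_iff_le_comap.mp le_sup_left)

end ChainMap

end RelativeComplexes

/-! ### Cohomology with compact supports -/

section Cutoff

variable {X : Type*} {n : ℕ}

/-- The product of a cochain with the indicator function of a set, in the first variable. -/
noncomputable def cutoff (W : Set X) (φ : Cochain X n) : Cochain X n :=
  {p | p 0 ∈ W}.indicator φ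

theorem cutoff_of_mem {W : Set X} (φ : Cochain X n) {p : Fin (n + 1) → X} (h : p 0 ∈ W) :
    cutoff W φ p = φ p :=
  Set.indicator_of_mem (s := {p : Fin (n + 1) → X | p 0 ∈ W}) h φ

theorem cutoff_of_notMem {W : Set X} (φ : Cochain X n) {p : Fin (n + 1) → X} (h : p 0 ∉ W) :
    cutoff W φ p = 0 :=
  Set.indicator_of_notMem (s := {p : Fin (n + 1) → X | p 0 ∈ W}) h φ

variable [TopologicalSpace X] {φ : Cochain X n} {x : X}

theorem LocallyZeroAt.cutoff (h : LocallyZeroAt φ x) (W : Set X) :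
    LocallyZeroAt (cutoff W φ) x := by
  obtain ⟨U, hU, h⟩ := h
  exact ⟨U, hU, fun p hp => Set.indicator_apply_eq_zero.mpr fun _ => h p hp⟩

theorem LocallyZeroAt.sub {ψ : Cochain X n} (hφ : LocallyZeroAt φ x) (hψ : LocallyZeroAt ψ x) :
    LocallyZeroAt (φ - ψ) x := by
  rw [sub_eq_add_neg, ← neg_one_smul ℚ ψ]
  exact hφ.add (hψ.smul _)

theorem locallyZeroAt_cutoff_of_notMem_closure (φ : Cochain X n) {W : Set X}
    (h : x ∉ closure W) : LocallyZeroAt (cutoff W φ) x :=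
  ⟨(closure W)ᶜ, isClosed_closure.isOpen_compl.mem_nhds h,
    fun _ hp => cutoff_of_notMem φ fun h0 => hp 0 (subset_closure h0)⟩

theorem locallyZeroAt_sub_cutoff_of_mem_nhds (φ : Cochain X n) {W : Set X} (h : W ∈ 𝓝 x) :
    LocallyZeroAt (φ - cutoff W φ) x :=
  ⟨W, h, fun p hp => by rw [Pi.sub_apply, cutoff_of_mem φ (hp 0), sub_self]⟩

end Cutoff

section SupportedIn

variable {X : Type*} [TopologicalSpace X] {n : ℕ}

theorem LocallyZeroAt.coboundary {φ : Cochain X n} {x : X} (h : LocallyZeroAt φ x) :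
    LocallyZeroAt (coboundary n φ) x := by
  obtain ⟨U, hU, h⟩ := h
  refine ⟨U, hU, fun p hp => ?_⟩
  change ∑ i : Fin (n + 2), (-1 : ℚ) ^ (i : ℕ) * φ (fun j => p (i.succAbove j)) = 0
  exact Finset.sum_eq_zero fun i _ => by rw [h _ fun _ => hp _, mul_zero]

theorem locallyZero_le_comap (n : ℕ) :
    locallyZero X n ≤ (locallyZero X (n + 1)).comap (coboundary n) :=
  fun _ h x => (h x).coboundary

/-- The cochains with compact support contained in `U`. -/
def supportedIn (U : Set X) (n : ℕ) : Submodule ℚ (Cochain X n) where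
  carrier := {φ | ∃ K : Set X, IsCompact K ∧ K ⊆ U ∧ ∀ x, x ∉ K → LocallyZeroAt φ x}
  add_mem' := by
    rintro φ ψ ⟨K, hK, hKU, h⟩ ⟨L, hL, hLU, h'⟩
    refine ⟨K ∪ L, hK.union hL, Set.union_subset hKU hLU, fun x hx => ?_⟩
    exact (h x fun hxK => hx (Or.inl hxK)).add (h' x fun hxL => hx (Or.inr hxL))
  zero_mem' := ⟨∅, isCompact_empty, Set.empty_subset _, fun x _ => LocallyZeroAt.zero x⟩
  smul_mem' := by
    rintro c φ ⟨K, hK, hKU, h⟩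
    exact ⟨K, hK, hKU, fun x hx => (h x hx).smul c⟩

theorem supportedIn_mono {U V : Set X} (h : U ⊆ V) : supportedIn U n ≤ supportedIn V n :=
  fun _ ⟨K, hK, hKU, hφ⟩ => ⟨K, hK, hKU.trans h, hφ⟩

theorem isRelComplex_supportedIn (U : Set X) :
    IsRelComplex coboundary (supportedIn U) (locallyZero X) where
  le _ _ h := ⟨∅, isCompact_empty, Set.empty_subset _, fun x _ => h x⟩
  le_comap _ _ := fun ⟨K, hK, hKU, h⟩ => ⟨K, hK, hKU, fun x hx => (h x hx).coboundary⟩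
  le_comap_rel := locallyZero_le_comap

variable [T2Space X] {U V : Set X}

theorem supportedIn_inf (U V : Set X) :
    supportedIn U ⊓ supportedIn V = supportedIn (U ∩ V) := by
  funext n
  refine le_antisymm ?_ (le_inf (supportedIn_mono Set.inter_subset_left)
    (supportedIn_mono Set.inter_subset_right))
  rintro φ ⟨⟨K, hK, hKU, h⟩, L, hL, hLV, h'⟩
  refine ⟨K ∩ L, hK.inter hL, Set.inter_subset_inter hKU hLV, fun x hx => ?_⟩
  by_cases hxK : x ∈ K
  · exact h' x fun hxL => hx ⟨hxK, hxL⟩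
  · exact h x hxK

theorem supportedIn_sup (hU : IsOpen U) (hV : IsOpen V) :
    supportedIn U ⊔ supportedIn V = supportedIn (U ∪ V) := by
  funext n
  refine le_antisymm (sup_le (supportedIn_mono Set.subset_union_left)
    (supportedIn_mono Set.subset_union_right)) ?_
  rintro φ ⟨K, hK, hKUV, h⟩
  have hdisj : Disjoint (K \ V) (K \ U) := Set.disjoint_left.mpr fun x hx hx' =>
    (hKUV hx.1).elim hx'.2 hx.2
  obtain ⟨O₁, O₂, ho₁, ho₂, h₁, h₂, hO⟩ :=
    SeparatedNhds.of_isCompact_isCompact (hK.diff hV) (hK.diff hU) hdisj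
  have hcl : Disjoint (closure O₁) O₂ := hO.closure_left ho₂
  refine Submodule.mem_sup.2 ⟨cutoff O₁ φ, ⟨K ∩ closure O₁, hK.inter_right isClosed_closure,
    fun x hx => ?_, fun x hx => ?_⟩, φ - cutoff O₁ φ, ⟨K \ O₁, hK.diff ho₁,
    fun x hx => ?_, fun x hx => ?_⟩, add_sub_cancel _ _⟩
  · exact by_contra fun hxU => Set.disjoint_left.1 hcl hx.2 (h₂ ⟨hx.1, hxU⟩)
  · by_cases hxK : x ∈ K
    · exact locallyZeroAt_cutoff_of_notMem_closure φ fun hxO => hx ⟨hxK, hxO⟩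
    · exact (h x hxK).cutoff _
  · exact by_contra fun hxV => hx.2 (h₁ ⟨hx.1, hxV⟩)
  · by_cases hxK : x ∈ K
    · have hxO : x ∈ O₁ := by_contra fun hxO => hx ⟨hxK, hxO⟩
      exact locallyZeroAt_sub_cutoff_of_mem_nhds φ (ho₁.mem_nhds hxO)
    · exact (h x hxK).sub ((h x hxK).cutoff _)

end SupportedIn

section OpenEmbedding

variable {X Y : Type*} [TopologicalSpace X] [TopologicalSpace Y] {j : Y → X} {n : ℕ}

theorem locallyZeroAt_pullback_iff (hj : Topology.IsOpenEmbedding j) (φ : Cochain X n) (y : Y) :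
    LocallyZeroAt (n := n) (pullback j (n + 1) φ) y ↔ LocallyZeroAt φ (j y) := by
  constructor
  · rintro ⟨V, hV, h⟩
    refine ⟨j '' V, hj.image_mem_nhds.2 hV, fun p hp => ?_⟩
    choose q hq hqp using hp
    rw [← funext hqp]
    exact h q hq
  · rintro ⟨U, hU, h⟩
    exact ⟨j ⁻¹' U, hj.continuous.continuousAt hU, fun p hp => h _ hp⟩

theorem pullback_mem_compactlySupported (hj : Topology.IsOpenEmbedding j) {φ : Cochain X n}
    (h : φ ∈ supportedIn (Set.range j) n) : pullback j (n + 1) φ ∈ compactlySupported Y n := by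
  obtain ⟨K, hK, hKj, h⟩ := h
  exact ⟨j ⁻¹' K, (hj.isInducing.isCompact_preimage_iff hKj).2 hK,
    fun y hy => (locallyZeroAt_pullback_iff hj φ y).2 (h _ hy)⟩

theorem supportedIn_inf_comap_pullback (hj : Topology.IsOpenEmbedding j) (n : ℕ) :
    supportedIn (Set.range j) n ⊓ (locallyZero Y n).comap (pullback j (n + 1)) =
      locallyZero X n := by
  refine le_antisymm ?_ (le_inf ((isRelComplex_supportedIn _).le n)
    fun φ h y => (locallyZeroAt_pullback_iff hj φ y).2 (h _))
  rintro φ ⟨⟨K, -, hKj, h⟩, h0⟩ x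
  by_cases hx : x ∈ Set.range j
  · obtain ⟨y, rfl⟩ := hx
    exact (locallyZeroAt_pullback_iff hj φ y).1 (h0 y)
  · exact h x fun hxK => hx (hKj hxK)

/-- Extension by zero, after cutting off outside a compact neighbourhood of the support. -/
theorem exists_sub_pullback_mem_locallyZero [T2Space X] [LocallyCompactSpace Y]
    (hj : Topology.IsOpenEmbedding j) {ψ : Cochain Y n} (h : ψ ∈ compactlySupported Y n) :
    ∃ φ ∈ supportedIn (Set.range j) n, ψ - pullback j (n + 1) φ ∈ locallyZero Y n := by
  obtain ⟨K, hK, h⟩ := h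
  obtain ⟨K', hK', hKK'⟩ := exists_compact_superset hK
  let φ : Cochain X n := Function.extend (fun p i => j (p i)) (cutoff K' ψ) 0
  have hφ : pullback j (n + 1) φ = cutoff K' ψ :=
    funext fun p => (hj.injective.comp_left (α := Fin (n + 1))).extend_apply _ _ p
  refine ⟨φ, ⟨j '' K', hK'.image hj.continuous, Set.image_subset_range _ _, fun x hx => ?_⟩, ?_⟩
  · refine ⟨(j '' K')ᶜ, (hK'.image hj.continuous).isClosed.isOpen_compl.mem_nhds hx,
      fun p hp => ?_⟩
    by_cases hpj : ∃ q : Fin (n + 1) → Y, (fun i => j (q i)) = p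
    · obtain ⟨q, rfl⟩ := hpj
      exact (congrFun hφ q).trans (cutoff_of_notMem ψ fun hq => hp 0 ⟨q 0, hq, rfl⟩)
    · exact Function.extend_apply' _ _ _ hpj
  · rw [hφ]
    intro y
    by_cases hy : y ∈ K
    · exact locallyZeroAt_sub_cutoff_of_mem_nhds ψ (mem_interior_iff_mem_nhds.1 (hKK' hy))
    · exact (h y hy).sub ((h y hy).cutoff _)

/-- The dimensions of the spaces `H_c^n(X; ℚ)`. -/
noncomputable def cohomologyLength (X : Type*) [TopologicalSpace X] : ℕ → ℕ∞ :=
  relCohomologyLength coboundary (compactlySupported X) (locallyZero X)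

theorem cohomologyLength_eq_supportedIn [T2Space X] [LocallyCompactSpace Y]
    (hj : Topology.IsOpenEmbedding j) : cohomologyLength Y =
      relCohomologyLength coboundary (supportedIn (Set.range j)) (locallyZero X) := by
  refine relCohomologyLength_eq_of_chainMap (J := fun n => pullback j (n + 1))
    (fun _ _ => rfl) (isRelComplex_supportedIn _) locallyZero_le_comap (fun n => ?_)
    (supportedIn_inf_comap_pullback hj)
  refine le_antisymm (sup_le (Submodule.map_le_iff_le_comap.mpr fun φ hφ =>
    pullback_mem_compactlySupported hj hφ) fun φ hφ => ⟨∅, isCompact_empty, fun x _ => hφ x⟩) ?_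
  intro ψ hψ
  obtain ⟨φ, hφ, hψφ⟩ := exists_sub_pullback_mem_locallyZero hj hψ
  exact Submodule.mem_sup.mpr ⟨_, ⟨φ, hφ, rfl⟩, _, hψφ, add_sub_cancel _ _⟩

theorem cohomologyLength_congr (e : Y ≃ₜ X) [T2Space X] [LocallyCompactSpace X] :
    cohomologyLength Y = cohomologyLength X := by
  have := e.isOpenEmbedding.locallyCompactSpace
  rw [cohomologyLength_eq_supportedIn e.isOpenEmbedding, e.surjective.range_eq,
    cohomologyLength_eq_supportedIn Topology.IsOpenEmbedding.id, Set.range_id]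

theorem mayerVietorisRanks_open [T2Space X] [LocallyCompactSpace X] {U V : Set X} (hU : IsOpen U)
    (hV : IsOpen V) : MayerVietorisRanks (cohomologyLength ↥(U ∩ V)) (cohomologyLength U)
      (cohomologyLength V) (cohomologyLength ↥(U ∪ V)) := by
  have hrel {W : Set X} (hW : IsOpen W) : cohomologyLength W =
      relCohomologyLength coboundary (supportedIn W) (locallyZero X) := by
    have := hW.isOpenEmbedding_subtypeVal.locallyCompactSpace
    rw [cohomologyLength_eq_supportedIn hW.isOpenEmbedding_subtypeVal, Subtype.range_val]
  rw [hrel hU, hrel hV, hrel (hU.inter hV), hrel (hU.union hV), ← supportedIn_inf,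
    ← supportedIn_sup hU hV]
  exact mayerVietorisRanks_rel coboundary_comp (isRelComplex_supportedIn U)
    (isRelComplex_supportedIn V)

end OpenEmbedding

section EulerCharacteristic

variable {X Y : Type*} [TopologicalSpace X] [TopologicalSpace Y] {c : ℝ}

theorem length_cohomology (n : ℕ) : Module.length ℚ (Cohomology X n) = cohomologyLength X n := by
  cases n <;> rfl

theorem finiteCohomology_iff : FiniteCohomology X ↔ FiniteDims (cohomologyLength X) := by
  have hfinite (n : ℕ) : Module.Finite ℚ (Cohomology X n) ↔ cohomologyLength X n ≠ ⊤ := by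
    rw [← length_cohomology, Module.length_eq_rank, ← Module.rank_lt_aleph0_iff]
    exact Cardinal.toENat_ne_top.symm
  have hzero (n : ℕ) : Subsingleton (Cohomology X n) ↔ cohomologyLength X n = 0 := by
    rw [← length_cohomology, Module.length_eq_zero_iff]
  simp only [FiniteCohomology, FiniteDims, hfinite, hzero]
  refine and_congr_right fun _ => ⟨?_, fun h => ?_⟩
  · rintro ⟨N, hN⟩
    exact (Set.finite_lt_nat N).subset fun n hn => not_le.mp fun hNn => hn (hN n hNn)
  · obtain ⟨N, hN⟩ := h.bddAbove
    exact ⟨N + 1, fun n hn => by_contra fun h0 => absurd (hN h0) (by omega)⟩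

theorem eulerChar_eq_altSum : (eulerChar X : ℝ) = altSum (cohomologyLength X) := by
  have hrank (n : ℕ) : Module.finrank ℚ (Cohomology X n) = (cohomologyLength X n).toNat := by
    rw [← length_cohomology, Module.length_eq_rank, Cardinal.toNat_toENat]
    rfl
  exact ((Int.castAddHom ℝ).map_finsum_of_injective Int.cast_injective _).trans
    (finsum_congr fun n => by simp [hrank])

theorem hasEulerChar_iff :
    HasEulerChar X c ↔ FiniteDims (cohomologyLength X) ∧ altSum (cohomologyLength X) = c := by
  rw [HasEulerChar, finiteCohomology_iff, eulerChar_eq_altSum]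

theorem HasEulerChar.homeomorph [T2Space X] [LocallyCompactSpace X] (h : HasEulerChar X c)
    (e : Y ≃ₜ X) : HasEulerChar Y c := by
  rwa [hasEulerChar_iff, cohomologyLength_congr e, ← hasEulerChar_iff]

theorem HasEulerChar.union [T2Space X] [LocallyCompactSpace X] {U V : Set X} (hU : IsOpen U)
    (hV : IsOpen V) {α β γ : ℝ} (h : HasEulerChar U α) (h' : HasEulerChar V β)
    (h'' : HasEulerChar ↥(U ∩ V) γ) : HasEulerChar ↥(U ∪ V) (α + β - γ) := by
  rw [hasEulerChar_iff] at *
  have hMV := mayerVietorisRanks_open hU hV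
  exact ⟨hMV.finiteDims_union h''.1 h.1 h'.1,
    by linarith [hMV.altSum_add_altSum h''.1 h.1 h'.1]⟩

theorem HasEulerChar.inter [T2Space X] [LocallyCompactSpace X] {U V : Set X} (hU : IsOpen U)
    (hV : IsOpen V) {α β γ : ℝ} (h : HasEulerChar U α) (h' : HasEulerChar V β)
    (h'' : HasEulerChar ↥(U ∪ V) γ) : HasEulerChar ↥(U ∩ V) (α + β - γ) := by
  rw [hasEulerChar_iff] at *
  have hMV := mayerVietorisRanks_open hU hV
  have hfin := hMV.finiteDims_inter h''.1 h.1 h'.1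
  exact ⟨hfin, by linarith [hMV.altSum_add_altSum hfin h.1 h'.1]⟩

theorem hasEulerChar_of_cohomologyLength_eq_zero (h : cohomologyLength X = 0) :
    HasEulerChar X 0 := by
  rw [hasEulerChar_iff, h]
  exact ⟨⟨fun _ => ENat.zero_ne_top, by simp⟩, by simp [altSum]⟩

theorem hasEulerChar_of_isEmpty [IsEmpty X] : HasEulerChar X 0 := by
  refine hasEulerChar_of_cohomologyLength_eq_zero (funext fun n => relLength_eq_zero_iff.2 ?_)
  have hzero : ∀ φ, φ ∈ locallyZero X n := fun φ x => isEmptyElim x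
  cases n with
  | zero => exact fun φ _ => hzero φ
  | succ n => exact fun φ _ => Submodule.mem_sup_right (hzero φ)

end EulerCharacteristic

section Homotopy

variable {X Y : Type*} [PseudoMetricSpace X] {n : ℕ} {φ : Cochain X n}

/-- The Lebesgue number of a covering by open sets on which the cochain vanishes. -/
theorem exists_ball_of_mem_locallyZero [CompactSpace X] (h : φ ∈ locallyZero X n) :
    ∃ ε > 0, ∀ x, ∀ p : Fin (n + 1) → X, (∀ i, p i ∈ Metric.ball x ε) → φ p = 0 := by
  let ι := {U : Set X // IsOpen U ∧ ∀ p : Fin (n + 1) → X, (∀ i, p i ∈ U) → φ p = 0}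
  obtain ⟨ε, hε, H⟩ := lebesgue_number_lemma_of_metric (c := fun U : ι => (U : Set X))
    isCompact_univ (fun U => U.2.1) fun x _ => by
      obtain ⟨U, hU, h⟩ := h x
      obtain ⟨V, hVU, hV, hxV⟩ := mem_nhds_iff.1 hU
      exact Set.mem_iUnion.2 ⟨⟨V, hV, fun p hp => h p fun i => hVU (hp i)⟩, hxV⟩
  refine ⟨ε, hε, fun x p hp => ?_⟩
  obtain ⟨U, hU⟩ := H x (Set.mem_univ x)
  exact U.2.2 p fun i => hU (hp i)

variable [TopologicalSpace Y]

theorem exists_pullback_sub_mem_locallyZero_of_dist_lt {ε : ℝ}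
    (hφ : ∀ x, ∀ p : Fin (n + 2) → X, (∀ i, p i ∈ Metric.ball x ε) → coboundary n φ p = 0)
    {f g : C(Y, X)} (hfg : ∀ y, dist (g y) (f y) < ε) :
    ∃ ψ : (Fin n → Y) → ℚ,
      pullback g (n + 1) φ - pullback f (n + 1) φ - tupleCoboundary n ψ ∈ locallyZero Y n := by
  refine ⟨prism f g n φ, fun y => ?_⟩
  have hε : 0 < ε := dist_nonneg.trans_lt (hfg y)
  refine ⟨f ⁻¹' Metric.ball (f y) ε ∩ g ⁻¹' Metric.ball (f y) ε,
    Filter.inter_mem (f.continuousAt y (Metric.ball_mem_nhds _ hε))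
      (g.continuousAt y (Metric.isOpen_ball.mem_nhds (hfg y))), fun p hp => ?_⟩
  rw [← prism_homotopy f g n φ, add_sub_cancel_left]
  exact prism_eq_zero (hφ (f y)) (fun i => (hp i).1) fun i => (hp i).2

theorem exists_pullback_sub_mem_locallyZero_of_homotopic [CompactSpace X] [CompactSpace Y]
    (hφ : coboundary n φ ∈ locallyZero X (n + 1)) {f g : C(Y, X)} (hfg : f.Homotopic g) :
    ∃ ψ : (Fin n → Y) → ℚ,
      pullback g (n + 1) φ - pullback f (n + 1) φ - tupleCoboundary n ψ ∈ locallyZero Y n := by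
  obtain ⟨ε, hε, hball⟩ := exists_ball_of_mem_locallyZero hφ
  obtain ⟨F⟩ := hfg
  have key : ∃ ψ : (Fin n → Y) → ℚ, pullback (F.curry 1) (n + 1) φ -
      pullback (F.curry 0) (n + 1) φ - tupleCoboundary n ψ ∈ locallyZero Y n := by
    refine PreconnectedSpace.induction₂' (fun s t => ∃ ψ : (Fin n → Y) → ℚ,
      pullback (F.curry t) (n + 1) φ - pullback (F.curry s) (n + 1) φ - tupleCoboundary n ψ ∈
        locallyZero Y n) (fun s => ?_) ⟨?_⟩ 0 1
    · filter_upwards [F.curry.continuous.continuousAt (Metric.ball_mem_nhds (F.curry s) hε)]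
        with t ht
      have hdist : ∀ y, dist (F.curry t y) (F.curry s y) < ε := fun y =>
        (ContinuousMap.dist_apply_le_dist y).trans_lt ht
      exact ⟨exists_pullback_sub_mem_locallyZero_of_dist_lt hball hdist,
        exists_pullback_sub_mem_locallyZero_of_dist_lt hball
          fun y => dist_comm (F.curry t y) _ ▸ hdist y⟩
    · rintro s t u ⟨ψ, hψ⟩ ⟨ψ', hψ'⟩
      refine ⟨ψ + ψ', ?_⟩
      convert add_mem hψ hψ' using 1
      rw [map_add]
      abel
  simpa only [F.curry_zero, F.curry_one] using key

end Homotopy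

section Contractible

variable {X : Type*}

theorem apply_const_of_mem_locallyZero [TopologicalSpace X] {n : ℕ} {φ : Cochain X n}
    (h : φ ∈ locallyZero X n) (x : X) : φ (fun _ => x) = 0 := by
  obtain ⟨U, hU, h⟩ := h x
  exact h _ fun _ => mem_of_mem_nhds hU

theorem mem_compactlySupported [TopologicalSpace X] [CompactSpace X] (n : ℕ) (φ : Cochain X n) :
    φ ∈ compactlySupported X n :=
  ⟨Set.univ, isCompact_univ, fun x hx => (hx (Set.mem_univ x)).elim⟩

variable [PseudoMetricSpace X] [CompactSpace X] [ContractibleSpace X]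

/-- Including the cochains of degree `-1` makes the complex of a contractible space exact in
degree `0`, too. -/
theorem exists_sub_tupleCoboundary_mem_locallyZero {n : ℕ} {φ : Cochain X n}
    (hφ : coboundary n φ ∈ locallyZero X (n + 1)) :
    ∃ ψ : (Fin n → X) → ℚ, φ - tupleCoboundary n ψ ∈ locallyZero X n := by
  obtain ⟨c, hc⟩ := id_nullhomotopic X
  obtain ⟨ψ, hψ⟩ := exists_pullback_sub_mem_locallyZero_of_homotopic hφ hc.symm
  set φ' := pullback (ContinuousMap.const X c) (n + 1) φ
  have hconst : φ' = tupleCoboundary n (contract c φ') := by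
    rw [← sub_eq_zero, ← contract_tupleCoboundary]
    exact funext fun _ => apply_const_of_mem_locallyZero hφ c
  refine ⟨ψ + contract c φ', ?_⟩
  rw [map_add, ← hconst, ← sub_sub, sub_right_comm]
  exact hψ

theorem cohomologyLength_succ_eq_zero (n : ℕ) : cohomologyLength X (n + 1) = 0 := by
  rw [cohomologyLength, relCohomologyLength, relLength_eq_zero_iff]
  rintro φ ⟨-, hφ⟩
  obtain ⟨ψ, hψ⟩ := exists_sub_tupleCoboundary_mem_locallyZero hφ
  exact Submodule.mem_sup.2 ⟨_, ⟨ψ, mem_compactlySupported n ψ, rfl⟩, _, hψ, add_sub_cancel _ _⟩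

theorem cohomologyLength_zero_eq_one : cohomologyLength X 0 = 1 := by
  let δ : ((Fin 0 → X) → ℚ) →ₗ[ℚ] Cochain X 0 := tupleCoboundary 0
  have hcocycles : relCocycles coboundary (compactlySupported X) (locallyZero X) 0 =
      LinearMap.range δ ⊔ locallyZero X 0 := by
    apply le_antisymm
    · rintro φ ⟨-, hφ⟩
      obtain ⟨ψ, hψ⟩ := exists_sub_tupleCoboundary_mem_locallyZero hφ
      exact Submodule.mem_sup.2 ⟨_, ⟨ψ, rfl⟩, _, hψ, add_sub_cancel _ _⟩
    · refine sup_le ?_ fun φ hφ => ⟨mem_compactlySupported 0 φ, locallyZero_le_comap 0 hφ⟩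
      rintro _ ⟨ψ, rfl⟩
      refine ⟨mem_compactlySupported 0 _, ?_⟩
      change tupleCoboundary 1 (tupleCoboundary 0 ψ) ∈ locallyZero X 1
      exact tupleCoboundary_comp 0 ψ ▸ zero_mem _
  have hinj : (locallyZero X 0).comap δ = ⊥ := by
    refine (Submodule.eq_bot_iff _).mpr fun ψ hψ => funext fun p => ?_
    obtain ⟨x⟩ := (inferInstance : Nonempty X)
    exact (tupleCoboundary_zero_apply ψ _ p).symm.trans (apply_const_of_mem_locallyZero hψ x)
  rw [cohomologyLength, relCohomologyLength, hcocycles, relCoboundaries, relLength_sup_right,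
    LinearMap.range_eq_map, relLength_map, hinj, ← LinearMap.ker_id, relLength_ker,
    Submodule.map_id, Module.length_top, Module.length_eq_finrank]
  simp

theorem hasEulerChar_of_contractible : HasEulerChar X 1 := by
  have hlength : cohomologyLength X = Pi.single 0 1 := by
    funext n
    cases n with
    | zero => exact cohomologyLength_zero_eq_one
    | succ n => exact cohomologyLength_succ_eq_zero n
  rw [hasEulerChar_iff, hlength]
  refine ⟨⟨fun n => ?_, (Set.finite_singleton 0).subset Pi.support_single_subset⟩, ?_⟩
  · cases n <;> simp
  · rw [altSum, finsum_eq_single _ 0 fun n hn => by simp [hn]]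
    simp

end Contractible

section ContractibleComplement

variable {X : Type*} {n : ℕ}

theorem locallyZeroAt_of_pullback_val [TopologicalSpace X] {Z : Set X} {φ : Cochain X n}
    (h : pullback ((↑) : Z → X) (n + 1) φ ∈ locallyZero Z n) {x : X} (hx : x ∈ interior Z) :
    LocallyZeroAt φ x := by
  obtain ⟨V, hV, h⟩ := h ⟨x, interior_subset hx⟩
  refine ⟨(↑) '' V, ?_, fun p hp => ?_⟩
  · rw [← nhdsWithin_eq_nhds.2 (mem_interior_iff_mem_nhds.1 hx),
      nhdsWithin_eq_map_subtype_coe (interior_subset hx)]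
    exact Filter.image_mem_map hV
  · choose q hq hqp using hp
    rw [← funext hqp]
    exact h q hq

variable [MetricSpace X] [CompactSpace X] [ContractibleSpace X] {U : Set X}

/-- The exact sequence of the pair `(X, Z)`: a primitive of `φ` on `X` is corrected by a primitive
on `Z` of its restriction. -/
theorem relCocycles_supportedIn_le (hU : ∀ K ⊆ U, IsCompact K → ∃ Z : Set X, IsClosed Z ∧
      ContractibleSpace Z ∧ Disjoint K Z ∧ Uᶜ ⊆ interior Z) (n : ℕ) :
    relCocycles coboundary (supportedIn U) (locallyZero X) n ≤
      relCoboundaries coboundary (supportedIn U) (locallyZero X) n := by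
  rintro φ ⟨⟨K, hK, hKU, hφK⟩, hφ⟩
  obtain ⟨Z, hZ, hZcontr, hKZ, hUZ⟩ := hU K hKU hK
  have := isCompact_iff_compactSpace.1 hZ.isCompact
  obtain ⟨ψ, hψ⟩ := exists_sub_tupleCoboundary_mem_locallyZero hφ
  let i : C(Z, X) := ⟨(↑), continuous_subtype_val⟩
  have hδψ : pullback i (n + 1) (tupleCoboundary n ψ) ∈ locallyZero Z n := fun z => by
    have hφz := hφK z fun hz => Set.disjoint_left.1 hKZ hz z.2
    obtain ⟨V, hV, h⟩ := hφz.sub (hψ z)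
    exact ⟨i ⁻¹' V, i.continuous.continuousAt hV,
      fun p hp => (congrFun (sub_sub_cancel φ _) _).symm.trans (h _ hp)⟩
  cases n with
  | zero =>
    obtain ⟨z⟩ := (inferInstance : Nonempty Z)
    have hψ0 : tupleCoboundary 0 ψ = 0 := funext fun p => by
      have hz := apply_const_of_mem_locallyZero hδψ z
      rw [pullback_apply, tupleCoboundary_zero_apply _ _ Fin.elim0] at hz
      rwa [tupleCoboundary_zero_apply _ _ Fin.elim0]
    rwa [hψ0, sub_zero] at hψ
  | succ n =>
    obtain ⟨χ, hχ⟩ := exists_sub_tupleCoboundary_mem_locallyZero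
      (φ := pullback i (n + 1) ψ) hδψ
    let χ' : (Fin n → X) → ℚ := Function.extend (fun q k => (q k : X)) χ 0
    have hχ' : pullback i n χ' = χ :=
      funext fun q => (Subtype.val_injective.comp_left (α := Fin n)).extend_apply _ _ q
    have hsupp : ψ - tupleCoboundary n χ' ∈ supportedIn U n := by
      refine ⟨(interior Z)ᶜ, isOpen_interior.isClosed_compl.isCompact,
        Set.compl_subset_comm.1 hUZ, fun x hx => ?_⟩
      refine locallyZeroAt_of_pullback_val (Z := Z) ?_ (not_not.1 hx)
      convert hχ using 1
      rw [map_sub, ← hχ']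
      rfl
    refine Submodule.mem_sup.2 ⟨_, ⟨_, hsupp, rfl⟩, _, hψ, ?_⟩
    rw [map_sub, ← tupleCoboundary_succ n (tupleCoboundary n χ'), tupleCoboundary_comp, sub_zero]
    exact add_sub_cancel _ _

theorem hasEulerChar_zero_of_contractible (hU : IsOpen U)
    (hcompl : ∀ K ⊆ U, IsCompact K → ∃ Z : Set X, IsClosed Z ∧ ContractibleSpace Z ∧
      Disjoint K Z ∧ Uᶜ ⊆ interior Z) : HasEulerChar U 0 := by
  have := hU.locallyCompactSpace
  refine hasEulerChar_of_cohomologyLength_eq_zero (funext fun n => ?_)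
  rw [cohomologyLength_eq_supportedIn hU.isOpenEmbedding_subtypeVal, Subtype.range_coe]
  exact relLength_eq_zero_iff.2 (relCocycles_supportedIn_le hcompl n)

end ContractibleComplement

/-! ### Planar cells -/

section Convex

theorem HasEulerChar.diff_union {X : Type*} [TopologicalSpace X] [T2Space X] {C F F' : Set X}
    [LocallyCompactSpace C] (hF : IsClosed F) (hF' : IsClosed F')
    {α β γ : ℝ} (h : HasEulerChar {x : C | (x : X) ∉ F} α)
    (h' : HasEulerChar {x : C | (x : X) ∉ F'} β)
    (h'' : HasEulerChar {x : C | (x : X) ∉ F ∩ F'} γ) :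
    HasEulerChar {x : C | (x : X) ∉ F ∪ F'} (α + β - γ) := by
  have hinter : {x : C | (x : X) ∉ F ∪ F'} = {x : C | (x : X) ∉ F} ∩ {x : C | (x : X) ∉ F'} := by
    ext x
    simp
  have hunion : {x : C | (x : X) ∉ F ∩ F'} = {x : C | (x : X) ∉ F} ∪ {x : C | (x : X) ∉ F'} := by
    ext x
    simp [imp_iff_not_or]
  rw [hinter]
  rw [hunion] at h''
  exact h.inter (hF.isOpen_compl.preimage continuous_subtype_val)
    (hF'.isOpen_compl.preimage continuous_subtype_val) h' h''

variable {E : Type*} [NormedAddCommGroup E] [NormedSpace ℝ E] {C F : Set E}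

theorem hasEulerChar_of_convex (hC : IsCompact C) (hconv : Convex ℝ C) (hne : C.Nonempty) :
    HasEulerChar C 1 := by
  have := isCompact_iff_compactSpace.1 hC
  have := hconv.contractibleSpace hne
  exact hasEulerChar_of_contractible

theorem hasEulerChar_diff_convex (hC : IsCompact C) (hCconv : Convex ℝ C) (hF : IsClosed F)
    (hFconv : Convex ℝ F) (hne : (C ∩ F).Nonempty) : HasEulerChar {x : C | (x : E) ∉ F} 0 := by
  have := isCompact_iff_compactSpace.1 hC
  have := hCconv.contractibleSpace (hne.mono Set.inter_subset_left)
  refine hasEulerChar_zero_of_contractible (hF.isOpen_compl.preimage continuous_subtype_val)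
    fun K hKF hK => ?_
  have hdisj : Disjoint (Subtype.val '' K) F := by
    rw [Set.disjoint_left]
    rintro _ ⟨x, hx, rfl⟩
    exact hKF hx
  obtain ⟨δ, hδ, hthick⟩ :=
    hdisj.exists_cthickenings (hK.image continuous_subtype_val) hF
  refine ⟨Subtype.val ⁻¹' Metric.cthickening δ F,
    Metric.isClosed_cthickening.preimage continuous_subtype_val, ?_, ?_, fun x hx => ?_⟩
  · have e : (Subtype.val ⁻¹' Metric.cthickening δ F : Set C) ≃ₜ
        ↥(C ∩ Metric.cthickening δ F) :=
      (Topology.IsEmbedding.subtypeVal.homeomorphImage _).trans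
        (Homeomorph.setCongr (Subtype.image_preimage_coe C _))
    have := (hCconv.inter (hFconv.cthickening δ)).contractibleSpace
      (hne.mono (Set.inter_subset_inter_right C (Metric.self_subset_cthickening F)))
    exact e.contractibleSpace
  · rw [Set.disjoint_left]
    exact fun x hxK hxF => Set.disjoint_left.1 hthick
      (Metric.self_subset_cthickening _ ⟨x, hxK, rfl⟩) hxF
  · refine preimage_interior_subset_interior_preimage continuous_subtype_val
      (Metric.thickening_subset_interior_cthickening δ F ?_)
    exact Metric.self_subset_thickening hδ F (not_not.1 hx)

theorem nonempty_homeomorph_of_convex_isOpen_isBounded {V : Set E} (hconv : Convex ℝ V)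
    (hV : IsOpen V) (hb : Bornology.IsBounded V) (hne : V.Nonempty) : Nonempty (V ≃ₜ E) := by
  obtain ⟨e, he, -⟩ := exists_homeomorph_image_interior_closure_frontier_eq_unitBall hconv
    (hV.interior_eq.symm ▸ hne) hb
  rw [hV.interior_eq] at he
  exact ⟨(e.image V).trans ((Homeomorph.setCongr he).trans Homeomorph.unitBall.symm)⟩

end Convex

section Plane

/-- The closed triangle whose sides lie on the coordinate axes and on the line `x + y = 1`. -/
def triangle : Set (ℝ × ℝ) := {p | 0 ≤ p.1 ∧ 0 ≤ p.2 ∧ p.1 + p.2 ≤ 1}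

theorem isCompact_triangle : IsCompact triangle := by
  refine (isCompact_Icc (a := ((0 : ℝ), (0 : ℝ))) (b := (1, 1))).of_isClosed_subset ?_ ?_
  · exact (isClosed_le continuous_const continuous_fst).inter
      ((isClosed_le continuous_const continuous_snd).inter
        (isClosed_le (continuous_fst.add continuous_snd) continuous_const))
  · rintro ⟨x, y⟩ ⟨hx, hy, hxy⟩
    simp only at hx hy hxy
    exact ⟨⟨hx, hy⟩, by simp only; linarith, by simp only; linarith⟩

theorem convex_triangle : Convex ℝ triangle :=
  (convex_halfSpace_ge (LinearMap.fst ℝ ℝ ℝ).isLinear 0).inter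
    ((convex_halfSpace_ge (LinearMap.snd ℝ ℝ ℝ).isLinear 0).inter
      (convex_halfSpace_le (LinearMap.fst ℝ ℝ ℝ + LinearMap.snd ℝ ℝ ℝ).isLinear 1))

theorem hasEulerChar_triangle_diff_convex {F : Set (ℝ × ℝ)} (hF : IsClosed F)
    (hconv : Convex ℝ F) (hne : (triangle ∩ F).Nonempty) :
    HasEulerChar {x : triangle | (x : ℝ × ℝ) ∉ F} 0 :=
  hasEulerChar_diff_convex isCompact_triangle convex_triangle hF hconv hne

theorem hasEulerChar_triangle_diff_pair {v w : ℝ × ℝ} (hv : v ∈ triangle) (hw : w ∈ triangle)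
    (hvw : v ≠ w) :
    HasEulerChar {x : triangle | (x : ℝ × ℝ) ∉ ({v} ∪ {w} : Set (ℝ × ℝ))} (-1) := by
  have : CompactSpace triangle := isCompact_iff_compactSpace.1 isCompact_triangle
  have hv' := hasEulerChar_triangle_diff_convex isClosed_singleton (convex_singleton v) ⟨v, hv, rfl⟩
  have hw' := hasEulerChar_triangle_diff_convex isClosed_singleton (convex_singleton w) ⟨w, hw, rfl⟩
  have hempty : HasEulerChar {x : triangle | (x : ℝ × ℝ) ∉ (∅ : Set _)} 1 :=
    (hasEulerChar_of_convex isCompact_triangle convex_triangle ⟨v, hv⟩).homeomorph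
      ((Homeomorph.setCongr (by simp)).trans (Homeomorph.Set.univ triangle))
  convert hv'.diff_union isClosed_singleton isClosed_singleton hw' (γ := 1) ?_ using 1
  · norm_num
  · rwa [Set.singleton_inter_eq_empty.2 (by simpa using hvw)]

/-- The lines carrying the sides of `triangle` are convex and meet in the three vertices. -/
theorem hasEulerChar_triangle_diff_lines :
    HasEulerChar {x : triangle | (x : ℝ × ℝ) ∉
      ({p | p.1 = 0} ∪ {p | p.2 = 0}) ∪ {p | p.1 + p.2 = 1}} 1 := by
  have : CompactSpace triangle := isCompact_iff_compactSpace.1 isCompact_triangle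
  have h00 : ((0 : ℝ), (0 : ℝ)) ∈ triangle := by simp [triangle]
  have h10 : ((1 : ℝ), (0 : ℝ)) ∈ triangle := by simp [triangle]
  have h01 : ((0 : ℝ), (1 : ℝ)) ∈ triangle := by simp [triangle]
  have hclosed₁ : IsClosed {p : ℝ × ℝ | p.1 = 0} := isClosed_eq continuous_fst continuous_const
  have hclosed₂ : IsClosed {p : ℝ × ℝ | p.2 = 0} := isClosed_eq continuous_snd continuous_const
  have hclosed₃ : IsClosed {p : ℝ × ℝ | p.1 + p.2 = 1} :=
    isClosed_eq continuous_add continuous_const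
  have hline₁ := hasEulerChar_triangle_diff_convex hclosed₁
    (convex_hyperplane (LinearMap.fst ℝ ℝ ℝ).isLinear 0) ⟨_, h00, rfl⟩
  have hline₂ := hasEulerChar_triangle_diff_convex hclosed₂
    (convex_hyperplane (LinearMap.snd ℝ ℝ ℝ).isLinear 0) ⟨_, h00, rfl⟩
  have hline₃ := hasEulerChar_triangle_diff_convex hclosed₃
    (convex_hyperplane (LinearMap.fst ℝ ℝ ℝ + LinearMap.snd ℝ ℝ ℝ).isLinear 1)
    ⟨_, h10, add_zero (1 : ℝ)⟩
  have hinter₁₂ : {p : ℝ × ℝ | p.1 = 0} ∩ {p | p.2 = 0} = {(0, 0)} := by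
    ext ⟨x, y⟩
    simp
  have hinter₃ : ({p : ℝ × ℝ | p.1 = 0} ∪ {p | p.2 = 0}) ∩ {p | p.1 + p.2 = 1} =
      {(0, 1)} ∪ {(1, 0)} := by
    ext ⟨x, y⟩
    simp only [Set.mem_inter_iff, Set.mem_union, Set.mem_ofPred_eq, Set.mem_singleton_iff,
      Prod.mk.injEq]
    grind
  convert (hline₁.diff_union hclosed₁ hclosed₂ hline₂ (γ := 0) ?_).diff_union
    (hclosed₁.union hclosed₂) hclosed₃ hline₃ (γ := -1) ?_ using 1
  · norm_num
  · rw [hinter₁₂]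
    exact hasEulerChar_triangle_diff_convex isClosed_singleton (convex_singleton _) ⟨_, h00, rfl⟩
  · rw [hinter₃]
    exact hasEulerChar_triangle_diff_pair h01 h10 (by simp)

theorem hasEulerChar_plane : HasEulerChar ℂ 1 := by
  let V : Set (ℝ × ℝ) := {p | 0 < p.1} ∩ ({p | 0 < p.2} ∩ {p | p.1 + p.2 < 1})
  have hV : IsOpen V := (isOpen_lt continuous_const continuous_fst).inter
    ((isOpen_lt continuous_const continuous_snd).inter (isOpen_lt continuous_add continuous_const))
  have hconv : Convex ℝ V := (convex_halfSpace_gt (LinearMap.fst ℝ ℝ ℝ).isLinear 0).inter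
    ((convex_halfSpace_gt (LinearMap.snd ℝ ℝ ℝ).isLinear 0).inter
      (convex_halfSpace_lt (LinearMap.fst ℝ ℝ ℝ + LinearMap.snd ℝ ℝ ℝ).isLinear 1))
  have hVT : V ⊆ triangle := fun p hp => ⟨hp.1.le, hp.2.1.le, hp.2.2.le⟩
  obtain ⟨e⟩ := nonempty_homeomorph_of_convex_isOpen_isBounded hconv hV
    (isCompact_triangle.isBounded.subset hVT) ⟨(1 / 3, 1 / 3), by norm_num [V]⟩
  have himage : Subtype.val '' {x : triangle | (x : ℝ × ℝ) ∉
      ({p | p.1 = 0} ∪ {p | p.2 = 0}) ∪ {p | p.1 + p.2 = 1}} = V := by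
    ext p
    constructor
    · rintro ⟨⟨p, h₁, h₂, h₃⟩, hp, rfl⟩
      exact ⟨h₁.lt_of_ne fun e => hp (Or.inl (Or.inl e.symm)),
        h₂.lt_of_ne fun e => hp (Or.inl (Or.inr e.symm)), h₃.lt_of_ne fun e => hp (Or.inr e)⟩
    · exact fun hp => ⟨⟨p, hVT hp⟩, by
        rintro ((e | e) | e)
        exacts [hp.1.ne' e, hp.2.1.ne' e, hp.2.2.ne e], rfl⟩
  have := hV.locallyCompactSpace
  have hsub :=
    (Topology.IsEmbedding.subtypeVal.homeomorphImage _).trans (Homeomorph.setCongr himage)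
  have := hsub.isOpenEmbedding.locallyCompactSpace
  exact hasEulerChar_triangle_diff_lines.homeomorph
    (Complex.equivRealProdCLM.toHomeomorph.trans (e.symm.trans hsub.symm))

end Plane

section Boxes

/-- Nonempty open intervals, possibly unbounded. -/
structure IsOpenInterval (I : Set ℝ) : Prop where
  isOpen : IsOpen I
  ordConnected : I.OrdConnected
  nonempty : I.Nonempty

theorem isOpenInterval_univ : IsOpenInterval Set.univ :=
  ⟨isOpen_univ, Set.ordConnected_univ, Set.univ_nonempty⟩

variable {I J : Set ℝ} {x : ℝ}

theorem IsOpenInterval.inter_Iio (hI : IsOpenInterval I) (hx : x ∈ I) :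
    IsOpenInterval (I ∩ Set.Iio x) := by
  obtain ⟨y, hyx, hy⟩ := mem_nhdsLT_iff_exists_Ioo_subset.1
    (mem_nhdsWithin_of_mem_nhds (hI.isOpen.mem_nhds hx))
  obtain ⟨z, hz⟩ := Set.nonempty_Ioo.2 (Set.mem_Iio.1 hyx)
  exact ⟨hI.isOpen.inter isOpen_Iio, hI.ordConnected.inter Set.ordConnected_Iio, z, hy hz, hz.2⟩

theorem IsOpenInterval.inter_Ioi (hI : IsOpenInterval I) (hx : x ∈ I) :
    IsOpenInterval (I ∩ Set.Ioi x) := by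
  obtain ⟨y, hyx, hy⟩ := mem_nhdsGT_iff_exists_Ioo_subset.1
    (mem_nhdsWithin_of_mem_nhds (hI.isOpen.mem_nhds hx))
  obtain ⟨z, hz⟩ := Set.nonempty_Ioo.2 (Set.mem_Ioi.1 hyx)
  exact ⟨hI.isOpen.inter isOpen_Ioi, hI.ordConnected.inter Set.ordConnected_Ioi, z, hy hz, hz.1⟩

theorem inter_Iio_union_inter_Ioi (I : Set ℝ) (x : ℝ) :
    I ∩ Set.Iio x ∪ I ∩ Set.Ioi x = I \ {x} := by
  rw [← Set.inter_union_distrib_left, Set.Iio_union_Ioi, Set.sdiff_eq]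

theorem disjoint_inter_Iio_inter_Ioi (I : Set ℝ) (x : ℝ) :
    Disjoint (I ∩ Set.Iio x) (I ∩ Set.Ioi x) :=
  Set.disjoint_left.2 fun _ h h' => lt_asymm (Set.mem_Iio.1 h.2) h'.2

/-- A homeomorphism from `ℝ` onto a bounded interval maps open intervals to bounded ones. -/
theorem IsOpenInterval.nonempty_homeomorph (hI : IsOpenInterval I) : Nonempty (I ≃ₜ ℝ) := by
  let f : ℝ → ℝ := fun x => (Homeomorph.unitBall x : ℝ)
  have hf : Topology.IsOpenEmbedding f :=
    Metric.isOpen_ball.isOpenEmbedding_subtypeVal.comp Homeomorph.unitBall.isOpenEmbedding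
  have hconn : IsPreconnected (f '' I) :=
    hI.ordConnected.isPreconnected.image f hf.continuous.continuousOn
  have hbounded : Bornology.IsBounded (f '' I) := Metric.isBounded_ball.subset <| by
    rintro _ ⟨x, -, rfl⟩
    exact (Homeomorph.unitBall x).2
  obtain ⟨e⟩ := nonempty_homeomorph_of_convex_isOpen_isBounded hconn.ordConnected.convex
    (hf.isOpenMap I hI.isOpen) hbounded (hI.nonempty.image f)
  exact ⟨(hf.isEmbedding.homeomorphImage I).trans e⟩

theorem IsOpenInterval.nonempty_homeomorph_reProdIm (hI : IsOpenInterval I)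
    (hJ : IsOpenInterval J) : Nonempty (I ×ℂ J ≃ₜ ℂ) := by
  obtain ⟨e⟩ := hI.nonempty_homeomorph
  obtain ⟨e'⟩ := hJ.nonempty_homeomorph
  have hbox : (I ×ℂ J : Set ℂ) ≃ₜ I ×ˢ J :=
    Complex.equivRealProdCLM.toHomeomorph.sets (by ext; rfl)
  exact ⟨((hbox.trans (Homeomorph.Set.prod I J)).trans (e.prodCongr e')).trans
    Complex.equivRealProdCLM.toHomeomorph.symm⟩

end Boxes

/-! ### Coverings of the punctured plane -/

section CellCover

/-- `π : X → ℂ` avoids the finite set `P` and behaves, as far as Euler characteristics are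
concerned, like a covering of degree `m` over the open cells of `ℂ \ P`. -/
structure CellCover {X : Type*} [TopologicalSpace X] (π : X → ℂ) (P : Finset ℂ) (m : ℕ) :
    Prop where
  continuous : Continuous π
  notMem : ∀ x, π x ∉ P
  hasEulerChar : ∀ S : Set ℂ, IsOpen S → Nonempty (S ≃ₜ ℂ) → Disjoint S P →
    HasEulerChar (π ⁻¹' S) m

/-- The Euler characteristic of `π ⁻¹' S` is that of a covering of degree `m` of a disjoint union
of `k` cells punctured at the points of `P`. -/
def CoversCells {X : Type*} [TopologicalSpace X] (π : X → ℂ) (P : Finset ℂ) (m : ℕ) (S : Set ℂ)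
    (k : ℝ) : Prop :=
  HasEulerChar (π ⁻¹' S) (m * (k - (S ∩ P).ncard))

variable {X : Type*} [TopologicalSpace X] [T2Space X] [LocallyCompactSpace X] {π : X → ℂ}
  {P : Finset ℂ} {m : ℕ} {S T : Set ℂ} {k l : ℝ}

theorem CoversCells.union (hπ : Continuous π) (hS : IsOpen S) (hT : IsOpen T)
    (h : CoversCells π P m S k) (h' : CoversCells π P m T l) {j : ℝ}
    (h'' : CoversCells π P m (S ∩ T) j) : CoversCells π P m (S ∪ T) (k + l - j) := by
  have hcard : (((S ∪ T) ∩ P).ncard : ℝ) + ((S ∩ T) ∩ P).ncard =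
      (S ∩ P).ncard + (T ∩ P).ncard := by
    have := Set.ncard_union_add_ncard_inter (S ∩ P) (T ∩ P)
      (P.finite_toSet.inter_of_right S) (P.finite_toSet.inter_of_right T)
    rw [← Set.union_inter_distrib_right, ← Set.inter_inter_distrib_right] at this
    exact_mod_cast this
  have := HasEulerChar.union (hS.preimage hπ) (hT.preimage hπ) h h' h''
  rw [CoversCells, Set.preimage_union]
  convert this using 1
  linear_combination (m : ℝ) * -hcard

theorem CoversCells.union_of_disjoint (hπ : Continuous π) (hS : IsOpen S) (hT : IsOpen T)
    (hST : Disjoint S T) (h : CoversCells π P m S k) (h' : CoversCells π P m T l) :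
    CoversCells π P m (S ∪ T) (k + l) := by
  have hempty : CoversCells π P m (S ∩ T) 0 := by
    rw [hST.inter_eq, CoversCells]
    simpa using hasEulerChar_of_isEmpty
  simpa using h.union hπ hS hT h' hempty

variable {I J : Set ℝ} {x y : ℝ}

theorem CoversCells.diff_reProdIm (hπ : Continuous π) (hI : IsOpen I) (hJ : IsOpen J)
    (h : CoversCells π P m ((I ∩ Set.Iio x) ×ℂ J) k)
    (h' : CoversCells π P m ((I ∩ Set.Ioi x) ×ℂ J) l) :
    CoversCells π P m ((I \ {x}) ×ℂ J) (k + l) := by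
  have hunion := h.union_of_disjoint hπ ((hI.inter isOpen_Iio).reProdIm hJ)
    ((hI.inter isOpen_Ioi).reProdIm hJ)
    (Set.disjoint_left.2 fun z hz hz' =>
      Set.disjoint_left.1 (disjoint_inter_Iio_inter_Ioi I x) hz.1 hz'.1) h'
  rwa [show (I ∩ Set.Iio x) ×ℂ J ∪ (I ∩ Set.Ioi x) ×ℂ J = (I \ {x}) ×ℂ J by
    ext z
    simp only [← inter_Iio_union_inter_Ioi, Set.mem_union, Complex.mem_reProdIm]
    tauto] at hunion

theorem CoversCells.reProdIm_diff (hπ : Continuous π) (hI : IsOpen I) (hJ : IsOpen J)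
    (h : CoversCells π P m (I ×ℂ (J ∩ Set.Iio y)) k)
    (h' : CoversCells π P m (I ×ℂ (J ∩ Set.Ioi y)) l) :
    CoversCells π P m (I ×ℂ (J \ {y})) (k + l) := by
  have hunion := h.union_of_disjoint hπ (hI.reProdIm (hJ.inter isOpen_Iio))
    (hI.reProdIm (hJ.inter isOpen_Ioi))
    (Set.disjoint_left.2 fun z hz hz' =>
      Set.disjoint_left.1 (disjoint_inter_Iio_inter_Ioi J y) hz.2 hz'.2) h'
  rwa [show I ×ℂ (J ∩ Set.Iio y) ∪ I ×ℂ (J ∩ Set.Ioi y) = I ×ℂ (J \ {y}) by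
    ext z
    simp only [← inter_Iio_union_inter_Ioi, Set.mem_union, Complex.mem_reProdIm]
    tauto] at hunion

/-- The vertical and the horizontal line through `p` leave two open sets which cover the box
except for `p` and meet in the four quadrants. -/
theorem CoversCells.reProdIm_diff_singleton (hπ : Continuous π) (hI : IsOpenInterval I)
    (hJ : IsOpenInterval J) {p : ℂ} (hp : p ∈ I ×ℂ J)
    (h : ∀ I' J' : Set ℝ, IsOpenInterval I' → IsOpenInterval J' → I' ⊆ I → J' ⊆ J →
      p ∉ I' ×ℂ J' → CoversCells π P m (I' ×ℂ J') 1) :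
    CoversCells π P m (I ×ℂ J \ {p}) 0 := by
  have hIl := hI.inter_Iio hp.1
  have hIr := hI.inter_Ioi hp.1
  have hJl := hJ.inter_Iio hp.2
  have hJr := hJ.inter_Ioi hp.2
  have hre : ∀ {J'}, IsOpenInterval J' → J' ⊆ J →
      CoversCells π P m ((I ∩ Set.Iio p.re) ×ℂ J') 1 ∧
        CoversCells π P m ((I ∩ Set.Ioi p.re) ×ℂ J') 1 := fun hJ' hJJ' =>
    ⟨h _ _ hIl hJ' Set.inter_subset_left hJJ' fun hp => lt_irrefl p.re hp.1.2,
      h _ _ hIr hJ' Set.inter_subset_left hJJ' fun hp => lt_irrefl p.re hp.1.2⟩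
  have hvertical := (hre hJ le_rfl).1.diff_reProdIm hπ hI.isOpen hJ.isOpen (hre hJ le_rfl).2
  have hhorizontal := CoversCells.reProdIm_diff hπ hI.isOpen hJ.isOpen
    (h _ _ hI hJl le_rfl Set.inter_subset_left fun hp => lt_irrefl p.im hp.2.2)
    (h _ _ hI hJr le_rfl Set.inter_subset_left fun hp => lt_irrefl p.im hp.2.2)
  have hquadrants := CoversCells.diff_reProdIm hπ hI.isOpen (hJ.isOpen.sdiff isClosed_singleton)
    ((hre hJl Set.inter_subset_left).1.reProdIm_diff hπ hIl.isOpen hJ.isOpen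
      (hre hJr Set.inter_subset_left).1)
    ((hre hJl Set.inter_subset_left).2.reProdIm_diff hπ hIr.isOpen hJ.isOpen
      (hre hJr Set.inter_subset_left).2)
  have hinter : (I \ {p.re}) ×ℂ J ∩ I ×ℂ (J \ {p.im}) = (I \ {p.re}) ×ℂ (J \ {p.im}) := by
    ext z
    simp only [Set.mem_inter_iff, Complex.mem_reProdIm, Set.mem_sdiff]
    tauto
  have hunion : (I \ {p.re}) ×ℂ J ∪ I ×ℂ (J \ {p.im}) = I ×ℂ J \ {p} := by
    ext z
    simp only [Set.mem_union, Complex.mem_reProdIm, Set.mem_sdiff, Set.mem_singleton_iff,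
      Complex.ext_iff]
    tauto
  have hpunctured := hvertical.union hπ ((hI.isOpen.sdiff isClosed_singleton).reProdIm hJ.isOpen)
    (hI.isOpen.reProdIm (hJ.isOpen.sdiff isClosed_singleton)) hhorizontal (hinter ▸ hquadrants)
  rwa [hunion, sub_self] at hpunctured

omit [T2Space X] [LocallyCompactSpace X] in
theorem CoversCells.of_diff_singleton (hP : ∀ x, π x ∉ P) {p : ℂ} (hp : p ∈ S ∩ P)
    (h : CoversCells π P m (S \ {p}) k) : CoversCells π P m S (k + 1) := by
  have hpreimage : π ⁻¹' (S \ {p}) = π ⁻¹' S :=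
    (Set.preimage_mono Set.sdiff_subset).antisymm fun x hx =>
      ⟨hx, fun hxp => hP x (Set.mem_singleton_iff.1 hxp ▸ hp.2)⟩
  have hcard : (((S \ {p}) ∩ P).ncard : ℝ) + 1 = (S ∩ P).ncard := by
    rw [← Set.inter_sdiff_right_comm]
    exact_mod_cast Set.ncard_sdiff_singleton_add_one hp (P.finite_toSet.inter_of_right S)
  rw [CoversCells, hpreimage] at h
  rw [CoversCells, ← hcard]
  convert h using 2
  ring

theorem CellCover.coversCells_reProdIm (h : CellCover π P m) (hI : IsOpenInterval I)
    (hJ : IsOpenInterval J) : CoversCells π P m (I ×ℂ J) 1 := by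
  induction hn : (I ×ℂ J ∩ P).ncard using Nat.strong_induction_on generalizing I J with
  | h n ih =>
  subst hn
  obtain hempty | ⟨p, hp⟩ := (I ×ℂ J ∩ P).eq_empty_or_nonempty
  · rw [CoversCells, hempty]
    simpa using h.hasEulerChar _ (hI.isOpen.reProdIm hJ.isOpen)
      (hI.nonempty_homeomorph_reProdIm hJ) (Set.disjoint_iff_inter_eq_empty.2 hempty)
  · have hpunctured : CoversCells π P m (I ×ℂ J \ {p}) 0 := by
      refine CoversCells.reProdIm_diff_singleton h.continuous hI hJ hp.1
        fun I' J' hI' hJ' hII' hJJ' hp' => ih _ ?_ hI' hJ' rfl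
      have hsubset : I' ×ℂ J' ∩ P ⊆ I ×ℂ J ∩ P :=
        Set.inter_subset_inter_left _ fun z hz => ⟨hII' hz.1, hJJ' hz.2⟩
      exact Set.ncard_lt_ncard ((Set.ssubset_iff_of_subset hsubset).2
        ⟨p, hp, fun hp'' => hp' hp''.1⟩) (P.finite_toSet.inter_of_right _)
    simpa using hpunctured.of_diff_singleton h.notMem hp

theorem CellCover.hasEulerChar_total (h : CellCover π P m) :
    HasEulerChar X (m * (1 - P.card)) := by
  have huniv := h.coversCells_reProdIm isOpenInterval_univ isOpenInterval_univ
  have hpreimage : π ⁻¹' (Set.univ ×ℂ Set.univ) = Set.univ := by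
    ext
    simp [Complex.mem_reProdIm]
  have hcard : ((Set.univ ×ℂ Set.univ ∩ P : Set ℂ)).ncard = P.card := by
    rw [← Set.ncard_coe_finset]
    congr
    ext
    simp [Complex.mem_reProdIm]
  rw [CoversCells, hpreimage, hcard] at huniv
  have : LocallyCompactSpace (Set.univ : Set X) := isOpen_univ.locallyCompactSpace
  exact huniv.homeomorph (Homeomorph.Set.univ X).symm

end CellCover

section RootCover

variable {A : Type*} [TopologicalSpace A]

theorem HasEulerChar.biUnion_of_pairwise_disjoint {ι : Type*} [T2Space A] [LocallyCompactSpace A]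
    {U : ι → Set A} {c : ι → ℝ} (hU : ∀ i, IsOpen (U i))
    (hdisj : Pairwise fun i j => Disjoint (U i) (U j)) (h : ∀ i, HasEulerChar (U i) (c i))
    (s : Finset ι) :
    HasEulerChar (⋃ i ∈ s, U i) (∑ i ∈ s, c i) := by
  classical
  induction s using Finset.induction_on with
  | empty =>
    have hempty : ⋃ i ∈ (∅ : Finset ι), U i = ∅ := by simp
    rw [hempty, Finset.sum_empty]
    exact hasEulerChar_of_isEmpty
  | insert i s hi ih =>
    have hinter : U i ∩ ⋃ j ∈ s, U j = ∅ := by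
      refine (Set.disjoint_iUnion₂_right.2 fun j hj => hdisj ?_).inter_eq
      rintro rfl
      exact hi hj
    have hempty : HasEulerChar ↥(U i ∩ ⋃ j ∈ s, U j) 0 := by
      rw [hinter]
      exact hasEulerChar_of_isEmpty
    have hunion := HasEulerChar.union (hU i) (isOpen_biUnion fun j _ => hU j) (h i) ih hempty
    rw [sub_zero, ← Finset.sum_insert hi] at hunion
    rwa [Finset.set_biUnion_insert]

theorem HasEulerChar.prod_discrete {ι : Type*} [T2Space A] [LocallyCompactSpace A]
    [TopologicalSpace ι] [DiscreteTopology ι] [Fintype ι] {c : ℝ} (h : HasEulerChar A c) :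
    HasEulerChar (A × ι) (Fintype.card ι * c) := by
  have hslice : ∀ i : ι, HasEulerChar (Prod.snd ⁻¹' {i} : Set (A × ι)) c := fun i =>
    h.homeomorph
      { toFun x := x.1.1
        invFun a := ⟨(a, i), rfl⟩
        left_inv := by
          rintro ⟨⟨a, k⟩, rfl : k = i⟩
          rfl
        right_inv _ := rfl
        continuous_toFun := by fun_prop
        continuous_invFun := by fun_prop }
  have hunion := HasEulerChar.biUnion_of_pairwise_disjoint
    (fun i => (isOpen_discrete {i}).preimage continuous_snd)
    (fun i j hij => (Set.disjoint_singleton.2 hij).preimage _) hslice Finset.univ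
  have huniv : ⋃ i ∈ (Finset.univ : Finset ι), (Prod.snd ⁻¹' {i} : Set (A × ι)) = Set.univ := by
    ext
    simp
  rw [huniv, Finset.sum_const, Finset.card_univ, nsmul_eq_mul] at hunion
  have : LocallyCompactSpace (Set.univ : Set (A × ι)) := isOpen_univ.locallyCompactSpace
  exact hunion.homeomorph (Homeomorph.Set.univ _).symm

theorem exists_continuous_root [SimplyConnectedSpace A] [LocallyPathConnectedSpace A] {m : ℕ}
    (hm : m ≠ 0) {f : A → ℂ} (hf : Continuous f) (h0 : ∀ a, f a ≠ 0) :
    ∃ h : A → ℂ, Continuous h ∧ ∀ a, h a ^ m = f a := by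
  obtain ⟨a₀⟩ : Nonempty A := inferInstance
  obtain ⟨F, ⟨-, hF⟩, -⟩ := Complex.isCoveringMapOn_exp.existsUnique_continuousMap_lifts
    (⟨f, hf⟩ : C(A, ℂ)) (a₀ := a₀) (Complex.exp_log (h0 _)) h0
  refine ⟨fun a => Complex.exp (F a / m), by fun_prop, fun a => ?_⟩
  rw [← Complex.exp_nat_mul, mul_div_cancel₀ _ (Nat.cast_ne_zero.2 hm)]
  exact congrFun hF a

theorem locallyCompactSpace_sep_eq {Y : Type*} [TopologicalSpace Y] [T1Space Y]
    [LocallyCompactSpace A] {U : Set A} (hU : IsOpen U) {f : A → Y} (hf : ContinuousOn f U)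
    (c : Y) :
    LocallyCompactSpace {a ∈ U | f a = c} := by
  obtain ⟨C, hC, hCeq⟩ := continuousOn_iff_isClosed.1 hf {c} isClosed_singleton
  have hset : {a ∈ U | f a = c} = C ∩ U := by
    rw [← hCeq]
    ext a
    exact and_comm
  rw [hset]
  exact (hC.isLocallyClosed.inter hU.isLocallyClosed).locallyCompactSpace

/-- The curve `s ^ m = g t` over the complement of the finite set `P`. -/
def rootCover (P : Finset ℂ) (m : ℕ) (g : ℂ → ℂ) : Set (ℂ × ℂ) :=
  {z | z.2 ∉ P ∧ z.1 ^ m = g z.2}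

variable {P : Finset ℂ} {m : ℕ} {g : ℂ → ℂ}

theorem locallyCompactSpace_rootCover (hg : ContinuousOn g (P : Set ℂ)ᶜ) :
    LocallyCompactSpace (rootCover P m g) := by
  have hset : rootCover P m g = {z ∈ Prod.snd ⁻¹' (P : Set ℂ)ᶜ | z.1 ^ m - g z.2 = 0} := by
    ext z
    exact and_congr_right fun _ => sub_eq_zero.symm
  rw [hset]
  exact locallyCompactSpace_sep_eq (P.finite_toSet.isClosed.isOpen_compl.preimage continuous_snd)
    ((by fun_prop : Continuous fun z : ℂ × ℂ => z.1 ^ m).continuousOn.sub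
      (hg.comp continuousOn_snd fun z hz => hz)) 0

/-- Over a cell, dividing by a continuous `m`-th root of `g` trivializes the covering. -/
noncomputable def rootCoverTrivialization {S : Set ℂ} (hS : Disjoint S P) {h : S → ℂ} (hm : m ≠ 0)
    (hh : Continuous h) (hroot : ∀ t, h t ^ m = g t) (h0 : ∀ t ∈ S, g t ≠ 0) :
    (fun z : rootCover P m g => z.1.2) ⁻¹' S ≃ₜ S × Polynomial.nthRootsFinset m (1 : ℂ) :=
  have hne : ∀ t, h t ≠ 0 := fun t ht => h0 t t.2 (by rw [← hroot, ht, zero_pow hm])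
  { toFun z := (⟨z.1.1.2, z.2⟩, ⟨z.1.1.1 / h ⟨z.1.1.2, z.2⟩, by
      rw [Polynomial.mem_nthRootsFinset hm.bot_lt, div_pow, hroot, z.1.2.2, div_self (h0 _ z.2)]⟩)
    invFun y := ⟨⟨(y.2.1 * h y.1, y.1.1), Set.disjoint_left.1 hS y.1.2, by
      simp only [mul_pow, (Polynomial.mem_nthRootsFinset hm.bot_lt 1).1 y.2.2, hroot, one_mul]⟩,
      y.1.2⟩
    left_inv z := Subtype.ext (Subtype.ext (Prod.ext (div_mul_cancel₀ _ (hne _)) rfl))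
    right_inv y := Prod.ext rfl (Subtype.ext (mul_div_cancel_right₀ _ (hne _)))
    continuous_toFun := by
      have hproj : Continuous fun z : (fun z : rootCover P m g => z.1.2) ⁻¹' S =>
          (⟨z.1.1.2, z.2⟩ : S) := by fun_prop
      exact hproj.prodMk (Continuous.subtype_mk
        (Continuous.div (by fun_prop) (hh.comp hproj) fun z => hne _) _)
    continuous_invFun := by fun_prop }

theorem cellCover_rootCover (hm : m ≠ 0) (hg : ContinuousOn g (P : Set ℂ)ᶜ)
    (h0 : ∀ t ∉ P, g t ≠ 0) : CellCover (fun z : rootCover P m g => z.1.2) P m := by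
  refine ⟨by fun_prop, fun z => z.2.1, fun S _ ⟨e⟩ hSP => ?_⟩
  have hg' : ∀ t ∈ S, g t ≠ 0 := fun t ht => h0 t (Set.disjoint_left.1 hSP ht)
  have hgS : Continuous fun z : ℂ => g (e.symm z) := hg.comp_continuous (by fun_prop) fun z =>
    Set.disjoint_left.1 hSP (e.symm z).2
  obtain ⟨h, hh, hroot⟩ := exists_continuous_root hm hgS fun z => hg' _ (e.symm z).2
  let E := rootCoverTrivialization hSP hm (hh.comp e.continuous)
    (fun t => by simpa using hroot (e t)) hg'
  have hcard : Fintype.card (Polynomial.nthRootsFinset m (1 : ℂ)) = m := by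
    rw [Fintype.card_coe]
    exact (Complex.isPrimitiveRoot_exp m hm).card_nthRootsFinset
  have hprod := hasEulerChar_plane.prod_discrete (ι := Polynomial.nthRootsFinset m (1 : ℂ))
  rw [hcard, mul_one] at hprod
  exact hprod.homeomorph (E.trans (e.prodCongr (Homeomorph.refl _)))

theorem hasEulerChar_rootCover (hm : m ≠ 0) (hg : ContinuousOn g (P : Set ℂ)ᶜ)
    (h0 : ∀ t ∉ P, g t ≠ 0) : HasEulerChar (rootCover P m g) (m * (1 - P.card)) :=
  have := locallyCompactSpace_rootCover (m := m) hg
  (cellCover_rootCover hm hg h0).hasEulerChar_total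

theorem hasEulerChar_compl_zero : HasEulerChar ({0}ᶜ : Set ℂ) 0 := by
  let e : ({0}ᶜ : Set ℂ) ≃ₜ rootCover {0} 1 id :=
    { toFun t := ⟨(t, t), ⟨fun h => t.2 (Finset.mem_singleton.1 h), pow_one _⟩⟩
      invFun z := ⟨z.1.2, fun h => z.2.1 (Finset.mem_singleton.2 h)⟩
      left_inv _ := rfl
      right_inv z := Subtype.ext (Prod.ext (by simpa [eq_comm] using z.2.2) rfl)
      continuous_toFun := by fun_prop
      continuous_invFun := by fun_prop }
  have := locallyCompactSpace_rootCover (P := {0}) (m := 1) continuousOn_id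
  have hcover := hasEulerChar_rootCover (P := {0}) one_ne_zero continuousOn_id (by simp)
  simpa using hcover.homeomorph e

end RootCover

/-! ### Curves in the torus -/

section Torus

/-- The torus `(ℂ*)²`. -/
def torus : Set (ℂ × ℂ) := {0}ᶜ ×ˢ {0}ᶜ

theorem isOpen_torus : IsOpen torus := isOpen_compl_singleton.prod isOpen_compl_singleton

/-- The monomial map with the exponents `(k, l)` and `(k', l')`. -/
noncomputable def monomialMap (k l k' l' : ℤ) (z : ℂ × ℂ) : ℂ × ℂ :=
  (z.1 ^ k * z.2 ^ l, z.1 ^ k' * z.2 ^ l')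

theorem continuousOn_monomialMap (k l k' l' : ℤ) : ContinuousOn (monomialMap k l k' l') torus := by
  have hfst : ∀ n : ℤ, ContinuousOn (fun z : ℂ × ℂ => z.1 ^ n) torus := fun n =>
    continuousOn_fst.zpow₀ n fun z hz => Or.inl hz.1
  have hsnd : ∀ n : ℤ, ContinuousOn (fun z : ℂ × ℂ => z.2 ^ n) torus := fun n =>
    continuousOn_snd.zpow₀ n fun z hz => Or.inl hz.2
  exact ((hfst k).mul (hsnd l)).prodMk ((hfst k').mul (hsnd l'))

theorem monomialMap_mem_torus (k l k' l' : ℤ) {z : ℂ × ℂ} (hz : z ∈ torus) :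
    monomialMap k l k' l' z ∈ torus :=
  ⟨mul_ne_zero (zpow_ne_zero _ hz.1) (zpow_ne_zero _ hz.2),
    mul_ne_zero (zpow_ne_zero _ hz.1) (zpow_ne_zero _ hz.2)⟩

theorem zpow_mul_zpow_zpow {x y : ℂ} (hx : x ≠ 0) (hy : y ≠ 0) (k l k' l' a b : ℤ) :
    (x ^ k * y ^ l) ^ a * (x ^ k' * y ^ l') ^ b = x ^ (k * a + k' * b) * y ^ (l * a + l' * b) := by
  rw [mul_zpow, mul_zpow, ← zpow_mul, ← zpow_mul, ← zpow_mul, ← zpow_mul, zpow_add₀ hx,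
    zpow_add₀ hy]
  ring

theorem monomialMap_monomialMap {k l k' l' a b a' b' : ℤ} (h₁₁ : k * a + k' * b = 1)
    (h₁₂ : l * a + l' * b = 0) (h₂₁ : k * a' + k' * b' = 0) (h₂₂ : l * a' + l' * b' = 1)
    {z : ℂ × ℂ} (hz : z ∈ torus) : monomialMap a b a' b' (monomialMap k l k' l' z) = z := by
  simp only [monomialMap, zpow_mul_zpow_zpow hz.1 hz.2, h₁₁, h₁₂, h₂₁, h₂₂, zpow_one, zpow_zero,
    one_mul, mul_one]

/-- The coordinate change of the torus whose second component is `x ^ e₁ y ^ e₂`. -/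
noncomputable def torusCoordinates {e₁ e₂ u v : ℤ} (h : u * e₁ + v * e₂ = 1) :
    OpenPartialHomeomorph (ℂ × ℂ) (ℂ × ℂ) where
  toFun := monomialMap (-v) u e₁ e₂
  invFun := monomialMap (-e₂) u e₁ v
  source := torus
  target := torus
  map_source' _ := monomialMap_mem_torus _ _ _ _
  map_target' _ := monomialMap_mem_torus _ _ _ _
  left_inv' _ := monomialMap_monomialMap (by linarith) (by ring) (by ring) (by linarith)
  right_inv' _ := monomialMap_monomialMap (by linarith) (by ring) (by ring) (by linarith)
  open_source := isOpen_torus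
  open_target := isOpen_torus
  continuousOn_toFun := continuousOn_monomialMap _ _ _ _
  continuousOn_invFun := continuousOn_monomialMap _ _ _ _

theorem exists_homeomorph_torus_curve (a b : ℤ) {e₁ e₂ : ℤ} (he : IsCoprime e₁ e₂) (φ : ℂ → ℂ) :
    ∃ k : ℤ, Nonempty ({z ∈ torus | z.1 ^ a * z.2 ^ b * φ (z.1 ^ e₁ * z.2 ^ e₂) = 1} ≃ₜ
      {z ∈ torus | z.1 ^ (e₁ * b - e₂ * a) * (z.2 ^ k * φ z.2) = 1}) := by
  obtain ⟨u, v, huv⟩ := he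
  refine ⟨u * a + v * b, ⟨(torusCoordinates huv).homeomorphOfImageSubsetSource
    (fun z hz => hz.1) ?_⟩⟩
  rw [(torusCoordinates huv).image_eq_target_inter_inv_preimage fun z hz => hz.1]
  ext ⟨x, y⟩
  refine and_congr_right fun hz : (x, y) ∈ torus => ?_
  refine (and_iff_right (monomialMap_mem_torus _ _ _ _ hz)).trans ?_
  change (x ^ (-e₂) * y ^ u) ^ a * (x ^ e₁ * y ^ v) ^ b *
    φ ((x ^ (-e₂) * y ^ u) ^ e₁ * (x ^ e₁ * y ^ v) ^ e₂) = 1 ↔ _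
  rw [zpow_mul_zpow_zpow hz.1 hz.2, zpow_mul_zpow_zpow hz.1 hz.2, huv,
    show -e₂ * e₁ + e₁ * e₂ = 0 by ring, show -e₂ * a + e₁ * b = e₁ * b - e₂ * a by ring,
    zpow_zero, one_mul, zpow_one, mul_assoc]

variable {G : ℂ → ℂ} {P : Finset ℂ}

theorem hasEulerChar_torus_pow_eq {n : ℕ} (hn : n ≠ 0) (hG : ContinuousOn G (P : Set ℂ)ᶜ)
    (hP : ∀ t, t ∈ P ↔ t = 0 ∨ G t = 0) :
    HasEulerChar {z ∈ torus | z.1 ^ n = G z.2} (n * (1 - P.card)) := by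
  have hcover : {z ∈ torus | z.1 ^ n = G z.2} = rootCover P n G := by
    ext ⟨s, t⟩
    refine and_congr_left fun hroot : s ^ n = G t => ?_
    simp [torus, hP, ← hroot, hn, and_comm]
  rw [hcover]
  exact hasEulerChar_rootCover hn hG fun t ht => by
    simp only [hP, not_or] at ht
    exact ht.2

theorem hasEulerChar_torus_zpow_mul_eq_one {M : ℤ} (hM : M ≠ 0)
    (hG : ContinuousOn G (P : Set ℂ)ᶜ) (hP : ∀ t, t ∈ P ↔ t = 0 ∨ G t = 0) :
    HasEulerChar {z ∈ torus | z.1 ^ M * G z.2 = 1} (|(M : ℝ)| * (1 - P.card)) := by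
  have hG0 : ∀ t ∉ P, G t ≠ 0 := fun t ht h => ht ((hP t).2 (Or.inr h))
  obtain ⟨n, rfl | rfl⟩ := M.eq_nat_or_neg
  · have hset : {z ∈ torus | z.1 ^ (n : ℤ) * G z.2 = 1} = {z ∈ torus | z.1 ^ n = (G z.2)⁻¹} := by
      ext z
      refine and_congr_right fun hz => ?_
      rw [zpow_natCast, mul_eq_one_iff_inv_eq₀ (pow_ne_zero _ hz.1), inv_eq_iff_eq_inv]
    rw [hset]
    simpa using hasEulerChar_torus_pow_eq (by simpa using hM) (hG.inv₀ hG0) (by simpa using hP)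
  · have hset : {z ∈ torus | z.1 ^ (-n : ℤ) * G z.2 = 1} = {z ∈ torus | z.1 ^ n = G z.2} := by
      ext z
      refine and_congr_right fun hz => ?_
      rw [zpow_neg, zpow_natCast, inv_mul_eq_one₀ (pow_ne_zero _ hz.1)]
    rw [hset]
    simpa using hasEulerChar_torus_pow_eq (by simpa using hM) hG hP

theorem hasEulerChar_compl_zero_prod {T : Set ℂ} (hT : T.Finite) :
    HasEulerChar (({0}ᶜ : Set ℂ) ×ˢ T) 0 := by
  have : Fintype T := hT.fintype
  have : Finite T := hT
  have := (isClosed_singleton (x := (0 : ℂ))).isOpen_compl.locallyCompactSpace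
  have hprod := hasEulerChar_compl_zero.prod_discrete (ι := T)
  rw [mul_zero] at hprod
  exact hprod.homeomorph (Homeomorph.Set.prod _ _)

theorem finite_setOf_zpow_mul_eval_eq_one (k : ℤ) {Q : Polynomial ℂ}
    (hQ : ∃ t, t ≠ 0 ∧ Q.IsRoot t) : {t : ℂ | t ≠ 0 ∧ t ^ k * Q.eval t = 1}.Finite := by
  let R : Polynomial ℂ := Polynomial.X ^ k.toNat * Q - Polynomial.X ^ (-k).toNat
  have heval : ∀ t, R.eval t = t ^ k.toNat * Q.eval t - t ^ (-k).toNat := fun t => by simp [R]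
  have hR : R ≠ 0 := by
    rintro hR
    obtain ⟨t, ht, hroot⟩ := hQ
    have := heval t
    rw [hR, hroot.eq_zero, mul_zero, zero_sub, Polynomial.eval_zero] at this
    exact pow_ne_zero _ ht (neg_eq_zero.1 this.symm)
  refine (Polynomial.finite_setOfPred_isRoot hR).subset fun t ⟨ht, heq⟩ => ?_
  have hpow : t ^ k.toNat = t ^ k * t ^ (-k).toNat := by
    rw [← zpow_natCast, ← zpow_natCast, ← zpow_add₀ ht]
    congr 1
    omega
  rw [Set.mem_ofPred_eq, Polynomial.IsRoot, heval, hpow, mul_right_comm, heq, one_mul, sub_self]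

theorem locallyCompactSpace_torus_curve (k : ℤ) (hG : ContinuousOn G {0}ᶜ) :
    LocallyCompactSpace {z ∈ torus | z.1 ^ k * G z.2 = 1} :=
  locallyCompactSpace_sep_eq isOpen_torus
    ((continuousOn_fst.zpow₀ k fun _ hz => Or.inl hz.1).mul
      (hG.comp continuousOn_snd fun _ hz => hz.2)) 1

theorem hasEulerChar_torus_zpow_mul_eval_eq_one (M k : ℤ) {Q : Polynomial ℂ} (hQ : Q ≠ 0)
    (hroot : ∃ t, t ≠ 0 ∧ Q.IsRoot t) :
    HasEulerChar {z ∈ torus | z.1 ^ M * (z.2 ^ k * Q.eval z.2) = 1}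
      (-(|(M : ℝ)| * {t | t ≠ 0 ∧ Q.IsRoot t}.ncard)) := by
  classical
  obtain rfl | hM := eq_or_ne M 0
  · have hset : {z ∈ torus | z.1 ^ (0 : ℤ) * (z.2 ^ k * Q.eval z.2) = 1} =
        ({0}ᶜ : Set ℂ) ×ˢ {t : ℂ | t ≠ 0 ∧ t ^ k * Q.eval t = 1} := by
      ext z
      simp [torus, and_assoc]
    rw [hset, Int.cast_zero, abs_zero, zero_mul, neg_zero]
    exact hasEulerChar_compl_zero_prod (finite_setOf_zpow_mul_eval_eq_one k hroot)
  · have hP : ∀ t, t ∈ insert 0 Q.roots.toFinset ↔ t = 0 ∨ t ^ k * Q.eval t = 0 := fun t => by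
      obtain rfl | ht := eq_or_ne t 0 <;> simp [*, zpow_ne_zero]
    have hcard : (insert 0 Q.roots.toFinset).card = {t | t ≠ 0 ∧ Q.IsRoot t}.ncard + 1 := by
      have hset : {t | t ≠ 0 ∧ Q.IsRoot t} = Q.roots.toFinset.erase 0 := by
        ext t
        simp [hQ, and_comm]
      have hinsert : insert 0 Q.roots.toFinset = insert 0 (Q.roots.toFinset.erase 0) := by grind
      rw [hset, Set.ncard_coe_finset, hinsert,
        Finset.card_insert_of_notMem (Finset.notMem_erase _ _)]
    have hG : ContinuousOn (fun t => t ^ k * Q.eval t) {0}ᶜ :=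
      (continuousOn_id.zpow₀ k fun t ht => Or.inl ht).mul Q.continuous.continuousOn
    have hcurve := hasEulerChar_torus_zpow_mul_eq_one hM
      (hG.mono (Set.compl_subset_compl.2 (by simp))) hP
    rw [hcard] at hcurve
    convert hcurve using 1
    push_cast
    ring

/-- In suitable coordinates `(s, t)` the curve is `s ^ M * G t = 1`, a covering of degree `|M|` of
the `t`-line without `0` and the roots of `Q` if `M ≠ 0`, and a finite union of lines `t = const`
if `M = 0`. -/
theorem hasEulerChar_torus_curve (a b : ℤ) {e₁ e₂ : ℤ} (he : IsCoprime e₁ e₂) {Q : Polynomial ℂ}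
    (hQ : Q ≠ 0) (hroot : ∃ t, t ≠ 0 ∧ Q.IsRoot t) :
    HasEulerChar {z ∈ torus | z.1 ^ a * z.2 ^ b * Q.eval (z.1 ^ e₁ * z.2 ^ e₂) = 1}
      (-(|((e₁ * b - e₂ * a : ℤ) : ℝ)| * {t | t ≠ 0 ∧ Q.IsRoot t}.ncard)) := by
  obtain ⟨k, ⟨e⟩⟩ := exists_homeomorph_torus_curve a b he fun t => Q.eval t
  have := locallyCompactSpace_torus_curve (e₁ * b - e₂ * a) (G := fun t => t ^ k * Q.eval t)
    ((continuousOn_id.zpow₀ k fun t ht => Or.inl ht).mul Q.continuous.continuousOn)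
  exact (hasEulerChar_torus_zpow_mul_eval_eq_one _ k hQ hroot).homeomorph e

theorem hasEulerChar_torus_monomial (a : ℤ) {b : ℤ} (hb : b ≠ 0) :
    HasEulerChar {z ∈ torus | z.1 ^ a * z.2 ^ b = 1} 0 := by
  have hG : ContinuousOn (fun t : ℂ => t ^ a) {0}ᶜ :=
    continuousOn_id.zpow₀ a fun t ht => Or.inl ht
  have hcurve := hasEulerChar_torus_zpow_mul_eq_one (P := {0}) hb (by simpa using hG) fun t => by
    simpa using eq_zero_of_zpow_eq_zero
  rw [Finset.card_singleton, Nat.cast_one, sub_self, mul_zero] at hcurve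
  have := locallyCompactSpace_torus_curve b hG
  refine hcurve.homeomorph ((Homeomorph.prodComm ℂ ℂ).sets ?_)
  ext z
  simp [torus, mul_comm, and_comm]

end Torus

end CompactSupp

namespace NewtonPolygon

/-! ### Evaluation and coefficients -/

section Evaluation

/-- Evaluation at a point with `x ≠ 0`, as an algebra homomorphism. -/
noncomputable def evalHom {x : ℂ} (hx : x ≠ 0) (y : ℂ) : LaurentPoly →ₐ[ℂ] ℂ :=
  AddMonoidAlgebra.lift ℂ ℂ (ℤ × ℕ)
    { toFun m := x ^ (Multiplicative.toAdd m).1 * y ^ (Multiplicative.toAdd m).2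
      map_one' := by simp
      map_mul' m m' := by
        simp only [toAdd_mul, Prod.fst_add, Prod.snd_add, zpow_add₀ hx, pow_add]
        ring }

theorem eval_eq_evalHom (f : LaurentPoly) {x : ℂ} (hx : x ≠ 0) (y : ℂ) :
    eval f x y = evalHom hx y f := by
  rw [evalHom, AddMonoidAlgebra.lift_apply, Finsupp.sum, eval]
  exact Finset.sum_congr rfl fun m _ => mul_assoc _ _ _

theorem evalHom_term {x : ℂ} (hx : x ≠ 0) (y c : ℂ) (a : ℤ) (b : ℕ) :
    evalHom hx y (term c a b) = c * (x ^ a * y ^ b) := by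
  rw [term, evalHom, AddMonoidAlgebra.lift_single]
  rfl

theorem eval_term_one (a : ℤ) (b : ℕ) (x y : ℂ) : eval (term 1 a b) x y = x ^ a * y ^ b := by
  have hsum : eval (term 1 a b) x y =
      (Finsupp.single (a, b) (1 : ℂ)).sum fun m c => c * x ^ m.1 * y ^ m.2 := rfl
  rw [hsum, Finsupp.sum_single_index (by simp), one_mul]

theorem term_mul_term (c c' : ℂ) (a a' : ℤ) (b b' : ℕ) :
    term c a b * term c' a' b' = term (c * c') (a + a') (b + b') :=
  AddMonoidAlgebra.single_mul_single ..

theorem term_one_pow (a : ℤ) (b k : ℕ) : term 1 a b ^ k = term 1 (k * a) (k * b) := by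
  simp [term, AddMonoidAlgebra.single_pow]

theorem smul_term (c c' : ℂ) (a : ℤ) (b : ℕ) : c • term c' a b = term (c * c') a b :=
  AddMonoidAlgebra.smul_single ..

end Evaluation

section RootPoly

variable {R ι : Type*} [CommRing R] [Fintype ι] {μ : ι → R} {ν : ι → ℕ}

/-- The univariate polynomial `∏ (X - μ_i) ^ ν_i`, of which the products in `formDiff` and
`formProd` are homogenizations. -/
noncomputable def rootPoly (μ : ι → R) (ν : ι → ℕ) : Polynomial R :=
  ∏ i, (Polynomial.X - Polynomial.C (μ i)) ^ ν i

theorem monic_rootPoly : (rootPoly μ ν).Monic :=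
  Polynomial.monic_prod_of_monic _ _ fun _ _ => (Polynomial.monic_X_sub_C _).pow _

theorem natDegree_rootPoly [Nontrivial R] : (rootPoly μ ν).natDegree = ∑ i, ν i := by
  rw [rootPoly, Polynomial.natDegree_prod_of_monic _ _ fun _ _ =>
    (Polynomial.monic_X_sub_C _).pow _]
  simp [(Polynomial.monic_X_sub_C _).natDegree_pow]

theorem coeff_zero_rootPoly_ne_zero [IsDomain R] (hμ : ∀ i, μ i ≠ 0) :
    (rootPoly μ ν).coeff 0 ≠ 0 := by
  rw [Polynomial.coeff_zero_eq_eval_zero, rootPoly, Polynomial.eval_prod,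
    Finset.prod_ne_zero_iff]
  simp [hμ]

theorem isRoot_rootPoly_iff [IsDomain R] (hν : ∀ i, 0 < ν i) {t : R} :
    (rootPoly μ ν).IsRoot t ↔ t ∈ Set.range μ := by
  simp [rootPoly, Polynomial.IsRoot, Polynomial.eval_prod, Finset.prod_eq_zero_iff, (hν _).ne',
    sub_eq_zero, eq_comm (a := t)]

theorem homogenize_rootPoly : (rootPoly μ ν).homogenize (∑ i, ν i) =
    ∏ i, (MvPolynomial.X 0 - MvPolynomial.C (μ i) * MvPolynomial.X 1) ^ ν i := by
  refine Polynomial.homogenize_eq_of_isHomogeneous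
    (MvPolynomial.IsHomogeneous.prod _ _ _ fun i _ => ?_) (by simp [rootPoly])
  have hlin : (MvPolynomial.X 0 - MvPolynomial.C (μ i) * MvPolynomial.X 1 :
      MvPolynomial (Fin 2) R).IsHomogeneous 1 :=
    (MvPolynomial.isHomogeneous_X _ _).sub (MvPolynomial.isHomogeneous_C_mul_X _ _)
  simpa using hlin.pow (ν i)

theorem aeval_homogenize {A : Type*} [CommRing A] [Algebra R A] (p : Polynomial R) (n : ℕ)
    (x y : A) : MvPolynomial.aeval ![x, y] (p.homogenize n) =
      ∑ j ∈ Finset.range (n + 1), p.coeff j • (x ^ j * y ^ (n - j)) := by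
  rw [Polynomial.homogenize, map_sum, Finset.Nat.sum_antidiagonal_eq_sum_range_succ_mk]
  refine Finset.sum_congr rfl fun j _ => ?_
  rw [MvPolynomial.aeval_monomial, Finsupp.prod_fintype _ _ (by simp), Fin.prod_univ_two,
    Algebra.smul_def]
  simp

theorem prod_sub_smul_pow_eq_sum {A : Type*} [CommRing A] [Algebra R A] (x y : A) :
    ∏ i, (x - μ i • y) ^ ν i = ∑ j ∈ Finset.range (∑ i, ν i + 1),
      (rootPoly μ ν).coeff j • (x ^ j * y ^ (∑ i, ν i - j)) := by
  rw [← aeval_homogenize, homogenize_rootPoly]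
  simp [Algebra.smul_def]

end RootPoly

section BinomialForm

variable {a : ℤ} {b q k l r : ℕ} {μ : Fin r → ℂ} {ν : Fin r → ℕ}

/-- `x ^ a y ^ b ∏ (x ^ q y ^ k - μ_i y ^ l) ^ ν_i`, the common generalization of `formDiff`
(`k = 0`) and `formProd` (`l = 0`). -/
noncomputable def binomialForm (a : ℤ) (b q k l : ℕ) {r : ℕ} (μ : Fin r → ℂ) (ν : Fin r → ℕ) :
    LaurentPoly :=
  term 1 a b * ∏ i, (term 1 (q : ℤ) k - term (μ i) 0 l) ^ ν i

theorem binomialForm_eq_sum :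
    binomialForm a b q k l μ ν = ∑ j ∈ (rootPoly μ ν).support,
      term ((rootPoly μ ν).coeff j) (a + j * q) (b + (j * k + (∑ i, ν i - j) * l)) := by
  have hsmul : ∀ i, term (μ i) 0 l = μ i • term 1 0 l := fun i => by rw [smul_term, mul_one]
  have hsub : (rootPoly μ ν).support ⊆ Finset.range (∑ i, ν i + 1) := by
    rw [← natDegree_rootPoly (μ := μ)]
    exact Polynomial.supp_subset_range_natDegree_succ
  simp only [binomialForm, hsmul, prod_sub_smul_pow_eq_sum, Finset.mul_sum]
  rw [← Finset.sum_subset hsub fun j _ hj => by rw [Polynomial.notMem_support_iff.1 hj]; simp]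
  refine Finset.sum_congr rfl fun j _ => ?_
  rw [term_one_pow, term_one_pow, term_mul_term, smul_term, term_mul_term]
  simp

theorem support_coeff_binomialForm (hq : q ≠ 0) :
    (binomialForm a b q k l μ ν).coeff.support = (rootPoly μ ν).support.image
      fun j : ℕ => (a + j * q, b + (j * k + (∑ i, ν i - j) * l)) := by
  have hinj : Function.Injective
      fun j : ℕ => (a + j * q, b + (j * k + (∑ i, ν i - j) * l)) := fun i j hij => by
    simpa [hq] using congrArg Prod.fst hij
  rw [binomialForm_eq_sum, AddMonoidAlgebra.coeff_sum]
  exact Finsupp.mapDomain_support_of_injective hinj (rootPoly μ ν).toFinsupp.coeff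

theorem supp_binomialForm (hq : q ≠ 0) :
    supp (binomialForm a b q k l μ ν) =
      (fun j : ℕ => (a, (b + l * ∑ i, (ν i : ℤ))) + j • ((q : ℤ), (k : ℤ) - l)) ''
        (rootPoly μ ν).support := by
  rw [supp, support_coeff_binomialForm hq, Finset.coe_image, Set.image_image]
  refine Set.image_congr fun j hj => ?_
  have hj : j ≤ ∑ i, ν i := by
    rw [← natDegree_rootPoly (μ := μ)]
    exact Polynomial.le_natDegree_of_mem_supp j hj
  push_cast [hj]
  ext
  · simp
  · simp
    ring

theorem eval_binomialForm {x y : ℂ} (hx : x ≠ 0) (hy : y ≠ 0) :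
    eval (binomialForm a b q k l μ ν) x y = x ^ a * y ^ (b + l * ∑ i, (ν i : ℤ)) *
      (rootPoly μ ν).eval (x ^ (q : ℤ) * y ^ ((k : ℤ) - l)) := by
  have hfactor : ∀ i, x ^ (q : ℤ) * y ^ k - μ i * y ^ l =
      y ^ l * (x ^ (q : ℤ) * y ^ ((k : ℤ) - l) - μ i) := fun i => by
    rw [zpow_sub₀ hy, zpow_natCast y k, zpow_natCast y l]
    field_simp
  have hpow : y ^ (b + l * ∑ i, (ν i : ℤ)) = y ^ b * (y ^ l) ^ (∑ i, ν i) := by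
    rw [← pow_mul, ← pow_add, ← zpow_natCast]
    push_cast
    rfl
  rw [eval_eq_evalHom _ hx, binomialForm, map_mul, map_prod, hpow]
  simp only [map_pow, map_sub, evalHom_term, zpow_zero, one_mul, hfactor, mul_pow,
    Finset.prod_mul_distrib, Finset.prod_pow_eq_pow_sum, rootPoly, Polynomial.eval_prod,
    Polynomial.eval_pow, Polynomial.eval_sub, Polynomial.eval_X, Polynomial.eval_C]
  ring

end BinomialForm

/-- `f` is supported on a segment from `v` in the primitive direction `e`, of lattice length
`∑ ν_i`, and has there the roots `μ_i` with multiplicities `ν_i`. -/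
structure IsEdgePoly (f : LaurentPoly) (v e : ℤ × ℤ) {r : ℕ} (μ : Fin r → ℂ) (ν : Fin r → ℕ) :
    Prop where
  coprime : IsCoprime e.1 e.2
  fst_pos : 0 < e.1
  length_pos : 0 < ∑ i, ν i
  eval_eq : ∀ x y : ℂ, x ≠ 0 → y ≠ 0 →
    eval f x y = x ^ v.1 * y ^ v.2 * (rootPoly μ ν).eval (x ^ e.1 * y ^ e.2)
  left_mem : v ∈ supp f
  right_mem : v + (∑ i, ν i) • e ∈ supp f
  exists_of_mem : ∀ u ∈ supp f, ∃ j ≤ ∑ i, ν i, u = v + j • e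

theorem isEdgePoly_binomialForm {a : ℤ} {b q k l r : ℕ} {μ : Fin r → ℂ} {ν : Fin r → ℕ}
    (hq : 0 < q) (hco : IsCoprime (q : ℤ) (k - l)) (hr : 0 < r) (hμ : ∀ i, μ i ≠ 0)
    (hν : ∀ i, 0 < ν i) :
    IsEdgePoly (binomialForm a b q k l μ ν) (a, b + l * ∑ i, (ν i : ℤ)) (q, k - l) μ ν where
  coprime := hco
  fst_pos := Nat.cast_pos.2 hq
  length_pos := Finset.sum_pos (fun i _ => hν i) ⟨⟨0, hr⟩, Finset.mem_univ _⟩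
  eval_eq _ _ hx hy := eval_binomialForm hx hy
  left_mem := by
    rw [supp_binomialForm hq.ne']
    exact ⟨0, Polynomial.mem_support_iff.2 (coeff_zero_rootPoly_ne_zero hμ), by simp⟩
  right_mem := by
    rw [supp_binomialForm hq.ne']
    refine ⟨∑ i, ν i, ?_, rfl⟩
    rw [← natDegree_rootPoly (μ := μ)]
    exact Polynomial.natDegree_mem_support_of_nonzero monic_rootPoly.ne_zero
  exists_of_mem u hu := by
    rw [supp_binomialForm hq.ne'] at hu
    obtain ⟨j, hj, rfl⟩ := hu
    refine ⟨j, ?_, rfl⟩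
    rw [← natDegree_rootPoly (μ := μ)]
    exact Polynomial.le_natDegree_of_mem_supp j hj

/-! ### Areas and roots of faces -/

section TriangleArea

open CompactSupp MeasureTheory

theorem convexHull_zero_basis :
    convexHull ℝ {0, ((1 : ℝ), (0 : ℝ)), ((0 : ℝ), (1 : ℝ))} = triangle := by
  refine (convexHull_min ?_ convex_triangle).antisymm ?_
  · rintro p (rfl | rfl | rfl) <;> norm_num [triangle]
  · rintro ⟨x, y⟩ ⟨hx, hy, hxy⟩
    have hcomb := (convex_convexHull ℝ {0, ((1 : ℝ), (0 : ℝ)), ((0 : ℝ), (1 : ℝ))}).sum_mem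
      (t := Finset.univ) (w := ![1 - (x + y), x, y]) (z := ![0, (1, 0), (0, 1)])
      (fun i _ => by fin_cases i; exacts [sub_nonneg.2 hxy, hx, hy])
      (by simp [Fin.sum_univ_three, add_assoc])
      (fun i _ => by fin_cases i <;> exact subset_convexHull ℝ _ (by simp))
    simpa [Fin.sum_univ_three] using hcomb

theorem preimage_prodMk_triangle (x : ℝ) :
    Prod.mk x ⁻¹' triangle = if x ∈ Set.Icc 0 1 then Set.Icc 0 (1 - x) else ∅ := by
  ext y
  split_ifs with hx
  · simp [triangle, hx.1, le_sub_iff_add_le']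
  · refine iff_of_false (fun hy => hx ⟨hy.1, ?_⟩) (Set.notMem_empty y)
    have hy0 : 0 ≤ y := hy.2.1
    have hxy : x + y ≤ 1 := hy.2.2
    linarith

theorem volume_triangle : volume.real triangle = 1 / 2 := by
  have hsection : ∀ x, volume (Prod.mk x ⁻¹' triangle) =
      (Set.Icc (0 : ℝ) 1).indicator (fun x => ENNReal.ofReal (1 - x)) x := fun x => by
    rw [preimage_prodMk_triangle]
    by_cases hx : x ∈ Set.Icc (0 : ℝ) 1 <;> simp [hx]
  have hint : ∫ x in (0 : ℝ)..1, (1 - x) = 1 / 2 := by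
    rw [intervalIntegral.integral_sub (by simp) (by simp)]
    norm_num
  rw [intervalIntegral.integral_of_le zero_le_one, ← integral_Icc_eq_integral_Ioc] at hint
  rw [measureReal_def, Measure.volume_eq_prod,
    Measure.prod_apply isCompact_triangle.measurableSet, lintegral_congr hsection,
    lintegral_indicator measurableSet_Icc, ← ofReal_integral_eq_lintegral_ofReal, hint]
  · norm_num
  · exact (by fun_prop : Continuous fun x : ℝ => 1 - x).continuousOn.integrableOn_Icc
  · filter_upwards [ae_restrict_mem measurableSet_Icc] with x hx using sub_nonneg.2 hx.2

theorem triangleArea_eq (v w : ℤ × ℤ) :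
    triangleArea v w = |((v.1 * w.2 - v.2 * w.1 : ℤ) : ℝ)| / 2 := by
  let A : ℝ × ℝ →ₗ[ℝ] ℝ × ℝ :=
    (LinearMap.fst ℝ ℝ ℝ).smulRight (toPlane v) + (LinearMap.snd ℝ ℝ ℝ).smulRight (toPlane w)
  have hA : convexHull ℝ {0, toPlane v, toPlane w} = A '' triangle := by
    rw [← convexHull_zero_basis, LinearMap.image_convexHull]
    simp [Set.image_insert_eq, A]
  have hdet : A.det = ((v.1 * w.2 - v.2 * w.1 : ℤ) : ℝ) := by
    rw [← LinearMap.det_toMatrix (Module.Basis.finTwoProd ℝ), Matrix.det_fin_two]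
    simp [LinearMap.toMatrix_apply, A, toPlane, mul_comm]
  rw [triangleArea, hA, measureReal_def, Measure.addHaar_image_linearMap, ENNReal.toReal_mul,
    ENNReal.toReal_ofReal (abs_nonneg _), hdet, ← measureReal_def, volume_triangle, mul_one_div]

end TriangleArea

section LatticeSegment

variable {v e : ℤ × ℤ} {n : ℕ}

theorem toPlane_injective : Function.Injective toPlane := fun u v huv => by
  simpa [toPlane, Prod.ext_iff] using huv

theorem toPlane_add_nsmul (v e : ℤ × ℤ) (j : ℕ) :
    toPlane (v + j • e) = toPlane v + (j : ℝ) • toPlane e := by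
  ext <;> simp [toPlane]

theorem toPlane_mem_segment (v e : ℤ × ℤ) {j n : ℕ} (hj : j ≤ n) :
    toPlane (v + j • e) ∈ segment ℝ (toPlane v) (toPlane (v + n • e)) := by
  obtain rfl | hn := n.eq_zero_or_pos
  · simp [Nat.le_zero.1 hj]
  have hn' : (0 : ℝ) < n := Nat.cast_pos.2 hn
  rw [segment_eq_image']
  refine ⟨j / n, ⟨by positivity, (div_le_one hn').2 (Nat.cast_le.2 hj)⟩, ?_⟩
  simp only [toPlane_add_nsmul, add_sub_cancel_left, smul_smul, div_mul_cancel₀ _ hn'.ne']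

/-- A Bézout relation for `e` turns the parameter of an integer point into an integer. -/
theorem exists_intCast_eq_of_toPlane_eq (he : IsCoprime e.1 e.2) {u : ℤ × ℤ} {θ : ℝ}
    (hu : toPlane v + θ • toPlane e = toPlane u) : ∃ k : ℤ, (k : ℝ) = θ := by
  obtain ⟨x, y, hxy⟩ := he
  have hu1 : (v.1 : ℝ) + θ * e.1 = u.1 := by simpa [toPlane] using congrArg Prod.fst hu
  have hu2 : (v.2 : ℝ) + θ * e.2 = u.2 := by simpa [toPlane] using congrArg Prod.snd hu
  have hxy' : (x : ℝ) * e.1 + y * e.2 = 1 := by exact_mod_cast hxy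
  refine ⟨x * (u.1 - v.1) + y * (u.2 - v.2), ?_⟩
  push_cast
  linear_combination θ * hxy' - x * hu1 - y * hu2

theorem setOf_toPlane_mem_openSegment (he : IsCoprime e.1 e.2) (hn : 0 < n) :
    {u : ℤ × ℤ | toPlane u ∈ openSegment ℝ (toPlane v) (toPlane (v + n • e))} =
      (fun j : ℕ => v + j • e) '' Set.Ioo 0 n := by
  have hn' : (0 : ℝ) < n := Nat.cast_pos.2 hn
  ext u
  rw [Set.mem_ofPred_eq, openSegment_eq_image']
  simp only [toPlane_add_nsmul, add_sub_cancel_left, smul_smul]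
  constructor
  · rintro ⟨θ, ⟨h0, h1⟩, hu⟩
    obtain ⟨k, hk⟩ := exists_intCast_eq_of_toPlane_eq he hu
    have hk0 : 0 < k := by
      rw [← Int.cast_pos (R := ℝ), hk]
      positivity
    have hkn : k < n := by
      rw [← Int.cast_lt (R := ℝ), hk, Int.cast_natCast]
      exact mul_lt_of_lt_one_left hn' h1
    lift k to ℕ using hk0.le
    refine ⟨k, ⟨Nat.cast_pos.1 hk0, Nat.cast_lt.1 hkn⟩, toPlane_injective ?_⟩
    simp only [toPlane_add_nsmul, ← hu, ← hk, Int.cast_natCast]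
  · rintro ⟨j, ⟨h0, h1⟩, rfl⟩
    refine ⟨j / n, ⟨by positivity, (div_lt_one hn').2 (Nat.cast_lt.2 h1)⟩, ?_⟩
    simp only [div_mul_cancel₀ _ hn'.ne', toPlane_add_nsmul]

theorem interiorPoints_add_one (v : ℤ × ℤ) (he : IsCoprime e.1 e.2) (he0 : e.1 ≠ 0)
    (hn : 0 < n) : interiorPoints (v, v + n • e) + 1 = n := by
  have hinj : Function.Injective fun j : ℕ => v + j • e := fun i j hij => by
    simpa [he0] using congrArg Prod.fst hij
  rw [interiorPoints, setOf_toPlane_mem_openSegment he hn, Set.ncard_image_of_injective _ hinj,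
    ← Finset.coe_Ioo, Set.ncard_coe_finset, Nat.card_Ioo]
  omega

theorem direction_add_nsmul (v : ℤ × ℤ) (he : IsCoprime e.1 e.2) (hn : 0 < n) :
    direction (v, v + n • e) = e := by
  have hgcd : Int.gcd (n * e.1) (n * e.2) = n := by
    rw [Int.gcd_mul_left, Int.isCoprime_iff_gcd_eq_one.1 he, mul_one, Int.natAbs_natCast]
  have hn' : (n : ℤ) ≠ 0 := Nat.cast_ne_zero.2 hn.ne'
  simp [direction, hgcd, Int.mul_ediv_cancel_left _ hn']

theorem faceArea_add_nsmul (v e : ℤ × ℤ) (n : ℕ) :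
    faceArea (v, v + n • e) = n * (|((e.1 * v.2 - e.2 * v.1 : ℤ) : ℝ)| / 2) := by
  have hdet : v.1 * (v + n • e).2 - v.2 * (v + n • e).1 = -(n * (e.1 * v.2 - e.2 * v.1)) := by
    simp
    ring
  rw [faceArea, hdet, Int.cast_neg, abs_neg, Int.cast_mul, abs_mul, Int.cast_natCast, Nat.abs_cast,
    mul_div_assoc]

end LatticeSegment

namespace IsEdgePoly

variable {f : LaurentPoly} {v e : ℤ × ℤ} {r : ℕ} {μ : Fin r → ℂ} {ν : Fin r → ℕ}

theorem facePoly_eq (hf : IsEdgePoly f v e μ ν) : facePoly f (v, v + (∑ i, ν i) • e) = f := by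
  classical
  rw [facePoly, (Finsupp.filter_eq_self_iff _ _).2 fun m hm => ?_]
  obtain ⟨j, hj, hu⟩ := hf.exists_of_mem (m.1, m.2) ⟨m, Finsupp.mem_support_iff.2 hm, rfl⟩
  rw [hu]
  exact toPlane_mem_segment v e hj

theorem eval_eq_zero_iff (hf : IsEdgePoly f v e μ ν) (hν : ∀ i, 0 < ν i) {x y : ℂ} (hx : x ≠ 0)
    (hy : y ≠ 0) : eval f x y = 0 ↔ x ^ e.1 * y ^ e.2 ∈ Set.range μ := by
  rw [hf.eval_eq x y hx hy, mul_eq_zero,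
    or_iff_right (mul_ne_zero (zpow_ne_zero _ hx) (zpow_ne_zero _ hy))]
  exact isRoot_rootPoly_iff hν

theorem faceRoots_eq (hf : IsEdgePoly f v e μ ν) (hμ : ∀ i, μ i ≠ 0) (hν : ∀ i, 0 < ν i) :
    faceRoots f (v, v + (∑ i, ν i) • e) = Set.range μ := by
  ext m
  rw [faceRoots, hf.facePoly_eq, direction_add_nsmul v hf.coprime hf.length_pos,
    Set.mem_ofPred_eq]
  constructor
  · rintro ⟨hm, hzero⟩
    obtain ⟨s, t, hst⟩ := hf.coprime
    have hpoint : (m ^ s) ^ e.1 * (m ^ t) ^ e.2 = m := by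
      rw [← zpow_mul, ← zpow_mul, ← zpow_add₀ hm, hst, zpow_one]
    have hs := zpow_ne_zero s hm
    have ht := zpow_ne_zero t hm
    rw [← hpoint]
    exact (hf.eval_eq_zero_iff hν hs ht).1 (hzero _ _ hs ht hpoint)
  · rintro ⟨i, rfl⟩
    exact ⟨hμ i, fun x y hx hy hxy => (hf.eval_eq_zero_iff hν hx hy).2 ⟨i, hxy.symm⟩⟩

theorem ncard_faceRoots_mul_faceArea_div (hf : IsEdgePoly f v e μ ν)
    (hinj : Function.Injective μ) (hμ : ∀ i, μ i ≠ 0) (hν : ∀ i, 0 < ν i) :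
    ((faceRoots f (v, v + (∑ i, ν i) • e)).ncard : ℝ) * faceArea (v, v + (∑ i, ν i) • e) /
      ((interiorPoints (v, v + (∑ i, ν i) • e) : ℝ) + 1) =
      r * |((e.1 * v.2 - e.2 * v.1 : ℤ) : ℝ)| / 2 := by
  have hn : ((∑ i, ν i : ℕ) : ℝ) ≠ 0 := Nat.cast_ne_zero.2 hf.length_pos.ne'
  have hpoints : (interiorPoints (v, v + (∑ i, ν i) • e) : ℝ) + 1 = (∑ i, ν i : ℕ) := by
    exact_mod_cast interiorPoints_add_one v hf.coprime hf.fst_pos.ne' hf.length_pos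
  have hroots : (faceRoots f (v, v + (∑ i, ν i) • e)).ncard = r := by
    rw [hf.faceRoots_eq hμ hν, Set.ncard_range_of_injective hinj, Nat.card_fin]
  rw [hpoints, hroots, faceArea_add_nsmul]
  field_simp

/-- Faces on lines through the origin do not contribute to the area. -/
theorem areaWrt_eq (hf : IsEdgePoly f v e μ ν) (hinj : Function.Injective μ)
    (hμ : ∀ i, μ i ≠ 0) (hν : ∀ i, 0 < ν i) {F : Set ((ℤ × ℤ) × (ℤ × ℤ))}
    (hF : ∀ γ ∈ F, γ = (v, v + (∑ i, ν i) • e) ∨ faceArea γ = 0)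
    (hmem : e.1 * v.2 - e.2 * v.1 ≠ 0 → (v, v + (∑ i, ν i) • e) ∈ F) :
    areaWrt F f = r * |((e.1 * v.2 - e.2 * v.1 : ℤ) : ℝ)| / 2 := by
  have hne : ∀ γ, ((faceRoots f γ).ncard : ℝ) * faceArea γ / ((interiorPoints γ : ℝ) + 1) ≠ 0 →
      faceArea γ ≠ 0 := fun γ hγ h0 => hγ (by rw [h0, mul_zero, zero_div])
  rw [areaWrt, ← hf.ncard_faceRoots_mul_faceArea_div hinj hμ hν,
    ← finsum_mem_singleton (a := (v, v + (∑ i, ν i) • e))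
      (f := fun γ => ((faceRoots f γ).ncard : ℝ) * faceArea γ / ((interiorPoints γ : ℝ) + 1))]
  refine finsum_mem_inter_support_eq' _ _ _ fun γ hγ =>
    ⟨fun hγF => (hF γ hγF).resolve_right (hne γ hγ), ?_⟩
  rintro rfl
  refine hmem fun h0 => hne _ hγ ?_
  rw [faceArea_add_nsmul, h0, Int.cast_zero, abs_zero, zero_div, mul_zero]

end IsEdgePoly

/-! ### Vertices and faces -/

section ExtremePoints

variable {V : Type*} [AddCommGroup V] [Module ℝ V]

theorem convex_insert_setOf_lt (g : V →ₗ[ℝ] ℝ) (x : V) : Convex ℝ (insert x {y | g x < g y}) := by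
  refine convex_iff_pairwise_pos.2 fun y hy z hz hne α β hα hβ hαβ => Or.inr ?_
  have hx : α * g x + β * g x = g x := by rw [← add_mul, hαβ, one_mul]
  rw [Set.mem_ofPred_eq, map_add, map_smul, map_smul, smul_eq_mul, smul_eq_mul, ← hx]
  rcases hy with rfl | hy <;> rcases hz with rfl | hz
  · exact absurd rfl hne
  · exact add_lt_add_right (mul_lt_mul_of_pos_left hz hβ) _
  · exact add_lt_add_left (mul_lt_mul_of_pos_left hy hα) _
  · exact add_lt_add (mul_lt_mul_of_pos_left hy hα) (mul_lt_mul_of_pos_left hz hβ)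

theorem mem_extremePoints_convexHull_of_forall_lt {S : Set V} {x : V} (hx : x ∈ S)
    (g : V →ₗ[ℝ] ℝ) (hg : ∀ y ∈ S, y = x ∨ g x < g y) : x ∈ (convexHull ℝ S).extremePoints ℝ := by
  have hsub : convexHull ℝ S ⊆ insert x {y | g x < g y} :=
    convexHull_min hg (convex_insert_setOf_lt g x)
  refine mem_extremePoints_iff_left.2 ⟨subset_convexHull ℝ S hx, ?_⟩
  rintro y hy z hz ⟨α, β, hα, hβ, hαβ, hxyz⟩
  refine (hsub hy).resolve_right fun hlt => ?_
  have hle : g x ≤ g z := (hsub hz).elim (fun h => h ▸ le_rfl) fun h => le_of_lt h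
  have hval : α * g y + β * g z = (α + β) * g x := by
    rw [hαβ, one_mul, ← hxyz]
    simp
  nlinarith [mul_lt_mul_of_pos_left hlt hα, mul_le_mul_of_nonneg_left hle hβ.le]

theorem left_mem_extremePoints_segment (x y : V) : x ∈ (segment ℝ x y).extremePoints ℝ := by
  rcases eq_or_ne x y with rfl | hxy
  · simp
  have hinj := AffineMap.lineMap_injective ℝ hxy
  have hsdiff : segment ℝ x y \ {x} = AffineMap.lineMap x y '' Set.Ioc (0 : ℝ) 1 := by
    rw [segment_eq_image_lineMap, ← Set.Icc_sdiff_left, Set.image_sdiff hinj]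
    simp
  refine (convex_segment x y).mem_extremePoints_iff_convex_sdiff.2 ⟨left_mem_segment ℝ x y, ?_⟩
  rw [hsdiff]
  exact (convex_Ioc 0 1).affine_image _

theorem right_mem_extremePoints_segment (x y : V) : y ∈ (segment ℝ x y).extremePoints ℝ := by
  rw [segment_symm]
  exact left_mem_extremePoints_segment y x

theorem extremePoints_segment_subset (x y : V) : (segment ℝ x y).extremePoints ℝ ⊆ {x, y} := by
  rw [← convexHull_pair]
  exact extremePoints_convexHull_subset

end ExtremePoints

section Vertices

variable {E : Set (ℤ × ℤ)} {A B : Set ℝ} {s t : ℤ} {v : ℤ × ℤ}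

/-- `A` is the half-line `{x | 0 ≤ s x}`, for some `s ≠ 0`. The quadrants in the definitions of the
Newton polygons are products of two such half-lines. -/
structure IsRay (s : ℤ) (A : Set ℝ) : Prop where
  ne_zero : s ≠ 0
  mem_iff : ∀ x, x ∈ A ↔ 0 ≤ (s : ℝ) * x

theorem isRay_Ici (hs : 0 < s) : IsRay s (Set.Ici 0) where
  ne_zero := hs.ne'
  mem_iff _ := by simp [hs]

theorem isRay_Iic (hs : s < 0) : IsRay s (Set.Iic 0) where
  ne_zero := hs.ne
  mem_iff _ := by simp [mul_nonneg_iff, hs, hs.le]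

namespace IsRay

theorem zero_mem_prod (hA : IsRay s A) (hB : IsRay t B) : (0 : ℝ × ℝ) ∈ A ×ˢ B := by
  simp [hA.mem_iff, hB.mem_iff]

theorem add_mem (hA : IsRay s A) {x y : ℝ} (hx : x ∈ A) (hy : y ∈ A) : x + y ∈ A := by
  rw [hA.mem_iff] at *
  rw [mul_add]
  exact add_nonneg hx hy

theorem eq_zero_or_pos (hA : IsRay s A) {x : ℝ} (hx : x ∈ A) : x = 0 ∨ 0 < (s : ℝ) * x := by
  rw [hA.mem_iff] at hx
  refine hx.eq_or_lt.imp_left fun h => ?_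
  simpa [hA.ne_zero] using h.symm

end IsRay

theorem toPlane_mem_diagram {Q : Set (ℝ × ℝ)} (hv : v ∈ E) {q : ℝ × ℝ} (hq : q ∈ Q) :
    toPlane v + q ∈ diagram E Q :=
  subset_convexHull ℝ _ (Set.add_mem_add (Set.mem_image_of_mem _ hv) hq)

/-- An extreme point `u + q` is the midpoint of `u` and `u + 2q`, so `q = 0`. -/
theorem vertices_subset (hA : IsRay s A) (hB : IsRay t B) : vertices E (A ×ˢ B) ⊆ E := by
  intro v hv
  obtain ⟨_, ⟨u, hu, rfl⟩, q, hq, huq⟩ := extremePoints_convexHull_subset hv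
  have h0 := toPlane_mem_diagram hu (hA.zero_mem_prod hB)
  have h2 := toPlane_mem_diagram hu (Set.mk_mem_prod (hA.add_mem hq.1 hq.1) (hB.add_mem hq.2 hq.2))
  have hmid : toPlane v ∈ openSegment ℝ (toPlane u + 0) (toPlane u + (q.1 + q.1, q.2 + q.2)) :=
    ⟨1 / 2, 1 / 2, by norm_num, by norm_num, by norm_num, by
      rw [← huq]
      ext <;> simp <;> ring⟩
  have hv' := (mem_extremePoints_iff_left.1 hv).2 _ h0 _ h2 hmid
  rw [add_zero] at hv'
  rwa [← toPlane_injective hv']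

theorem mem_vertices (hA : IsRay s A) (hB : IsRay t B) (hv : v ∈ E)
    (hE : ∀ u ∈ E, u = v ∨ s * v.1 + t * v.2 < s * u.1 + t * u.2) : v ∈ vertices E (A ×ˢ B) := by
  let g : ℝ × ℝ →ₗ[ℝ] ℝ := (s : ℝ) • LinearMap.fst ℝ ℝ ℝ + (t : ℝ) • LinearMap.snd ℝ ℝ ℝ
  have hg (u : ℤ × ℤ) : g (toPlane u) = ((s * u.1 + t * u.2 : ℤ) : ℝ) := by simp [g, toPlane]
  have hgpos (q) (hq : q ∈ A ×ˢ B) : q = 0 ∨ 0 < g q := by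
    have hgq : g q = s * q.1 + t * q.2 := rfl
    rw [hgq, Prod.ext_iff, Prod.fst_zero, Prod.snd_zero]
    rcases hA.eq_zero_or_pos hq.1 with h1 | h1 <;> rcases hB.eq_zero_or_pos hq.2 with h2 | h2
    · exact Or.inl ⟨h1, h2⟩
    · exact Or.inr (by simpa [h1] using h2)
    · exact Or.inr (by simpa [h2] using h1)
    · exact Or.inr (add_pos h1 h2)
  have hmem : toPlane v ∈ toPlane '' E + A ×ˢ B :=
    ⟨_, Set.mem_image_of_mem _ hv, 0, hA.zero_mem_prod hB, add_zero _⟩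
  refine mem_extremePoints_convexHull_of_forall_lt hmem g ?_
  rintro _ ⟨_, ⟨u, hu, rfl⟩, q, hq, rfl⟩
  have hgu : u = v ∨ g (toPlane v) < g (toPlane u) := by
    simpa only [hg, Int.cast_lt] using hE u hu
  rw [map_add]
  rcases hgu with rfl | hgu <;> rcases hgpos q hq with rfl | hq
  · exact Or.inl (add_zero _)
  · exact Or.inr (lt_add_of_pos_right _ hq)
  · exact Or.inr (by simpa using hgu)
  · exact Or.inr (by linarith)

end Vertices

theorem snd_nonneg_of_mem_supp {f : LaurentPoly} {u : ℤ × ℤ} (hu : u ∈ supp f) : 0 ≤ u.2 := by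
  obtain ⟨m, -, rfl⟩ := hu
  exact Nat.cast_nonneg _

theorem IsPoly.fst_nonneg_of_mem_supp {f : LaurentPoly} (hf : IsPoly f) {u : ℤ × ℤ}
    (hu : u ∈ supp f) : 0 ≤ u.1 := by
  obtain ⟨m, hm, rfl⟩ := hu
  exact hf m hm

theorem add_nsmul_fst (v e : ℤ × ℤ) (n : ℕ) : (v + n • e).1 = v.1 + n * e.1 := by simp

theorem add_nsmul_snd (v e : ℤ × ℤ) (n : ℕ) : (v + n • e).2 = v.2 + n * e.2 := by simp

namespace IsEdgePoly

variable {f : LaurentPoly} {v e : ℤ × ℤ} {r : ℕ} {μ : Fin r → ℂ} {ν : Fin r → ℕ}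
  {E : Set (ℤ × ℤ)} {A B : Set ℝ} {s t : ℤ}

theorem fst_lt (hf : IsEdgePoly f v e μ ν) : v.1 < (v + (∑ i, ν i) • e).1 := by
  rw [add_nsmul_fst]
  exact lt_add_of_pos_right _ (mul_pos (Nat.cast_pos.2 hf.length_pos) hf.fst_pos)

theorem eq_or_eq_of_mem_vertices (hf : IsEdgePoly f v e μ ν) (hE : supp f ⊆ E) (hA : IsRay s A)
    (hB : IsRay t B) {u : ℤ × ℤ} (hu : u ∈ supp f) (huV : u ∈ vertices E (A ×ˢ B)) :
    u = v ∨ u = v + (∑ i, ν i) • e := by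
  obtain ⟨j, hj, rfl⟩ := hf.exists_of_mem u hu
  have hmem {w} (hw : w ∈ supp f) : toPlane w ∈ diagram E (A ×ˢ B) := by
    simpa using toPlane_mem_diagram (hE hw) (hA.zero_mem_prod hB)
  have hend := (mem_extremePoints_iff_forall_segment.1 huV).2 _ (hmem hf.left_mem) _
    (hmem hf.right_mem) (toPlane_mem_segment v e hj)
  simpa only [toPlane_injective.eq_iff, eq_comm] using hend

theorem left_mem_vertices (hf : IsEdgePoly f v e μ ν) (hE : supp f ⊆ E) (hA : IsRay s A)
    (hB : IsRay t B) (he : 0 < s * e.1 + t * e.2)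
    (hlt : ∀ u ∈ E, u ∈ supp f ∨ s * v.1 + t * v.2 < s * u.1 + t * u.2) :
    v ∈ vertices E (A ×ˢ B) := by
  refine mem_vertices hA hB (hE hf.left_mem) fun u hu => ?_
  obtain hu | hu := hlt u hu
  · obtain ⟨j, -, rfl⟩ := hf.exists_of_mem u hu
    obtain rfl | hj := j.eq_zero_or_pos
    · simp
    · have hpos := mul_pos (Nat.cast_pos (α := ℤ).2 hj) he
      rw [add_nsmul_fst, add_nsmul_snd]
      exact Or.inr (by linarith)
  · exact Or.inr hu

theorem right_mem_vertices (hf : IsEdgePoly f v e μ ν) (hE : supp f ⊆ E) (hA : IsRay s A)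
    (hB : IsRay t B) (he : s * e.1 + t * e.2 < 0)
    (hlt : ∀ u ∈ E, u ∈ supp f ∨
      s * (v + (∑ i, ν i) • e).1 + t * (v + (∑ i, ν i) • e).2 < s * u.1 + t * u.2) :
    v + (∑ i, ν i) • e ∈ vertices E (A ×ˢ B) := by
  refine mem_vertices hA hB (hE hf.right_mem) fun u hu => ?_
  obtain hu | hu := hlt u hu
  · obtain ⟨j, hj, rfl⟩ := hf.exists_of_mem u hu
    obtain rfl | hj := hj.eq_or_lt
    · exact Or.inl rfl
    · have hneg := mul_neg_of_pos_of_neg (sub_pos.2 (Nat.cast_lt (α := ℤ).2 hj)) he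
      simp only [add_nsmul_fst, add_nsmul_snd]
      exact Or.inr (by linarith)
  · exact Or.inr hu

/-! ### The Newton polygon at the origin -/

theorem eq_or_eq_of_mem_originVertices (hf : IsEdgePoly f v e μ ν) {u : ℤ × ℤ}
    (hu : u ∈ originVertices f) : u = v ∨ u = v + (∑ i, ν i) • e :=
  hf.eq_or_eq_of_mem_vertices subset_rfl (isRay_Ici one_pos) (isRay_Ici one_pos)
    (vertices_subset (isRay_Ici one_pos) (isRay_Ici one_pos) hu) hu

theorem originFaces_eq (hf : IsEdgePoly f v e μ ν) (he : e.2 < 0) :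
    originFaces f = {(v, v + (∑ i, ν i) • e)} := by
  have hlt := hf.fst_lt
  have hprod := mul_neg_of_pos_of_neg hf.fst_pos he
  have hV {u} (hu : u ∈ originVertices f) := hf.eq_or_eq_of_mem_originVertices hu
  refine Set.Subset.antisymm ?_ (Set.singleton_subset_iff.2 ⟨?_, ?_, hlt, ?_⟩)
  · rintro ⟨w, w'⟩ ⟨hw, hw', hww', -⟩
    dsimp only at hw hw' hww'
    rcases hV hw with rfl | rfl <;> rcases hV hw' with rfl | rfl
    · exact absurd hww' (lt_irrefl _)
    · rfl
    · exact absurd hww' hlt.not_gt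
    · exact absurd hww' (lt_irrefl _)
  · exact hf.left_mem_vertices subset_rfl (isRay_Ici (s := -2 * e.2) (by linarith))
      (isRay_Ici hf.fst_pos) (by linarith) fun _ => Or.inl
  · exact hf.right_mem_vertices subset_rfl (isRay_Ici (neg_pos.2 he))
      (isRay_Ici (mul_pos two_pos hf.fst_pos)) (by linarith) fun _ => Or.inl
  · rintro u hu ⟨h1, h2⟩
    rcases hV hu with rfl | rfl
    · exact lt_irrefl _ h1
    · exact lt_irrefl _ h2

/-! ### The global Newton polygon -/

theorem convexHull_supp (hf : IsEdgePoly f v e μ ν) :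
    convexHull ℝ (toPlane '' supp f) =
      segment ℝ (toPlane v) (toPlane (v + (∑ i, ν i) • e)) := by
  refine (convexHull_min ?_ (convex_segment _ _)).antisymm (segment_subset_convexHull
    (Set.mem_image_of_mem _ hf.left_mem) (Set.mem_image_of_mem _ hf.right_mem))
  rintro _ ⟨u, hu, rfl⟩
  obtain ⟨j, hj, rfl⟩ := hf.exists_of_mem u hu
  exact toPlane_mem_segment v e hj

theorem globalFaces_eq (hf : IsEdgePoly f v e μ ν) :
    globalFaces f = {(v, v + (∑ i, ν i) • e)} := by
  have hlt := hf.fst_lt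
  ext ⟨w, w'⟩
  simp only [globalFaces, hf.convexHull_supp, Set.mem_ofPred_eq, Set.mem_singleton_iff]
  constructor
  · rintro ⟨hww', hext⟩
    have hends := hext.extremePoints_subset_extremePoints.trans (extremePoints_segment_subset _ _)
    have hw := hends (left_mem_extremePoints_segment _ _)
    have hw' := hends (right_mem_extremePoints_segment _ _)
    simp only [Set.mem_insert_iff, Set.mem_singleton_iff, toPlane_injective.eq_iff] at hw hw'
    unfold LexLt at hww'
    rcases hw with rfl | rfl <;> rcases hw' with rfl | rfl
    · omega
    · rfl
    · omega
    · omega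
  · rintro ⟨rfl, rfl⟩
    exact ⟨Or.inl hlt, IsExtreme.rfl⟩

/-! ### The Newton polygon at infinity -/

theorem eq_or_of_mem_vertices_insert_zero (hf : IsEdgePoly f v e μ ν) (hA : IsRay s A)
    (hB : IsRay t B) {u : ℤ × ℤ} (hu : u ∈ vertices (insert 0 (supp f)) (A ×ˢ B)) :
    u = 0 ∨ u = v ∨ u = v + (∑ i, ν i) • e :=
  (vertices_subset hA hB hu).imp_right fun hu' =>
    hf.eq_or_eq_of_mem_vertices (Set.subset_insert _ _) hA hB hu' hu

theorem eq_or_of_mem_zeroInf_union_infInf (hf : IsEdgePoly f v e μ ν) {u : ℤ × ℤ}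
    (hu : u ∈ verticesZeroInf f ∪ verticesInfInf f) :
    u = 0 ∨ u = v ∨ u = v + (∑ i, ν i) • e :=
  hu.elim (hf.eq_or_of_mem_vertices_insert_zero (isRay_Ici one_pos) (isRay_Iic neg_one_lt_zero))
    (hf.eq_or_of_mem_vertices_insert_zero (isRay_Iic neg_one_lt_zero) (isRay_Iic neg_one_lt_zero))

theorem eq_or_of_mem_infInf_union_infZero (hf : IsEdgePoly f v e μ ν) {u : ℤ × ℤ}
    (hu : u ∈ verticesInfInf f ∪ verticesInfZero f) :
    u = 0 ∨ u = v ∨ u = v + (∑ i, ν i) • e :=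
  hu.elim
    (hf.eq_or_of_mem_vertices_insert_zero (isRay_Iic neg_one_lt_zero) (isRay_Iic neg_one_lt_zero))
    (hf.eq_or_of_mem_vertices_insert_zero (isRay_Iic neg_one_lt_zero) (isRay_Ici one_pos))

theorem eq_or_faceArea_eq_zero (hf : IsEdgePoly f v e μ ν) {w w' : ℤ × ℤ}
    (hw : w = 0 ∨ w = v ∨ w = v + (∑ i, ν i) • e)
    (hw' : w' = 0 ∨ w' = v ∨ w' = v + (∑ i, ν i) • e) (hlt : LexLt w w') :
    (w, w') = (v, v + (∑ i, ν i) • e) ∨ faceArea (w, w') = 0 := by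
  have hvw := hf.fst_lt
  unfold LexLt at hlt
  rcases hw with rfl | rfl | rfl
  · exact Or.inr (by simp [faceArea])
  · rcases hw' with rfl | rfl | rfl
    · exact Or.inr (by simp [faceArea])
    · omega
    · exact Or.inl rfl
  · rcases hw' with rfl | rfl | rfl
    · exact Or.inr (by simp [faceArea])
    · omega
    · omega

theorem eq_or_faceArea_eq_zero_of_mem_infinityFaces (hf : IsEdgePoly f v e μ ν) :
    ∀ γ ∈ infinityFaces f, γ = (v, v + (∑ i, ν i) • e) ∨ faceArea γ = 0 := by
  rintro ⟨w, w'⟩ ⟨hlt, ⟨hw, hw', -⟩ | ⟨hw, hw', -⟩ | ⟨hw', hw, -⟩⟩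
  · exact hf.eq_or_faceArea_eq_zero (hf.eq_or_of_mem_zeroInf_union_infInf hw)
      (hf.eq_or_of_mem_zeroInf_union_infInf hw') hlt
  all_goals
    exact hf.eq_or_faceArea_eq_zero (hf.eq_or_of_mem_infInf_union_infZero hw)
      (hf.eq_or_of_mem_infInf_union_infZero hw') hlt

theorem mem_infinityFaces_of_fst (hf : IsEdgePoly f v e μ ν) (hv0 : 0 ≤ v.1)
    (hv : v ∈ verticesZeroInf f ∪ verticesInfInf f)
    (hw : v + (∑ i, ν i) • e ∈ verticesInfInf f) :
    (v, v + (∑ i, ν i) • e) ∈ infinityFaces f := by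
  refine ⟨Or.inl hf.fst_lt, Or.inl ⟨hv, Or.inr hw, hf.fst_lt, ?_⟩⟩
  rintro u hu ⟨h1, h2⟩
  rcases hf.eq_or_of_mem_zeroInf_union_infInf hu with rfl | rfl | rfl
  · exact h1.not_ge hv0
  · exact lt_irrefl _ h1
  · exact lt_irrefl _ h2

theorem mem_infinityFaces_of_snd (hf : IsEdgePoly f v e μ ν) (he : 0 < e.2)
    (hv : v ∈ verticesInfZero f) (hw : v + (∑ i, ν i) • e ∈ verticesInfInf f) :
    (v, v + (∑ i, ν i) • e) ∈ infinityFaces f := by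
  have hlt : v.2 < (v + (∑ i, ν i) • e).2 := by
    rw [add_nsmul_snd]
    exact lt_add_of_pos_right _ (mul_pos (Nat.cast_pos.2 hf.length_pos) he)
  refine ⟨Or.inl hf.fst_lt, Or.inr (Or.inl ⟨Or.inr hv, Or.inl hw, hlt, ?_⟩)⟩
  rintro u hu ⟨h1, h2⟩
  rcases hf.eq_or_of_mem_infInf_union_infZero hu with rfl | rfl | rfl
  · exact h1.not_ge (snd_nonneg_of_mem_supp hf.left_mem)
  · exact lt_irrefl _ h1
  · exact lt_irrefl _ h2

theorem left_mem_vertices_insert_zero (hf : IsEdgePoly f v e μ ν) (hA : IsRay s A)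
    (hB : IsRay t B) (he : 0 < s * e.1 + t * e.2) (hneg : s * v.1 + t * v.2 < 0) :
    v ∈ vertices (insert 0 (supp f)) (A ×ˢ B) := by
  refine hf.left_mem_vertices (Set.subset_insert _ _) hA hB he ?_
  rintro u (rfl | hu)
  · exact Or.inr (by simpa using hneg)
  · exact Or.inl hu

theorem right_mem_vertices_insert_zero (hf : IsEdgePoly f v e μ ν) (hA : IsRay s A)
    (hB : IsRay t B) (he : s * e.1 + t * e.2 < 0)
    (hneg : s * (v + (∑ i, ν i) • e).1 + t * (v + (∑ i, ν i) • e).2 < 0) :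
    v + (∑ i, ν i) • e ∈ vertices (insert 0 (supp f)) (A ×ˢ B) := by
  refine hf.right_mem_vertices (Set.subset_insert _ _) hA hB he ?_
  rintro u (rfl | hu)
  · exact Or.inr (by simpa using hneg)
  · exact Or.inl hu

theorem mem_infinityFaces_of_snd_neg (hf : IsEdgePoly f v e μ ν) (hpoly : IsPoly f)
    (he : e.2 < 0) : (v, v + (∑ i, ν i) • e) ∈ infinityFaces f := by
  have he1 := hf.fst_pos
  have hn : (0 : ℤ) < (∑ i, ν i : ℕ) := Nat.cast_pos.2 hf.length_pos
  have hv1 := hpoly.fst_nonneg_of_mem_supp hf.left_mem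
  have hw1 := hv1.trans_lt hf.fst_lt
  have hw2 := snd_nonneg_of_mem_supp hf.right_mem
  have hv2 : 0 < v.2 := by
    rw [add_nsmul_snd] at hw2
    linarith [mul_neg_of_pos_of_neg hn he]
  have hprod := mul_neg_of_pos_of_neg he1 he
  refine hf.mem_infinityFaces_of_fst hv1 (Or.inr ?_) ?_
  · exact hf.left_mem_vertices_insert_zero (isRay_Iic he)
      (isRay_Iic (s := -2 * e.1) (by linarith)) (by linarith)
      (by linarith [mul_nonpos_of_nonpos_of_nonneg he.le hv1, mul_pos he1 hv2])
  · exact hf.right_mem_vertices_insert_zero (isRay_Iic (s := 2 * e.2) (by linarith))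
      (isRay_Iic (neg_neg_of_pos he1)) (by linarith)
      (by linarith [mul_neg_of_neg_of_pos he hw1, mul_nonneg he1.le hw2])

theorem right_mem_verticesInfInf (hf : IsEdgePoly f v e μ ν) (hpoly : IsPoly f)
    (he : 0 ≤ e.2) : v + (∑ i, ν i) • e ∈ verticesInfInf f := by
  have hw1 := (hpoly.fst_nonneg_of_mem_supp hf.left_mem).trans_lt hf.fst_lt
  have hw2 := snd_nonneg_of_mem_supp hf.right_mem
  exact hf.right_mem_vertices_insert_zero (isRay_Iic neg_one_lt_zero) (isRay_Iic neg_one_lt_zero)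
    (by linarith [hf.fst_pos]) (by linarith)

/-- The functionals exposing `v` vanish at `v + e`, so that their values at `v` and `e` are
opposite. -/
theorem mem_infinityFaces_of_snd_nonneg (hf : IsEdgePoly f v e μ ν) (hpoly : IsPoly f)
    (he : 0 ≤ e.2) (hdet : e.1 * v.2 - e.2 * v.1 ≠ 0) :
    (v, v + (∑ i, ν i) • e) ∈ infinityFaces f := by
  have hv1 := hpoly.fst_nonneg_of_mem_supp hf.left_mem
  have hv2 := snd_nonneg_of_mem_supp hf.left_mem
  have hpos1 : 0 < e.1 + v.1 := add_pos_of_pos_of_nonneg hf.fst_pos hv1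
  have hw := hf.right_mem_verticesInfInf hpoly he
  rcases hdet.lt_or_gt with hdet | hdet
  · have he2 : 0 < e.2 := by
      refine he.lt_of_ne' fun h0 => ?_
      rw [h0] at hdet
      linarith [mul_nonneg hf.fst_pos.le hv2]
    refine hf.mem_infinityFaces_of_snd he2 ?_ hw
    exact hf.left_mem_vertices_insert_zero (isRay_Iic (s := -(e.2 + v.2)) (by linarith))
      (isRay_Ici hpos1) (by linarith) (by linarith)
  · have hpos2 : 0 < e.2 + v.2 := by
      refine (add_nonneg he hv2).lt_of_ne' fun h0 => ?_
      have he0 : e.2 = 0 := by linarith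
      have hv0 : v.2 = 0 := by linarith
      simp [he0, hv0] at hdet
    refine hf.mem_infinityFaces_of_fst hv1 (Or.inl ?_) hw
    exact hf.left_mem_vertices_insert_zero (isRay_Ici hpos2)
      (isRay_Iic (neg_neg_of_pos hpos1)) (by linarith) (by linarith)

theorem mem_infinityFaces (hf : IsEdgePoly f v e μ ν) (hpoly : IsPoly f)
    (hdet : e.1 * v.2 - e.2 * v.1 ≠ 0) : (v, v + (∑ i, ν i) • e) ∈ infinityFaces f :=
  (lt_or_ge e.2 0).elim (hf.mem_infinityFaces_of_snd_neg hpoly)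
    fun he => hf.mem_infinityFaces_of_snd_nonneg hpoly he hdet

end IsEdgePoly

open CompactSupp

/-! ### Quasi-homogeneous polynomials and monomials -/

theorem isEdgePoly_formDiff (a : ℤ) (b : ℕ) {p q r : ℕ} {μ : Fin r → ℂ} {ν : Fin r → ℕ}
    (hq : 0 < q) (hpq : Nat.Coprime p q) (hr : 0 < r) (hμ : ∀ i, μ i ≠ 0) (hν : ∀ i, 0 < ν i) :
    IsEdgePoly (formDiff a b p q μ ν) (a, b + p * ∑ i, (ν i : ℤ)) (q, -p) μ ν := by
  have hco : IsCoprime (q : ℤ) ((0 : ℕ) - p) := by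
    simpa only [Nat.cast_zero, zero_sub] using (Nat.isCoprime_iff_coprime.2 hpq).symm.neg_right
  have hf := isEdgePoly_binomialForm (a := a) (b := b) hq hco hr hμ hν
  rwa [Nat.cast_zero, zero_sub] at hf

theorem isEdgePoly_formProd (a : ℤ) (b : ℕ) {p q r : ℕ} {μ : Fin r → ℂ} {ν : Fin r → ℕ}
    (hq : 0 < q) (hpq : Nat.Coprime p q) (hr : 0 < r) (hμ : ∀ i, μ i ≠ 0) (hν : ∀ i, 0 < ν i) :
    IsEdgePoly (formProd a b p q μ ν) (a, b) (q, p) μ ν := by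
  have hco : IsCoprime (q : ℤ) (p - (0 : ℕ)) := by
    simpa using (Nat.isCoprime_iff_coprime.2 hpq).symm
  have hf := isEdgePoly_binomialForm (a := a) (b := b) hq hco hr hμ hν
  rwa [Nat.cast_zero, sub_zero, zero_mul, add_zero] at hf

namespace IsEdgePoly

variable {f : LaurentPoly} {v e : ℤ × ℤ} {r : ℕ} {μ : Fin r → ℂ} {ν : Fin r → ℕ}

theorem torusFiber_eq (hf : IsEdgePoly f v e μ ν) : torusFiber f = {z ∈ torus |
    z.1 ^ v.1 * z.2 ^ v.2 * (rootPoly μ ν).eval (z.1 ^ e.1 * z.2 ^ e.2) = 1} := by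
  ext z
  simp only [torusFiber, torus, Set.mem_ofPred_eq, Set.mem_prod, Set.mem_compl_singleton_iff,
    and_assoc]
  exact and_congr_right fun hx => and_congr_right fun hy => by rw [hf.eval_eq _ _ hx hy]

theorem hasEulerChar_torusFiber (hf : IsEdgePoly f v e μ ν)
    (hinj : Function.Injective μ) (hμ : ∀ i, μ i ≠ 0) (hν : ∀ i, 0 < ν i) :
    HasEulerChar (torusFiber f) (-(|((e.1 * v.2 - e.2 * v.1 : ℤ) : ℝ)| * r)) := by
  have hr : 0 < r := by
    refine Nat.pos_of_ne_zero ?_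
    rintro rfl
    simpa using hf.length_pos
  have hroots : {t | t ≠ 0 ∧ (rootPoly μ ν).IsRoot t} = Set.range μ := by
    ext t
    simp only [isRoot_rootPoly_iff hν, Set.mem_ofPred_eq, and_iff_right_iff_imp]
    rintro ⟨i, rfl⟩
    exact hμ i
  have hcurve := hasEulerChar_torus_curve v.1 v.2 hf.coprime monic_rootPoly.ne_zero
    ⟨μ ⟨0, hr⟩, hμ _, (isRoot_rootPoly_iff hν).2 ⟨_, rfl⟩⟩
  rwa [hroots, Set.ncard_range_of_injective hinj, Nat.card_fin, ← hf.torusFiber_eq] at hcurve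

theorem hasEulerChar_triangleArea (hf : IsEdgePoly f v e μ ν)
    (hinj : Function.Injective μ) (hμ : ∀ i, μ i ≠ 0) (hν : ∀ i, 0 < ν i) {u u' : ℤ × ℤ}
    (hu : |u.1 * u'.2 - u.2 * u'.1| = |(∑ i, ν i : ℕ) * (e.1 * v.2 - e.2 * v.1)|) :
    HasEulerChar (torusFiber f) (-(2 * r * triangleArea u u' / ∑ i, (ν i : ℝ))) := by
  convert hf.hasEulerChar_torusFiber hinj hμ hν using 2
  have hn : ∑ i, (ν i : ℝ) ≠ 0 := by exact_mod_cast hf.length_pos.ne'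
  rw [triangleArea_eq, ← Int.cast_abs, hu, abs_mul, Nat.abs_cast]
  push_cast
  field_simp

theorem hasEulerChar_areaWrt (hf : IsEdgePoly f v e μ ν)
    (hinj : Function.Injective μ) (hμ : ∀ i, μ i ≠ 0) (hν : ∀ i, 0 < ν i)
    {F : Set ((ℤ × ℤ) × (ℤ × ℤ))}
    (hF : ∀ γ ∈ F, γ = (v, v + (∑ i, ν i) • e) ∨ faceArea γ = 0)
    (hmem : e.1 * v.2 - e.2 * v.1 ≠ 0 → (v, v + (∑ i, ν i) • e) ∈ F) :
    HasEulerChar (torusFiber f) (-(2 * areaWrt F f)) := by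
  convert hf.hasEulerChar_torusFiber hinj hμ hν using 2
  rw [hf.areaWrt_eq hinj hμ hν hF hmem]
  ring

theorem hasEulerChar_areaWrt_singleton (hf : IsEdgePoly f v e μ ν)
    (hinj : Function.Injective μ) (hμ : ∀ i, μ i ≠ 0) (hν : ∀ i, 0 < ν i) :
    HasEulerChar (torusFiber f) (-(2 * areaWrt {(v, v + (∑ i, ν i) • e)} f)) :=
  hf.hasEulerChar_areaWrt hinj hμ hν (fun _ => Or.inl) fun _ => rfl

theorem hasEulerChar_areaWrt_infinityFaces (hf : IsEdgePoly f v e μ ν) (hpoly : IsPoly f)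
    (hinj : Function.Injective μ) (hμ : ∀ i, μ i ≠ 0) (hν : ∀ i, 0 < ν i) :
    HasEulerChar (torusFiber f) (-(2 * areaWrt (infinityFaces f) f)) :=
  hf.hasEulerChar_areaWrt hinj hμ hν hf.eq_or_faceArea_eq_zero_of_mem_infinityFaces
    (hf.mem_infinityFaces hpoly)

end IsEdgePoly

theorem fiber_term (a : ℤ) {b : ℕ} (hb : b ≠ 0) :
    fiber (term 1 a b) = torusFiber (term 1 a b) := by
  ext ⟨x, y⟩
  simp only [fiber, torusFiber, Set.mem_ofPred_eq, eval_term_one]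
  refine and_congr_right fun _ => (and_iff_right_of_imp ?_).symm
  rintro h rfl
  simp [hb] at h

theorem affineFiber_term {a : ℤ} (ha : a ≠ 0) (b : ℕ) :
    affineFiber (term 1 a b) = fiber (term 1 a b) := by
  ext ⟨x, y⟩
  simp only [fiber, affineFiber, Set.mem_ofPred_eq, eval_term_one]
  refine (and_iff_right_of_imp ?_).symm
  rintro h rfl
  simp [zero_zpow a ha] at h

theorem hasEulerChar_torusFiber_term (a : ℤ) {b : ℕ} (hb : b ≠ 0) :
    HasEulerChar (torusFiber (term 1 a b)) 0 := by
  have hset : torusFiber (term 1 a b) = {z ∈ torus | z.1 ^ a * z.2 ^ (b : ℤ) = 1} := by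
    ext z
    simp [torusFiber, torus, eval_term_one, and_assoc]
  rw [hset]
  exact hasEulerChar_torus_monomial a (Nat.cast_ne_zero.2 hb)

end NewtonPolygon

open CompactSupp NewtonPolygon in
theorem mainTheorem11 :
    (∀ (a : ℤ) (b : ℕ), a ≠ 0 → b ≠ 0 →
      HasEulerChar (torusFiber (term 1 a b)) 0 ∧
      HasEulerChar (fiber (term 1 a b)) 0 ∧
      (IsPoly (term 1 a b) → HasEulerChar (affineFiber (term 1 a b)) 0)) ∧
    (∀ (a : ℤ) (b p q r : ℕ) (μ : Fin r → ℂ) (ν : Fin r → ℕ),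
      0 < p → 0 < q → Nat.Coprime p q → 0 < r →
      Function.Injective μ → (∀ i, μ i ≠ 0) → (∀ i, 0 < ν i) →
      (HasEulerChar (torusFiber (formDiff a b p q μ ν))
          (-(2 * r * triangleArea (a + q * ∑ i, (ν i : ℤ), b) (a, b + p * ∑ i, (ν i : ℤ)) /
            ∑ i, (ν i : ℝ))) ∧
        HasEulerChar (torusFiber (formDiff a b p q μ ν))
          (-(2 * areaWrt (originFaces (formDiff a b p q μ ν)) (formDiff a b p q μ ν))) ∧
        (IsPoly (formDiff a b p q μ ν) →
          HasEulerChar (torusFiber (formDiff a b p q μ ν))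
            (-(2 * areaWrt (infinityFaces (formDiff a b p q μ ν)) (formDiff a b p q μ ν))))) ∧
      (HasEulerChar (torusFiber (formProd a b p q μ ν))
          (-(2 * r * triangleArea (a, b)
              (a + q * ∑ i, (ν i : ℤ), b + p * ∑ i, (ν i : ℤ)) /
            ∑ i, (ν i : ℝ))) ∧
        HasEulerChar (torusFiber (formProd a b p q μ ν))
          (-(2 * areaWrt (globalFaces (formProd a b p q μ ν)) (formProd a b p q μ ν))) ∧
        (IsPoly (formProd a b p q μ ν) →
          HasEulerChar (torusFiber (formProd a b p q μ ν))
            (-(2 * areaWrt (infinityFaces (formProd a b p q μ ν)) (formProd a b p q μ ν)))))) := by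
  refine ⟨fun a b ha hb => ?_, fun a b p q r μ ν hp hq hpq hr hinj hμ hν => ⟨?_, ?_⟩⟩
  · have h := hasEulerChar_torusFiber_term a hb
    rw [affineFiber_term ha, fiber_term a hb]
    exact ⟨h, h, fun _ => h⟩
  · have hf := isEdgePoly_formDiff a b hq hpq hr hμ hν
    refine ⟨hf.hasEulerChar_triangleArea hinj hμ hν ?_, ?_,
      fun hpoly => hf.hasEulerChar_areaWrt_infinityFaces hpoly hinj hμ hν⟩
    · congr 1
      push_cast
      ring
    · rw [hf.originFaces_eq (by simpa using hp)]
      exact hf.hasEulerChar_areaWrt_singleton hinj hμ hν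
  · have hf := isEdgePoly_formProd a b hq hpq hr hμ hν
    refine ⟨hf.hasEulerChar_triangleArea hinj hμ hν ?_, ?_,
      fun hpoly => hf.hasEulerChar_areaWrt_infinityFaces hpoly hinj hμ hν⟩
    · rw [← abs_neg]
      congr 1
      push_cast
      ring
    · rw [hf.globalFaces_eq]
      exact hf.hasEulerChar_areaWrt_singleton hinj hμ hν
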